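/- **Definitions.** A *lattice polygon* is a two-dimensional convex hull of finitely many points of $\mathbb Z^2$ in $\mathbb R^2$; it is *Delzant* if at every vertex the primitive lattice vectors along its edges form a basis of $\mathbb Z^2$. For a lattice polygon $P$, let $\mathrm{Vol}(P)$ be its area, let $dv$ be Lebesgue measure on $\mathbb R^2$, and let $d\sigma$ be the measure on $\partial P$ that on each edge is Lebesgue measure normalized so that a primitive lattice vector has length $1$. For an integer $i\ge 1$ put $$E_P(i)=\#\bigl(P\cap(\mathbb Z/i)^2\bigr),\qquad \boldsymbol s_P(i)=\sum_{\boldsymbol a\in P\cap(\mathbb Z/i)^2}\boldsymbol a,\qquad \mathrm{Chow}_P(\boldsymbol x;i)=\mathrm{Vol}(P)\,\boldsymbol s_P(i)-E_P(i)\int_P\boldsymbol x\,dv .$$ When $\boldsymbol s_P(i)$ is given for all $i\ge1$ by a (necessarily unique) $\mathbb R^2$-valued polynomial in $i$, the lattice-sum polynomial of $P$, let $\boldsymbol s_P$ denote its constant term. **Theorem.** Let $\Delta\subset\mathbb R^2$ be a lattice Delzant polygon with a decomposition $\Delta=\Delta'\cup D_1\cup\dots\cup D_\ell$ such that: there is a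 positive integer $n$ for which $n\Delta'$ is a lattice Delzant polygon, and $k$ is the least such integer; each $D_a$ is a two-dimensional simplex (triangle) containing exactly one vertex $\boldsymbol p_a$ of $\Delta$; $D_a\cap\Delta'=\partial D_a\cap\Delta'$ for every $a$; and $D_a\cap D_b=\emptyset$ for $a\ne b$. Let $\boldsymbol u_a=(\alpha_a,\beta_a)$ and $\boldsymbol v_a=(\gamma_a,\delta_a)$ be the primitive generators of the edges of $\Delta$ emanating from $\boldsymbol p_a$, ordered so that $\alpha_a\delta_a-\gamma_a\beta_a=1$. Then the lattice-sum polynomial of $k\Delta$ exists; there are unique positive integers $m_1,\dots,m_\ell$ such that $$D_a=\mathrm{conv}\Bigl\{\boldsymbol p_a,\ \boldsymbol p_a+\tfrac{m_a}{k}\boldsymbol u_a,\ \boldsymbol p_a+\tfrac{m_a}{k}\boldsymbol v_a\Bigr\}\qquad(a=1,\dots,\ell);$$ and for every positive integer $i$ $$\mathrm{Chow}_{k\Delta'}(\boldsymbol x;i)=\mathrm{Chow}_{k\Delta}(\boldsymbol x;i)+i\,\mathcal{DF}_{k\Delta,1}+\mathcal{DF}_{k\Delta,2},$$ where, with $M=\sum_a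 m_a$, $\widetilde M=\sum_a m_a^2$, $A=\#(\partial(k\Delta)\cap\mathbb Z^2)-M$ and $B=2\,\mathrm{Vol}(k\Delta)-\widetilde M$, $$\mathcal{DF}_{k\Delta,1}=\frac{A}{12}\sum_a m_a^3(\boldsymbol u_a+\boldsymbol v_a)+\frac k4\Bigl(A\sum_a m_a^2\boldsymbol p_a-B\sum_a m_a\boldsymbol p_a\Bigr)+\frac M2\int_{k\Delta}\boldsymbol x\,dv-\frac{\widetilde M}{4}\int_{\partial(k\Delta)}\boldsymbol x\,d\sigma,$$ $$\mathcal{DF}_{k\Delta,2}=\frac{B}{12}\sum_a m_a(\boldsymbol u_a+\boldsymbol v_a)+\frac16\sum_a m_a^3(\boldsymbol u_a+\boldsymbol v_a)+\frac k2\sum_a m_a^2\boldsymbol p_a-\frac{\widetilde M}{2}\,\boldsymbol s_{k\Delta}.$$ -/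

import Mathlib

open MeasureTheory Set
open scoped Pointwise Polynomial

noncomputable section

namespace ChowBlowUp

/-- The plane `ℝ²`. -/
abbrev Plane : Type := Fin 2 → ℝ

/-- The real vector with the given integer coordinates; the lattice `ℤ²` is the range. -/
def toPlane (w : Fin 2 → ℤ) : Plane := fun j => (w j : ℝ)

/-- A lattice polygon: the convex hull of finitely many lattice points, of full dimension. -/
def IsLatticePolygon (P : Set Plane) : Prop :=
  (∃ S : Finset (Fin 2 → ℤ), P = convexHull ℝ (toPlane '' (S : Set (Fin 2 → ℤ)))) ∧
    (interior P).Nonempty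

/-- The primitive lattice generators of the edges of `P` emanating from the point `p`: an edge is a
nondegenerate segment that is a face of `P`. -/
def edgeVectors (P : Set Plane) (p : Plane) : Set (Fin 2 → ℤ) :=
  {w | IsCoprime (w 0) (w 1) ∧
    ∃ t : ℝ, 0 < t ∧ IsExposed ℝ P (segment ℝ p (p + t • toPlane w))}

/-- `u, v` are the primitive generators of the edges of `P` at `p`, they form a basis of `ℤ²`, and
they are ordered so that the matrix with columns `u, v` has determinant `1`. -/
def IsOrientedEdgeBasis (P : Set Plane) (p : Plane) (u v : Fin 2 → ℤ) : Prop :=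
  edgeVectors P p = {u, v} ∧ u 0 * v 1 - v 0 * u 1 = 1

/-- A lattice Delzant polygon: at every vertex the primitive generators of the edges form a basis
of `ℤ²`. -/
def IsDelzantPolygon (P : Set Plane) : Prop :=
  IsLatticePolygon P ∧
    ∀ p ∈ P.extremePoints ℝ, ∃ u v : Fin 2 → ℤ, IsOrientedEdgeBasis P p u v

/-- A two-dimensional simplex (nondegenerate closed triangle). -/
def IsTriangle (D : Set Plane) : Prop :=
  ∃ z : Fin 3 → Plane, AffineIndependent ℝ z ∧ D = convexHull ℝ (Set.range z)

/-- The area `Vol(P)`. -/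
def area (P : Set Plane) : ℝ := volume.real P

/-- The vector `∫_P x dv`. -/
def moment (P : Set Plane) : Plane := ∫ x in P, x

/-- The integer vectors `a` with `a / i ∈ P`; they index the points of `P ∩ (ℤ/i)²`. -/
def scaledLatticePoints (P : Set Plane) (i : ℕ) : Set (Fin 2 → ℤ) :=
  {a | (i : ℝ)⁻¹ • toPlane a ∈ P}

/-- `E_P(i)`, the number of points of `P ∩ (ℤ/i)²`. -/
def ehrhart (P : Set Plane) (i : ℕ) : ℕ := (scaledLatticePoints P i).ncard

/-- `s_P(i)`, the sum of the points of `P ∩ (ℤ/i)²`. -/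
def latticeSum (P : Set Plane) (i : ℕ) : Plane :=
  ∑ᶠ a ∈ scaledLatticePoints P i, (i : ℝ)⁻¹ • toPlane a

/-- The Chow weight `Chow_P(x; i) = Vol(P) s_P(i) - E_P(i) ∫_P x dv`. -/
def chow (P : Set Plane) (i : ℕ) : Plane :=
  area P • latticeSum P i - (ehrhart P i : ℝ) • moment P

/-- The number of lattice points on the boundary of `P`. -/
def boundaryCount (P : Set Plane) : ℕ := {a : Fin 2 → ℤ | toPlane a ∈ frontier P}.ncard

/-- The edges of `P`, each listed exactly once when `P` is a lattice polygon: the triple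
`(p, w, t)` stands for the edge from `p` to `p + t w`, traversed counterclockwise, where `w` is a
primitive lattice vector and `t > 0`. -/
def orientedEdges (P : Set Plane) : Set (Plane × (Fin 2 → ℤ) × ℝ) :=
  {e | IsCoprime (e.2.1 0) (e.2.1 1) ∧ 0 < e.2.2 ∧
    IsExposed ℝ P (segment ℝ e.1 (e.1 + e.2.2 • toPlane e.2.1)) ∧
    ∀ x ∈ P, 0 ≤ (e.2.1 0 : ℝ) * (x 1 - e.1 1) - (e.2.1 1 : ℝ) * (x 0 - e.1 0)}

/-- The boundary measure `dσ` of a lattice polygon. On the edge from `p` to `p + t w` with `w`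
primitive, the primitive defining function is `h(x) = det(w, x - p)`; in the coordinates
`x = p + s w + r w'` with `det(w, w') = 1` one has `h = r` and `dv = ds ∧ dh`, so `dσ` is the image
of the Lebesgue measure `ds` on `[0, t]`. -/
def boundaryMeasure (P : Set Plane) : Measure Plane :=
  Measure.sum fun e : orientedEdges P =>
    (volume.restrict (Icc (0 : ℝ) e.1.2.2)).map fun s : ℝ => e.1.1 + s • toPlane e.1.2.1

/-- The vector `∫_{∂P} x dσ`. -/
def boundaryMoment (P : Set Plane) : Plane := ∫ x, x ∂(boundaryMeasure P)

/-- `q` is the (`ℝ²`-valued) lattice-sum polynomial of `P`: its value at every positive integer `i`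
is `s_P(i)`. -/
def IsLatticeSumPolynomial (P : Set Plane) (q : Fin 2 → ℝ[X]) : Prop :=
  ∀ i : ℕ, 0 < i → ∀ j, (q j).eval (i : ℝ) = latticeSum P i j

theorem IsLatticeSumPolynomial.unique {P : Set Plane} {q r : Fin 2 → ℝ[X]}
    (hq : IsLatticeSumPolynomial P q) (hr : IsLatticeSumPolynomial P r) : q = r := by
  funext j
  refine Polynomial.eq_of_infinite_eval_eq _ _ ?_
  refine Set.Infinite.mono (s := (fun n : ℕ => (n : ℝ)) '' Set.Ioi 0) ?_ ?_
  · rintro _ ⟨n, hn, rfl⟩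
    change (q j).eval _ = (r j).eval _
    rw [hq n hn j, hr n hn j]
  · exact (Set.Ioi_infinite 0).image (Nat.cast_injective.injOn)

open Classical in
/-- The lattice-sum polynomial of `P` (zero if there is none); it is unique when it exists. -/
def latticeSumPolynomial (P : Set Plane) : Fin 2 → ℝ[X] :=
  if h : ∃ q, IsLatticeSumPolynomial P q then h.choose else 0

/-- The constant term `s_P` of the lattice-sum polynomial. -/
def latticeSumConst (P : Set Plane) : Plane := fun j => (latticeSumPolynomial P j).coeff 0

/-- The decomposition `Δ = Δ' ∪ D_1 ∪ … ∪ D_ℓ` that chops off the corners `D_a` at the vertices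
`p_a` of the lattice Delzant polygon `Δ`, where `k` is the least positive integer for which `kΔ'`
is a lattice Delzant polygon. -/
structure IsCornerDecomposition {ℓ : ℕ} (Δ Δ' : Set Plane) (D : Fin ℓ → Set Plane)
    (p : Fin ℓ → Plane) (k : ℕ) : Prop where
  delzant : IsDelzantPolygon Δ
  least : IsLeast {n : ℕ | 0 < n ∧ IsDelzantPolygon ((n : ℝ) • Δ')} k
  eq_union : Δ = Δ' ∪ ⋃ a, D a
  triangle : ∀ a, IsTriangle (D a)
  unique_vertex : ∀ a, Δ.extremePoints ℝ ∩ D a = {p a}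
  inter : ∀ a, D a ∩ Δ' = frontier (D a) ∩ Δ'
  disjoint : ∀ a b, a ≠ b → D a ∩ D b = ∅

/-- The integers `m_a > 0` with `D_a = conv {p_a, p_a + (m_a / k) u_a, p_a + (m_a / k) v_a}`. -/
def IsCornerSize {ℓ : ℕ} (D : Fin ℓ → Set Plane) (p : Fin ℓ → Plane) (k : ℕ)
    (u v : Fin ℓ → Fin 2 → ℤ) (m : Fin ℓ → ℕ) : Prop :=
  ∀ a, 0 < m a ∧ D a = convexHull ℝ
    {p a, p a + ((m a : ℝ) / k) • toPlane (u a), p a + ((m a : ℝ) / k) • toPlane (v a)}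

section Invariants

/-- `M = ∑ m_a`. -/
def sumM {ℓ : ℕ} (m : Fin ℓ → ℕ) : ℝ := ∑ a, (m a : ℝ)

/-- The sum `∑ m_a²`. -/
def sumMSq {ℓ : ℕ} (m : Fin ℓ → ℕ) : ℝ := ∑ a, (m a : ℝ) ^ 2

/-- `A = #(∂P ∩ ℤ²) - M`. -/
def invA {ℓ : ℕ} (P : Set Plane) (m : Fin ℓ → ℕ) : ℝ := (boundaryCount P : ℝ) - sumM m

/-- `B = 2 Vol(P) - ∑ m_a²`. -/
def invB {ℓ : ℕ} (P : Set Plane) (m : Fin ℓ → ℕ) : ℝ := 2 * area P - sumMSq m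

/-- The vector `DF_{kΔ,1}`, for `u a = (α_a, β_a)` and `v a = (γ_a, δ_a)`. -/
def DF1 {ℓ : ℕ} (Δ : Set Plane) (k : ℕ) (m : Fin ℓ → ℕ) (p : Fin ℓ → Plane)
    (u v : Fin ℓ → Fin 2 → ℤ) : Plane :=
  (invA ((k : ℝ) • Δ) m / 12) • ∑ a, (m a : ℝ) ^ 3 • (toPlane (u a) + toPlane (v a))
    + ((k : ℝ) / 4) • (invA ((k : ℝ) • Δ) m • ∑ a, (m a : ℝ) ^ 2 • p a
        - invB ((k : ℝ) • Δ) m • ∑ a, (m a : ℝ) • p a)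
    + (sumM m / 2) • moment ((k : ℝ) • Δ)
    - (sumMSq m / 4) • boundaryMoment ((k : ℝ) • Δ)

/-- The vector `DF_{kΔ,2}`, for `u a = (α_a, β_a)` and `v a = (γ_a, δ_a)`. -/
def DF2 {ℓ : ℕ} (Δ : Set Plane) (k : ℕ) (m : Fin ℓ → ℕ) (p : Fin ℓ → Plane)
    (u v : Fin ℓ → Fin 2 → ℤ) : Plane :=
  (invB ((k : ℝ) • Δ) m / 12) • ∑ a, (m a : ℝ) • (toPlane (u a) + toPlane (v a))
    + (1 / 6 : ℝ) • ∑ a, (m a : ℝ) ^ 3 • (toPlane (u a) + toPlane (v a))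
    + ((k : ℝ) / 2) • ∑ a, (m a : ℝ) ^ 2 • p a
    - (sumMSq m / 2) • latticeSumConst ((k : ℝ) • Δ)

end Invariants

end ChowBlowUp

end

/-! The weight `chow` is the area times the lattice sum minus the lattice point count times the
moment, and all four quantities are additive over disjoint pieces. Passing from kΔ to kΔ' removes
one triangle at each chosen vertex, without its third side, which stays with kΔ'. These half-open
triangles are disjoint from each other and from kΔ', so it suffices to know the four quantities of
each triangle and the polynomials in i that give the count and the lattice sum of kΔ.

Shape of a corner. A line separates the interior of D_a from Δ'. The part of Δ strictly beyond that
line is convex, hence connected, and is covered by the disjoint closed triangles, so it lies in D_a;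
thus D_a is exactly the part of Δ cut off by the line (`exists_cut`). Since p_a is the only vertex
of Δ in D_a, the other two corners of D_a lie on the line and on the two edges at p_a
(`corner_shape`). After scaling by k they are vertices of kΔ', hence lattice points, so the sides
are m/k and m'/k for positive integers m, m'. At such a vertex kΔ' has an edge along the old edge
and one along the cut. The Delzant condition there forces m' ∣ m, at the other vertex m ∣ m'
(`dvd_of_delzant`), so m = m'. As (u_a, v_a) is a lattice basis, the lattice points of the removed
triangle have natural coordinates with sum less than m_a i, which gives its count and sum by
elementary summation.

Polynomials of a lattice polygon. Fan the polygon out from a vertex into half-open triangles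
(`eq_union_fanPiece`). A dilated half-open triangle is tiled by translates of itself and of the
complementary half of its half-open parallelogram (`halfTri_eq`). A point reflection compares the
two halves up to lattice points on sides, which determines the leading coefficients
(`ncard_halfTri_eq`, `exists_sum_halfTri_eq`). Contributions of the inner sides of the fan telescope
around the boundary. This gives Ehrhart's formula and a quadratic lattice-sum polynomial with
leading coefficients the moment and half the boundary moment (`exists_latticeSum_const`).

Conclusion. In the Chow weight of kΔ and of kΔ' alike the i² terms cancel, because the i²
coefficients of count and sum are the area and the moment. The difference of the two weights is
therefore affine in i, and its coefficients are DF1 and DF2 (`chow_cut`). -/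

noncomputable section

namespace ChowBlowUp

/-! ### Determinants and linear functionals of the plane -/

/-- The determinant of two vectors of the plane. -/
def cross (x y : Plane) : ℝ := x 0 * y 1 - x 1 * y 0

/-- The determinant of two integer vectors. -/
def crossZ (x y : Fin 2 → ℤ) : ℤ := x 0 * y 1 - x 1 * y 0

lemma cross_toPlane (x y : Fin 2 → ℤ) : cross (toPlane x) (toPlane y) = crossZ x y := by
  simp [cross, crossZ, toPlane]

lemma plane_ext {x y : Plane} (h0 : x 0 = y 0) (h1 : x 1 = y 1) : x = y := by
  funext j; fin_cases j <;> assumption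

lemma int_ext {x y : Fin 2 → ℤ} (h0 : x 0 = y 0) (h1 : x 1 = y 1) : x = y := by
  funext j; fin_cases j <;> assumption

lemma toPlane_injective : Function.Injective toPlane := by
  intro x y h
  funext j
  have := congrFun h j
  simpa [toPlane] using this

@[simp] lemma toPlane_add (x y : Fin 2 → ℤ) : toPlane (x + y) = toPlane x + toPlane y := by
  funext j; simp [toPlane]

@[simp] lemma toPlane_sub (x y : Fin 2 → ℤ) : toPlane (x - y) = toPlane x - toPlane y := by
  funext j; simp [toPlane]

@[simp] lemma toPlane_neg (x : Fin 2 → ℤ) : toPlane (-x) = -toPlane x := by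
  funext j; simp [toPlane]

@[simp] lemma toPlane_zero : toPlane 0 = 0 := by
  funext j; simp [toPlane]

@[simp] lemma toPlane_zsmul (n : ℤ) (x : Fin 2 → ℤ) : toPlane (n • x) = (n : ℝ) • toPlane x := by
  funext j; simp [toPlane]

lemma toPlane_ne_zero {w : Fin 2 → ℤ} (hw : IsCoprime (w 0) (w 1)) : toPlane w ≠ 0 := by
  intro h
  rw [← toPlane_zero] at h
  have := toPlane_injective h
  subst this
  simp [isCoprime_zero_left] at hw

lemma normSq_pos {d : Plane} (hd : d ≠ 0) : 0 < d 0 * d 0 + d 1 * d 1 := by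
  by_contra h
  apply hd
  apply plane_ext
  · simp; nlinarith [mul_self_nonneg (d 0), mul_self_nonneg (d 1)]
  · simp; nlinarith [mul_self_nonneg (d 0), mul_self_nonneg (d 1)]

lemma cross_eq_zero {d y : Plane} (hd : d ≠ 0) (h : cross d y = 0) : ∃ c : ℝ, y = c • d := by
  have hn := (normSq_pos hd).ne'
  unfold cross at h
  refine ⟨(d 0 * y 0 + d 1 * y 1) / (d 0 * d 0 + d 1 * d 1), plane_ext ?_ ?_⟩
  · rw [Pi.smul_apply, smul_eq_mul, div_mul_eq_mul_div, eq_div_iff hn]; linear_combination (-d 1) * h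
  · rw [Pi.smul_apply, smul_eq_mul, div_mul_eq_mul_div, eq_div_iff hn]; linear_combination (d 0) * h

lemma cross_self (x : Plane) : cross x x = 0 := by simp [cross]; ring
lemma cross_add_right (x y z : Plane) : cross x (y + z) = cross x y + cross x z := by
  simp [cross]; ring
lemma cross_sub_right (x y z : Plane) : cross x (y - z) = cross x y - cross x z := by
  simp [cross]; ring
lemma cross_smul_right (x y : Plane) (c : ℝ) : cross x (c • y) = c * cross x y := by
  simp [cross]; ring
lemma cross_add_left (x y z : Plane) : cross (x + y) z = cross x z + cross y z := by
  simp [cross]; ring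
lemma cross_sub_left (x y z : Plane) : cross (x - y) z = cross x z - cross y z := by
  simp [cross]; ring
lemma cross_smul_left (x y : Plane) (c : ℝ) : cross (c • x) y = c * cross x y := by
  simp [cross]; ring
lemma cross_swap (x y : Plane) : cross x y = - cross y x := by
  simp [cross]; ring
lemma cross_neg_left (x y : Plane) : cross (-x) y = - cross x y := by
  simp [cross]; ring
lemma cross_zero_left (y : Plane) : cross 0 y = 0 := by simp [cross]
lemma cross_zero_right (y : Plane) : cross y 0 = 0 := by simp [cross]

/-- The functional `cross d`, as a continuous linear map. -/
def crossCLM (d : Plane) : Plane →L[ℝ] ℝ :=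
  d 0 • ContinuousLinearMap.proj 1 - d 1 • ContinuousLinearMap.proj 0

@[simp] lemma crossCLM_apply (d x : Plane) : crossCLM d x = cross d x := by
  simp [crossCLM, cross]

lemma exists_cross_eq (f : Plane →L[ℝ] ℝ) : ∃ d : Plane, ∀ x, f x = cross d x := by
  refine ⟨![f (Pi.single 1 1), - f (Pi.single 0 1)], fun x => ?_⟩
  have hx : x = x 0 • Pi.single (M := fun _ => ℝ) (0 : Fin 2) (1 : ℝ) + x 1 • Pi.single (M := fun _ => ℝ) (1 : Fin 2) (1 : ℝ) := by
    apply plane_ext <;> simp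
  conv_lhs => rw [hx]
  simp only [map_add, map_smul, smul_eq_mul, cross]
  simp
  ring

/-! ### Convexity: supporting lines and exposed segments -/

namespace IsLatticePolygon

variable {P : Set Plane} 

lemma convex (hP : IsLatticePolygon P) : Convex ℝ P := by
  obtain ⟨⟨S, rfl⟩, -⟩ := hP
  exact convex_convexHull ℝ _

lemma isCompact (hP : IsLatticePolygon P) : IsCompact P := by
  obtain ⟨⟨S, rfl⟩, -⟩ := hP
  exact (S.finite_toSet.image _).isCompact_convexHull ℝ

lemma exists_of_extreme (hP : IsLatticePolygon P) {x : Plane} (hx : x ∈ P.extremePoints ℝ) :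
    ∃ n : Fin 2 → ℤ, toPlane n = x := by
  obtain ⟨⟨S, rfl⟩, -⟩ := hP
  have h : x ∈ toPlane '' (S : Set (Fin 2 → ℤ)) := extremePoints_convexHull_subset hx
  obtain ⟨n, -, rfl⟩ := h
  exact ⟨n, rfl⟩

end IsLatticePolygon

lemma exists_pos_add_smul_mem {P : Set Plane} {z : Plane} (hz : z ∈ interior P) (d : Plane) :
    ∃ r : ℝ, 0 < r ∧ z + r • d ∈ P := by
  have hcont : Filter.Tendsto (fun r : ℝ => z + r • d) (nhds 0) (nhds z) := by
    have : Continuous (fun r : ℝ => z + r • d) := by fun_prop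
    simpa using this.tendsto 0
  have hev := hcont.eventually (mem_interior_iff_mem_nhds.1 hz)
  obtain ⟨r, hr, hr0⟩ := ((hev.filter_mono nhdsWithin_le_nhds).and
    (self_mem_nhdsWithin : ∀ᶠ r in nhdsWithin (0:ℝ) (Ioi 0), r ∈ Ioi (0:ℝ))).exists
  exact ⟨r, hr0, hr⟩

/-- A nonzero functional `cross d` takes smaller values near an interior point. -/
lemma exists_cross_neg {P : Set Plane} {z : Plane} (hz : z ∈ interior P) {d : Plane} (hd : d ≠ 0) :
    ∃ y ∈ P, cross d (y - z) < 0 := by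
  obtain ⟨r, hr0, hr⟩ := exists_pos_add_smul_mem hz ![d 1, -d 0]
  refine ⟨_, hr, ?_⟩
  have h3 : cross d (z + r • ![d 1, -d 0] - z) = - (r * (d 0 * d 0 + d 1 * d 1)) := by
    simp only [cross, Pi.sub_apply, Pi.add_apply, Pi.smul_apply, smul_eq_mul, Matrix.cons_val_zero,
      Matrix.cons_val_one]
    ring
  rw [h3, neg_lt_zero]
  exact mul_pos hr0 (normSq_pos hd)

lemma exists_cross_ne {P : Set Plane} (hi : (interior P).Nonempty) {d : Plane} (hd : d ≠ 0)
    (x : Plane) : ∃ y ∈ P, cross d (y - x) ≠ 0 := by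
  obtain ⟨z, hz⟩ := hi
  by_contra! h
  obtain ⟨y, hy, h1⟩ := exists_cross_neg hz hd
  have h2 := h _ hy
  have h3 := h _ (interior_subset hz)
  simp only [cross_sub_right] at *
  linarith

/-- A compact convex set meets a line in a segment. -/
lemma exists_line_eq_Icc {P : Set Plane} (hc : Convex ℝ P) (hk : IsCompact P) {x d : Plane}
    (hx : x ∈ P) (hd : d ≠ 0) :
    ∃ r₀ r₁ : ℝ, r₀ ≤ 0 ∧ 0 ≤ r₁ ∧ ∀ r : ℝ, x + r • d ∈ P ↔ r₀ ≤ r ∧ r ≤ r₁ := by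
  set f : ℝ → Plane := fun r => x + r • d with hf
  have hfc : Continuous f := by fun_prop
  have hcl : IsClosed (f ⁻¹' P) := hk.isClosed.preimage hfc
  have hconv : Convex ℝ (f ⁻¹' P) := by
    intro a ha b hb s t hs ht hst
    have := hc ha hb hs ht hst
    have e : s • f a + t • f b = f (s • a + t • b) := by
      simp only [hf]
      have : x = s • x + t • x := by rw [← add_smul, hst, one_smul]
      conv_rhs => rw [this]
      simp only [smul_add, add_smul, smul_smul, smul_eq_mul]
      abel
    rw [e] at this
    exact this
  have hbdd : Bornology.IsBounded (f ⁻¹' P) := by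
    obtain ⟨C, hC⟩ := hk.isBounded.exists_norm_le
    have hdn : 0 < ‖d‖ := norm_pos_iff.2 hd
    refine (Metric.isBounded_closedBall (x := (0:ℝ)) (r := (C + ‖x‖) / ‖d‖)).subset ?_
    intro r hr
    have h1 := hC _ hr
    rw [Metric.mem_closedBall, dist_zero_right, le_div_iff₀ hdn, ← norm_smul]
    have : r • d = f r - x := by simp [hf]
    rw [this]
    exact (norm_sub_le _ _).trans (by linarith)
  have hkk : IsCompact (f ⁻¹' P) := Metric.isCompact_of_isClosed_isBounded hcl hbdd
  have h0 : (0:ℝ) ∈ f ⁻¹' P := by simp [hf, hx]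
  have := eq_Icc_of_connected_compact ⟨⟨0, h0⟩, hconv.isPreconnected⟩ hkk
  have key : ∀ r, r ∈ f ⁻¹' P ↔ sInf (f ⁻¹' P) ≤ r ∧ r ≤ sSup (f ⁻¹' P) := fun r => by
    conv_lhs => rw [this]
    rfl
  exact ⟨_, _, ((key 0).1 h0).1, ((key 0).1 h0).2, key⟩

lemma mem_segment_line {x d y : Plane} {r₀ r₁ : ℝ} (h : r₀ ≤ r₁) :
    y ∈ segment ℝ (x + r₀ • d) (x + r₁ • d) ↔ ∃ r, r₀ ≤ r ∧ r ≤ r₁ ∧ y = x + r • d := by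
  rw [segment_eq_image']
  constructor
  · rintro ⟨θ, ⟨h0, h1⟩, rfl⟩
    refine ⟨r₀ + θ * (r₁ - r₀), by nlinarith, by nlinarith, ?_⟩
    apply plane_ext <;> simp <;> ring
  · rintro ⟨r, h0, h1, rfl⟩
    rcases h.eq_or_lt with rfl | hlt
    · refine ⟨0, by simp, ?_⟩
      have : r = r₀ := le_antisymm h1 h0
      subst this
      apply plane_ext <;> simp
    · have : r₁ - r₀ ≠ 0 := by linarith
      refine ⟨(r - r₀) / (r₁ - r₀), ⟨div_nonneg (by linarith) (by linarith), ?_⟩, ?_⟩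
      · rw [div_le_one (by linarith)]; linarith
      · apply plane_ext <;> simp <;> field_simp <;> ring

/-- The end points of an exposed segment are extreme. -/
lemma left_mem_extremePoints {P : Set Plane} {x y : Plane} (h : IsExposed ℝ P (segment ℝ x y)) :
    x ∈ P.extremePoints ℝ := by
  apply h.isExtreme.extremePoints_subset_extremePoints
  rw [mem_extremePoints]
  refine ⟨left_mem_segment _ _ _, ?_⟩
  rw [segment_eq_image']
  rintro _ ⟨s, ⟨hs, -⟩, rfl⟩ _ ⟨t, ⟨ht, -⟩, rfl⟩ ⟨a, b, ha, hb, hab, he⟩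
  have h3 : (a * s + b * t) • (y - x) = 0 := by
    have hx' : x = a • x + b • x := by rw [← add_smul, hab, one_smul]
    have e : (a * s + b * t) • (y - x) =
        a • (x + s • (y - x)) + b • (x + t • (y - x)) - (a • x + b • x) := by
      generalize y - x = w
      simp only [smul_add, add_smul, smul_smul]; abel
    rw [e, ← hx']
    exact sub_eq_zero.2 he
  rcases smul_eq_zero.1 h3 with h4 | h4
  · have h5 : a * s = 0 := by nlinarith [mul_nonneg ha.le hs, mul_nonneg hb.le ht]
    have h6 : b * t = 0 := by nlinarith [mul_nonneg ha.le hs, mul_nonneg hb.le ht]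
    rw [(mul_eq_zero.1 h5).resolve_left ha.ne', (mul_eq_zero.1 h6).resolve_left hb.ne']
    simp
  · simp [h4]

/-- The part of a compact convex set on a supporting line is an exposed segment whose end points
are extreme. -/
lemma exists_exposed_segment {P : Set Plane} (hc : Convex ℝ P) (hk : IsCompact P) {x d : Plane}
    (hx : x ∈ P) (hd : d ≠ 0) (hs : ∀ y ∈ P, 0 ≤ cross d (y - x)) :
    ∃ r₀ r₁ : ℝ, r₀ ≤ 0 ∧ 0 ≤ r₁ ∧ (∀ r : ℝ, x + r • d ∈ P ↔ r₀ ≤ r ∧ r ≤ r₁) ∧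
      IsExposed ℝ P (segment ℝ (x + r₀ • d) (x + r₁ • d)) ∧
      x + r₀ • d ∈ P.extremePoints ℝ ∧ x + r₁ • d ∈ P.extremePoints ℝ := by
  obtain ⟨r₀, r₁, h0, h1, hr⟩ := exists_line_eq_Icc hc hk hx hd
  have hle : r₀ ≤ r₁ := h0.trans h1
  have hseg : segment ℝ (x + r₀ • d) (x + r₁ • d) = {y ∈ P | cross d (y - x) = 0} := by
    ext y
    rw [mem_segment_line hle]
    constructor
    · rintro ⟨r, hr0, hr1, rfl⟩
      refine ⟨(hr r).2 ⟨hr0, hr1⟩, ?_⟩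
      rw [add_sub_cancel_left, cross_smul_right, cross_self, mul_zero]
    · rintro ⟨hy, h⟩
      obtain ⟨c, hcd⟩ := cross_eq_zero hd h
      have : y = x + c • d := by rw [← hcd]; abel
      subst this
      obtain ⟨ha, hb⟩ := (hr c).1 hy
      exact ⟨c, ha, hb, rfl⟩
  have hexp : IsExposed ℝ P (segment ℝ (x + r₀ • d) (x + r₁ • d)) := by
    intro _
    refine ⟨-crossCLM d, ?_⟩
    rw [hseg]
    ext y
    constructor
    · rintro ⟨hy, h⟩
      refine ⟨hy, fun z hz => ?_⟩
      have := hs z hz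
      simp [cross_sub_right] at *
      linarith
    · rintro ⟨hy, h⟩
      refine ⟨hy, ?_⟩
      have h1 := h x hx
      have h2 := hs y hy
      simp [cross_sub_right] at *
      linarith
  exact ⟨r₀, r₁, h0, h1, hr, hexp, left_mem_extremePoints hexp,
    left_mem_extremePoints (segment_symm ℝ (x + r₀ • d) (x + r₁ • d) ▸ hexp)⟩

/-! ### Oriented edges -/

/-- The end point of an oriented edge. -/
def edgeHead (e : Plane × (Fin 2 → ℤ) × ℝ) : Plane := e.1 + e.2.2 • toPlane e.2.1

section Edges

variable {P : Set Plane} {e e' : Plane × (Fin 2 → ℤ) × ℝ}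

lemma edge_cross_nonneg (he : e ∈ orientedEdges P) {y : Plane} (hy : y ∈ P) :
    0 ≤ cross (toPlane e.2.1) (y - e.1) := he.2.2.2 y hy

lemma edge_ne_zero (he : e ∈ orientedEdges P) : toPlane e.2.1 ≠ 0 := toPlane_ne_zero he.1

lemma mem_edge_segment {y : Plane} (ht : 0 < e.2.2) :
    y ∈ segment ℝ e.1 (e.1 + e.2.2 • toPlane e.2.1) ↔
      ∃ s, 0 ≤ s ∧ s ≤ e.2.2 ∧ y = e.1 + s • toPlane e.2.1 := by
  have := mem_segment_line (x := e.1) (d := toPlane e.2.1) (y := y) (r₀ := 0) (r₁ := e.2.2) ht.le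
  simpa using this

lemma edge_mem (he : e ∈ orientedEdges P) {s : ℝ} (h0 : 0 ≤ s) (h1 : s ≤ e.2.2) :
    e.1 + s • toPlane e.2.1 ∈ P :=
  he.2.2.1.subset ((mem_edge_segment he.2.1).2 ⟨s, h0, h1, rfl⟩)

lemma edge_tail_mem (he : e ∈ orientedEdges P) : e.1 ∈ P := by
  simpa using edge_mem he le_rfl he.2.1.le

lemma edge_head_mem (he : e ∈ orientedEdges P) : edgeHead e ∈ P :=
  edge_mem he he.2.1.le le_rfl

lemma edge_tail_extreme (he : e ∈ orientedEdges P) : e.1 ∈ P.extremePoints ℝ :=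
  left_mem_extremePoints he.2.2.1

lemma edge_head_extreme (he : e ∈ orientedEdges P) : edgeHead e ∈ P.extremePoints ℝ := by
  have := he.2.2.1
  rw [segment_symm] at this
  exact left_mem_extremePoints this

/-- An edge is the part of the polygon on its supporting line. -/
lemma edge_of_cross_eq_zero (he : e ∈ orientedEdges P) {y : Plane} (hy : y ∈ P)
    (h : cross (toPlane e.2.1) (y - e.1) = 0) :
    ∃ s, 0 ≤ s ∧ s ≤ e.2.2 ∧ y = e.1 + s • toPlane e.2.1 := by
  rw [← mem_edge_segment he.2.1]
  obtain ⟨l, hl⟩ := he.2.2.1 ⟨_, left_mem_segment _ _ _⟩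
  have h1 : e.1 ∈ segment ℝ e.1 (e.1 + e.2.2 • toPlane e.2.1) := left_mem_segment _ _ _
  have h2 : e.1 + e.2.2 • toPlane e.2.1 ∈ segment ℝ e.1 (e.1 + e.2.2 • toPlane e.2.1) :=
    right_mem_segment _ _ _
  rw [hl] at h1 h2 ⊢
  have h3 := h1.2 _ h2.1
  have h4 := h2.2 _ h1.1
  have h5 : l (toPlane e.2.1) = 0 := by
    simp only [map_add, map_smul, smul_eq_mul] at h3 h4
    have := he.2.1
    nlinarith
  obtain ⟨c, hc⟩ := cross_eq_zero (edge_ne_zero he) h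
  refine ⟨hy, fun z hz => ?_⟩
  have : y = e.1 + c • toPlane e.2.1 := by rw [← hc]; abel
  rw [this]
  simpa [h5] using h1.2 z hz

/-- Coprimality makes corresponding coordinates divide each other, so they agree up to sign; the
vanishing determinant forces the two signs to agree unless a coordinate is zero. -/
lemma coprime_parallel {v w : Fin 2 → ℤ} (hv : IsCoprime (v 0) (v 1)) (hw : IsCoprime (w 0) (w 1))
    (h : crossZ v w = 0) : w = v ∨ w = -v := by
  unfold crossZ at h
  have h0 : v 0 ∣ w 0 := hv.dvd_of_dvd_mul_right ⟨w 1, by linear_combination -h⟩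
  have h0' : w 0 ∣ v 0 := hw.dvd_of_dvd_mul_right ⟨v 1, by linear_combination h⟩
  have h1 : v 1 ∣ w 1 := hv.symm.dvd_of_dvd_mul_left ⟨w 0, by linear_combination h⟩
  have h1' : w 1 ∣ v 1 := hw.symm.dvd_of_dvd_mul_left ⟨v 0, by linear_combination -h⟩
  rcases Int.natAbs_eq_natAbs_iff.1 (Int.natAbs_eq_of_dvd_dvd h0 h0') with a | a <;>
  rcases Int.natAbs_eq_natAbs_iff.1 (Int.natAbs_eq_of_dvd_dvd h1 h1') with b | b
  · exact Or.inl (int_ext a.symm b.symm)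
  · rw [a, b] at h
    have h2 : w 0 * w 1 = 0 := by linarith
    rcases mul_eq_zero.1 h2 with h3 | h3
    · exact Or.inr (int_ext (by simp [a, h3]) (by simp [b]))
    · exact Or.inl (int_ext a.symm (by simp [b, h3]))
  · rw [a, b] at h
    have h2 : w 0 * w 1 = 0 := by linarith
    rcases mul_eq_zero.1 h2 with h3 | h3
    · exact Or.inl (int_ext (by simp [a, h3]) b.symm)
    · exact Or.inr (int_ext (by simp [a]) (by simp [b, h3]))
  · exact Or.inr (int_ext (by simp [a]) (by simp [b]))

/-- Two oriented edges with the same direction coincide. -/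
lemma edge_eq_of_direction_eq (he : e ∈ orientedEdges P) (he' : e' ∈ orientedEdges P)
    (hw : e'.2.1 = e.2.1) : e = e' := by
  have h1 := edge_cross_nonneg he (edge_tail_mem he')
  have h2 := edge_cross_nonneg he' (edge_tail_mem he)
  have h3 := edge_cross_nonneg he (edge_head_mem he')
  have h4 := edge_cross_nonneg he' (edge_head_mem he)
  have hself := cross_self (toPlane e.2.1)
  rw [hw] at h2 h4
  simp only [edgeHead, cross_sub_right, cross_add_right, cross_smul_right] at h1 h2 h3 h4
  obtain ⟨s, hs0, hs1, hs⟩ := edge_of_cross_eq_zero he (edge_tail_mem he')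
    (by rw [cross_sub_right]; linarith)
  obtain ⟨r, hr0, hr1, hr⟩ := edge_of_cross_eq_zero he (edge_head_mem he')
    (by simp only [edgeHead, cross_sub_right, cross_add_right, cross_smul_right, hw, hself] at *
        linarith)
  obtain ⟨s', hs0', hs1', hs'⟩ := edge_of_cross_eq_zero he' (edge_tail_mem he)
    (by rw [hw, cross_sub_right]; linarith)
  obtain ⟨r', hr0', hr1', hr'⟩ := edge_of_cross_eq_zero he' (edge_head_mem he)
    (by simp only [edgeHead, cross_sub_right, cross_add_right, cross_smul_right, hw, hself] at *
        linarith)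
  rw [hw] at hs' hr'
  simp only [edgeHead, hw] at hr hr'
  have hz : ∀ c : ℝ, c • toPlane e.2.1 = 0 → c = 0 := fun c hc =>
    (smul_eq_zero.1 hc).resolve_right (edge_ne_zero he)
  have k1 : s + s' = 0 := hz _ (by
    have : e.1 = e.1 + s • toPlane e.2.1 + s' • toPlane e.2.1 := by rw [← hs, ← hs']
    rw [add_smul]
    have h := congrArg (fun z => z - e.1) this
    simp only [sub_self] at h
    rw [h]; abel)
  have hs00 : s = 0 := by linarith
  have hp : e'.1 = e.1 := by rw [hs, hs00]; simp
  have k2 : e'.2.2 - r = 0 := hz _ (by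
    rw [hp] at hr
    rw [sub_smul, add_left_cancel hr, sub_self])
  have k3 : e.2.2 - r' = 0 := hz _ (by
    rw [hp] at hr'
    rw [sub_smul, add_left_cancel hr', sub_self])
  exact Prod.ext hp.symm (Prod.ext hw.symm (by linarith))

/-- Here x is a common point of the two supporting lines. Opposite directions would put the polygon
on both sides of one line, hence inside it, against the nonempty interior. -/
lemma direction_eq_of_cross (hi : (interior P).Nonempty) (he : e ∈ orientedEdges P)
    (he' : e' ∈ orientedEdges P)
    {x : Plane} (hx : cross (toPlane e.2.1) (x - e.1) = 0)
    (hx' : cross (toPlane e'.2.1) (x - e'.1) = 0)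
    (h : cross (toPlane e.2.1) (toPlane e'.2.1) = 0) : e = e' := by
  refine edge_eq_of_direction_eq he he' ?_
  rw [cross_toPlane] at h
  rcases coprime_parallel he.1 he'.1 (by exact_mod_cast h) with h1 | h1
  · exact h1
  · exfalso
    obtain ⟨y, hy, hne⟩ := exists_cross_ne hi (edge_ne_zero he) x
    have h2 := edge_cross_nonneg he hy
    have h3 := edge_cross_nonneg he' hy
    apply hne
    rw [h1, toPlane_neg, cross_neg_left] at h3 hx'
    simp only [cross_sub_right] at *
    linarith

/-- The half-open edges (without end point) are pairwise disjoint. -/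
lemma edge_unique_tail (hi : (interior P).Nonempty) (he : e ∈ orientedEdges P)
    (he' : e' ∈ orientedEdges P) {s s' : ℝ} (hs : s < e.2.2) (hs' : s' < e'.2.2)
    (h : e.1 + s • toPlane e.2.1 = e'.1 + s' • toPlane e'.2.1) : e = e' := by
  have h1 := edge_cross_nonneg he (edge_head_mem he')
  have h2 := edge_cross_nonneg he' (edge_head_mem he)
  have c := congrArg (cross (toPlane e.2.1)) h
  have c' := congrArg (cross (toPlane e'.2.1)) h
  have hself := cross_self (toPlane e.2.1)
  have hself' := cross_self (toPlane e'.2.1)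
  have hsw := cross_swap (toPlane e.2.1) (toPlane e'.2.1)
  have ht := he.2.1
  have ht' := he'.2.1
  simp only [edgeHead, cross_sub_right, cross_add_right, cross_smul_right] at *
  -- At the common point each edge still has a positive stretch ahead, and its head lies to the left
  -- of the other edge. This gives the determinant of the directions both signs.
  have h0 : cross (toPlane e.2.1) (toPlane e'.2.1) = 0 := by
    have k1 : 0 ≤ (e'.2.2 - s') * cross (toPlane e.2.1) (toPlane e'.2.1) := by
      rw [hself] at c; linarith
    have k2 : 0 ≤ (e.2.2 - s) * -cross (toPlane e.2.1) (toPlane e'.2.1) := by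
      rw [hsw, hself'] at *; linarith
    have k3 := nonneg_of_mul_nonneg_right k1 (by linarith)
    have k4 := nonneg_of_mul_nonneg_right k2 (by linarith)
    linarith
  refine direction_eq_of_cross hi he he' (x := e.1 + s • toPlane e.2.1) ?_ ?_ h0
  · rw [add_sub_cancel_left, cross_smul_right, hself, mul_zero]
  · rw [h, add_sub_cancel_left, cross_smul_right, hself', mul_zero]

/-- The argument of `edge_unique_tail` run backwards: the tails now lie to the left of the other
edge, so the directions are parallel. -/
lemma edge_unique_head (hi : (interior P).Nonempty) (he : e ∈ orientedEdges P)
    (he' : e' ∈ orientedEdges P) (h : edgeHead e = edgeHead e') : e = e' := by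
  have h1 := edge_cross_nonneg he (edge_tail_mem he')
  have h2 := edge_cross_nonneg he' (edge_tail_mem he)
  have c := congrArg (cross (toPlane e.2.1)) h
  have c' := congrArg (cross (toPlane e'.2.1)) h
  have hself := cross_self (toPlane e.2.1)
  have hself' := cross_self (toPlane e'.2.1)
  have hsw := cross_swap (toPlane e.2.1) (toPlane e'.2.1)
  have ht := he.2.1
  have ht' := he'.2.1
  have hx : cross (toPlane e.2.1) (edgeHead e - e.1) = 0 := by
    rw [edgeHead, add_sub_cancel_left, cross_smul_right, hself, mul_zero]
  have hx' : cross (toPlane e'.2.1) (edgeHead e - e'.1) = 0 := by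
    rw [h, edgeHead, add_sub_cancel_left, cross_smul_right, hself', mul_zero]
  refine direction_eq_of_cross hi he he' hx hx' ?_
  simp only [edgeHead, cross_sub_right, cross_add_right, cross_smul_right] at *
  have k1 : 0 ≤ e'.2.2 * -cross (toPlane e.2.1) (toPlane e'.2.1) := by
    rw [hself] at c; linarith
  have k2 : 0 ≤ e.2.2 * cross (toPlane e.2.1) (toPlane e'.2.1) := by
    rw [hsw, hself'] at *; linarith
  have k3 := nonneg_of_mul_nonneg_right k1 ht'
  have k4 := nonneg_of_mul_nonneg_right k2 ht
  linarith

end Edges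

/-! ### Every boundary point lies on an edge -/

lemma cross_nonneg_of_hull {T : Set Plane} {d x : Plane} (h : ∀ s ∈ T, 0 ≤ cross d (s - x)) :
    ∀ y ∈ convexHull ℝ T, 0 ≤ cross d (y - x) := by
  have hc : Convex ℝ {y : Plane | 0 ≤ cross d (y - x)} := by
    intro a ha b hb α β hα hβ hab
    simp only [mem_ofPred_eq, cross_sub_right, cross_add_right, cross_smul_right] at *
    obtain rfl : β = 1 - α := by linarith
    nlinarith
  exact fun y hy => convexHull_min h hc hy

/-- At a boundary point of a polygon there is a supporting line through a further generator. -/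
lemma exists_supporting_generator {T : Set Plane} (hT : T.Finite)
    (hi : (interior (convexHull ℝ T)).Nonempty) {x : Plane} (hx : x ∈ frontier (convexHull ℝ T)) :
    ∃ q ∈ T, q ≠ x ∧ ∀ y ∈ convexHull ℝ T, 0 ≤ cross (q - x) (y - x) := by
  set P := convexHull ℝ T
  have hPc : Convex ℝ P := convex_convexHull ℝ T
  obtain ⟨f, hf⟩ := geometric_hahn_banach_open_point hPc.interior isOpen_interior hx.2
  obtain ⟨d', hd'⟩ := exists_cross_eq f
  set d := -d' with hd
  have hfd : ∀ y, f y = - cross d y := fun y => by rw [hd' y, hd, cross_neg_left, neg_neg]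
  have hd0 : d ≠ 0 := by
    intro h0
    obtain ⟨z, hz⟩ := hi
    have := hf z hz
    simp [hfd, h0, cross] at this
  have hsup : ∀ y ∈ P, 0 ≤ cross d (y - x) := by
    have hcl : IsClosed {y : Plane | f y ≤ f x} := isClosed_le f.continuous continuous_const
    have hsub : closure (interior P) ⊆ {y : Plane | f y ≤ f x} :=
      closure_minimal (fun a ha => (hf a ha).le) hcl
    intro y hy
    have : y ∈ closure (interior P) := by
      rw [hPc.closure_interior_eq_closure_of_nonempty_interior hi]; exact subset_closure hy
    have := hsub this
    simp only [mem_ofPred_eq, hfd] at this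
    rw [cross_sub_right]; linarith
  have hnn := normSq_pos hd0
  -- X and Y are coordinates centred at x, along the supporting line and across it; in them the
  -- determinant of two generators becomes a comparison of the slopes X / Y.
  set X : Plane → ℝ := fun s => d 0 * (s 0 - x 0) + d 1 * (s 1 - x 1) with hX
  set Y : Plane → ℝ := fun s => cross d (s - x) with hY
  have hXY : ∀ q s : Plane, (d 0 * d 0 + d 1 * d 1) * cross (q - x) (s - x) = X q * Y s - Y q * X s := by
    intro q s
    simp only [hX, hY, cross, Pi.sub_apply]; ring
  have hTP : ∀ s ∈ T, 0 ≤ Y s := fun s hs => hsup s (subset_convexHull ℝ T hs)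
  have hfin : ∀ q ∈ T, q ≠ x → (∀ s ∈ T, 0 ≤ X q * Y s - Y q * X s) →
      ∃ q ∈ T, q ≠ x ∧ ∀ y ∈ P, 0 ≤ cross (q - x) (y - x) := by
    intro q hq hqx h
    refine ⟨q, hq, hqx, cross_nonneg_of_hull fun s hs => ?_⟩
    have := h s hs
    rw [← hXY] at this
    exact nonneg_of_mul_nonneg_right this hnn
  by_cases hc : ∃ q ∈ T, Y q = 0 ∧ 0 < X q
  · obtain ⟨q, hq, hq0, hqX⟩ := hc
    refine hfin q hq ?_ ?_
    · rintro rfl; simp [hX] at hqX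
    · intro s hs
      rw [hq0]
      have := mul_nonneg hqX.le (hTP s hs)
      linarith
  -- With no generator ahead on the line, rotate the line about x until it first meets a generator:
  -- this is the one of largest X / Y among those strictly to the left.
  · push Not at hc
    have hne : {s ∈ T | 0 < Y s}.Nonempty := by
      by_contra hemp
      rw [not_nonempty_iff_eq_empty] at hemp
      have h0 : ∀ s ∈ T, 0 ≤ cross (-d) (s - x) := by
        intro s hs
        rw [cross_neg_left]
        have : ¬ (0 < Y s) := fun h => by
          have : s ∈ {s ∈ T | 0 < Y s} := ⟨hs, h⟩
          rw [hemp] at this; exact this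
        simp only [hY] at this; linarith
      have h1 := cross_nonneg_of_hull h0
      obtain ⟨y, hy, hne⟩ := exists_cross_ne hi hd0 x
      have h2 := h1 y hy
      have h3 := hsup y hy
      rw [cross_neg_left] at h2
      exact hne (by linarith)
    obtain ⟨q, ⟨hq, hqY⟩, hmax⟩ := exists_max_image {s ∈ T | 0 < Y s} (fun s => X s / Y s)
      (hT.subset (sep_subset _ _)) hne
    refine hfin q hq ?_ ?_
    · rintro rfl; simp [hY, cross_zero_right] at hqY
    · intro s hs
      rcases (hTP s hs).eq_or_lt with h | h
      · rw [← h]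
        have := hc s hs h.symm
        nlinarith
      · have := hmax s ⟨hs, h⟩
        rw [div_le_div_iff₀ h hqY] at this
        linarith

lemma exists_primitive {n : Fin 2 → ℤ} (hn : n ≠ 0) :
    ∃ (w : Fin 2 → ℤ) (g : ℕ), IsCoprime (w 0) (w 1) ∧ 0 < g ∧ n = (g : ℤ) • w := by
  have hg : 0 < Int.gcd (n 0) (n 1) := by
    rw [Int.gcd_pos_iff]
    by_contra! h
    exact hn (int_ext (by simp [h.1]) (by simp [h.2]))
  refine ⟨![n 0 / Int.gcd (n 0) (n 1), n 1 / Int.gcd (n 0) (n 1)], Int.gcd (n 0) (n 1), ?_, hg, ?_⟩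
  · rw [Int.isCoprime_iff_gcd_eq_one]
    exact Int.gcd_div_gcd_div_gcd hg
  · apply int_ext
    · simp [Int.mul_ediv_cancel' (Int.gcd_dvd_left _ _)]
    · simp [Int.mul_ediv_cancel' (Int.gcd_dvd_right _ _)]

/-- A Bézout relation for w is an integral functional with value 1 at w, so its value at the lattice
vector is the scalar. -/
lemma int_of_smul_primitive {w n : Fin 2 → ℤ} (hw : IsCoprime (w 0) (w 1)) {t : ℝ}
    (h : t • toPlane w = toPlane n) : ∃ g : ℤ, t = g := by
  obtain ⟨a, b, hab⟩ := hw
  have h0 := congrFun h 0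
  have h1 := congrFun h 1
  simp only [Pi.smul_apply, smul_eq_mul, toPlane] at h0 h1
  refine ⟨a * n 0 + b * n 1, ?_⟩
  push_cast
  rw [← h0, ← h1]
  have : (a : ℝ) * w 0 + b * w 1 = 1 := by exact_mod_cast hab
  linear_combination (-t) * this

/-! ### The boundary as a closed cycle of half-open edges -/

section Edges

variable {P : Set Plane} {e e' : Plane × (Fin 2 → ℤ) × ℝ}

/-- Every boundary point lies on a half-open edge. -/
lemma exists_edge (hP : IsLatticePolygon P) {x : Plane} (hx : x ∈ frontier P) :
    ∃ e ∈ orientedEdges P, ∃ s, 0 ≤ s ∧ s < e.2.2 ∧ x = e.1 + s • toPlane e.2.1 := by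
  have hxP : x ∈ P := hP.isCompact.isClosed.frontier_subset hx
  obtain ⟨q, hq, hqx, hsup⟩ : ∃ q ∈ P, q ≠ x ∧ ∀ y ∈ P, 0 ≤ cross (q - x) (y - x) := by
    obtain ⟨⟨S, rfl⟩, hi⟩ := hP
    obtain ⟨q, hq, h⟩ := exists_supporting_generator (S.finite_toSet.image _) hi hx
    exact ⟨q, subset_convexHull ℝ _ hq, h⟩
  have hd : q - x ≠ 0 := sub_ne_zero.2 hqx
  obtain ⟨r₀, r₁, h0, -, hr, hexp, hx0, hx1⟩ :=
    exists_exposed_segment hP.convex hP.isCompact hxP hd hsup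
  -- The point q lies ahead of x on the edge, so x is not the head of the edge and the inequality
  -- for its parameter is strict.
  have h1 : 1 ≤ r₁ := ((hr 1).1 (by simpa using hq)).2
  obtain ⟨a, ha⟩ := hP.exists_of_extreme hx0
  obtain ⟨b, hb⟩ := hP.exists_of_extreme hx1
  have hsub : toPlane (b - a) = (r₁ - r₀) • (q - x) := by
    rw [toPlane_sub, ha, hb, sub_smul]; abel
  have hn : b - a ≠ 0 := by
    intro h
    rw [h, toPlane_zero] at hsub
    rcases smul_eq_zero.1 hsub.symm with h' | h'
    · linarith
    · exact hd h'
  obtain ⟨w, g, hw, hg, hgw⟩ := exists_primitive hn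
  rw [hgw, toPlane_zsmul, Int.cast_natCast] at hsub
  have hg' : (0 : ℝ) < g := by exact_mod_cast hg
  have hr' : 0 < r₁ - r₀ := by linarith
  have hdw : q - x = (g / (r₁ - r₀)) • toPlane w := by
    rw [div_eq_inv_mul, mul_smul, hsub, smul_smul, inv_mul_cancel₀ hr'.ne', one_smul]
  refine ⟨(x + r₀ • (q - x), w, g), ⟨hw, hg', ?_, ?_⟩, -r₀ * (g / (r₁ - r₀)), ?_, ?_, ?_⟩
  · have : x + r₀ • (q - x) + (g : ℝ) • toPlane w = x + r₁ • (q - x) := by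
      rw [hsub, sub_smul]; abel
    rw [this]; exact hexp
  · intro y hy
    change 0 ≤ cross (toPlane w) (y - (x + r₀ • (q - x)))
    have h2 := hsup y hy
    have h3 : cross (q - x) (y - (x + r₀ • (q - x))) = cross (q - x) (y - x) := by
      rw [← sub_sub, cross_sub_right _ (y - x), cross_smul_right, cross_self]; ring
    rw [← h3] at h2
    nth_rewrite 1 [hdw] at h2
    rw [cross_smul_left] at h2
    exact nonneg_of_mul_nonneg_right h2 (by positivity)
  · have : 0 ≤ -r₀ := by linarith
    positivity
  · change -r₀ * (g / (r₁ - r₀)) < g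
    rw [← mul_div_assoc, div_lt_iff₀ hr']
    nlinarith
  · change x = x + r₀ • (q - x) + (-r₀ * (g / (r₁ - r₀))) • toPlane w
    rw [mul_smul, ← hdw, neg_smul]; abel

lemma edge_mem_frontier (he : e ∈ orientedEdges P) {s : ℝ} (h0 : 0 ≤ s) (h1 : s ≤ e.2.2) :
    e.1 + s • toPlane e.2.1 ∈ frontier P := by
  refine ⟨subset_closure (edge_mem he h0 h1), fun h => ?_⟩
  obtain ⟨y, hy, hlt⟩ := exists_cross_neg h (edge_ne_zero he)
  have := edge_cross_nonneg he hy
  rw [← sub_sub, cross_sub_right, cross_smul_right, cross_self] at hlt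
  linarith

/-- The ends of an edge are extreme, hence lattice points; as the direction is primitive, the length
is an integer. -/
lemma edge_lattice (hP : IsLatticePolygon P) (he : e ∈ orientedEdges P) :
    ∃ (a : Fin 2 → ℤ) (g : ℕ), 0 < g ∧ e.1 = toPlane a ∧ e.2.2 = g ∧
      edgeHead e = toPlane (a + (g : ℤ) • e.2.1) := by
  obtain ⟨a, ha⟩ := hP.exists_of_extreme (edge_tail_extreme he)
  obtain ⟨b, hb⟩ := hP.exists_of_extreme (edge_head_extreme he)
  obtain ⟨g, hg⟩ := int_of_smul_primitive (n := b - a) he.1 (t := e.2.2) (by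
    rw [toPlane_sub, ha, hb, edgeHead]; abel)
  have ht := he.2.1
  rw [hg] at ht
  have hg0 : 0 < g := by exact_mod_cast ht
  lift g to ℕ using hg0.le
  refine ⟨a, g, by exact_mod_cast hg0, ha.symm, by exact_mod_cast hg, ?_⟩
  rw [edgeHead, toPlane_add, toPlane_zsmul, ha, hg]

lemma extremePoints_finite (hP : IsLatticePolygon P) : (P.extremePoints ℝ).Finite := by
  obtain ⟨⟨S, rfl⟩, -⟩ := hP
  exact (S.finite_toSet.image _).subset extremePoints_convexHull_subset

lemma orientedEdges_finite (hP : IsLatticePolygon P) : (orientedEdges P).Finite := by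
  refine Set.Finite.of_finite_image (f := Prod.fst) ((extremePoints_finite hP).subset ?_) ?_
  · rintro _ ⟨e, he, rfl⟩
    exact edge_tail_extreme he
  · intro e he e' he' h
    exact edge_unique_tail hP.2 he he' he.2.1 he'.2.1 (by simpa using h)

/-- The edges of a lattice polygon, as a finite set. -/
def edgeFinset (hP : IsLatticePolygon P) : Finset (Plane × (Fin 2 → ℤ) × ℝ) :=
  (orientedEdges_finite hP).toFinset

lemma mem_edgeFinset (hP : IsLatticePolygon P) : e ∈ edgeFinset hP ↔ e ∈ orientedEdges P :=
  (orientedEdges_finite hP).mem_toFinset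

lemma exists_edge_tail (hP : IsLatticePolygon P) {x : Plane} (hx : x ∈ P.extremePoints ℝ)
    (hf : x ∈ frontier P) : ∃ e ∈ orientedEdges P, e.1 = x := by
  obtain ⟨e, he, s, h0, h1, rfl⟩ := exists_edge hP hf
  refine ⟨e, he, ?_⟩
  rcases h0.eq_or_lt with rfl | h0
  · simp
  have ht := he.2.1
  refine (mem_extremePoints.1 hx).2 _ (edge_tail_mem he) _ (edge_head_mem he) ?_ |>.1
  refine ⟨1 - s / e.2.2, s / e.2.2, ?_, by positivity, by ring, ?_⟩
  · rw [sub_pos, div_lt_one ht]; exact h1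
  · rw [edgeHead, smul_add, smul_smul, div_mul_cancel₀ _ ht.ne', ← add_assoc, ← add_smul]
    simp

-- The boundary closes up. Each head is a vertex and so is the tail of some edge; both maps are
-- injective on the finite set of edges, so the inclusion is an equality by counting. No cyclic
-- ordering of the edges is needed.
open Classical in
lemma image_head_eq_image_tail (hP : IsLatticePolygon P) :
    (edgeFinset hP).image edgeHead = (edgeFinset hP).image Prod.fst := by
  apply Finset.eq_of_subset_of_card_le
  · intro x hx
    obtain ⟨e, he, rfl⟩ := Finset.mem_image.1 hx
    rw [mem_edgeFinset] at he
    obtain ⟨e', he', h⟩ := exists_edge_tail hP (edge_head_extreme he)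
      (edge_mem_frontier he he.2.1.le le_rfl)
    exact Finset.mem_image.2 ⟨e', (mem_edgeFinset hP).2 he', h⟩
  · rw [Finset.card_image_of_injOn, Finset.card_image_of_injOn]
    · intro e he e' he' h
      exact edge_unique_head hP.2 ((mem_edgeFinset hP).1 he) ((mem_edgeFinset hP).1 he') h
    · intro e he e' he' h
      have he := (mem_edgeFinset hP).1 he
      have he' := (mem_edgeFinset hP).1 he'
      exact edge_unique_tail hP.2 he he' he.2.1 he'.2.1 (by simpa using h)

/-- Summation over the start points of the edges is summation over the end points. -/
lemma sum_head_eq_sum_tail {M : Type*} [AddCommMonoid M] (hP : IsLatticePolygon P) (f : Plane → M) :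
    ∑ e ∈ edgeFinset hP, f (edgeHead e) = ∑ e ∈ edgeFinset hP, f e.1 := by
  classical
  rw [← Finset.sum_image (f := f) (g := edgeHead), ← Finset.sum_image (f := f) (g := Prod.fst),
    image_head_eq_image_tail]
  · intro e he e' he' h
    have he := (mem_edgeFinset hP).1 he
    have he' := (mem_edgeFinset hP).1 he'
    exact edge_unique_tail hP.2 he he' he.2.1 he'.2.1 (by simpa using h)
  · intro e he e' he' h
    exact edge_unique_head hP.2 ((mem_edgeFinset hP).1 he) ((mem_edgeFinset hP).1 he') h

end Edges

lemma integral_segment (p w : Plane) {t : ℝ} (ht : 0 ≤ t) :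
    ∫ s in Icc (0:ℝ) t, (p + s • w) = t • p + (t ^ 2 / 2) • w := by
  rw [integral_Icc_eq_integral_Ioc, ← intervalIntegral.integral_of_le ht,
    intervalIntegral.integral_add (by simp) (Continuous.intervalIntegrable (by fun_prop) _ _),
    intervalIntegral.integral_const, intervalIntegral.integral_smul_const, integral_id]
  simp

/-- The mean position on an edge is the midpoint of its ends. -/
lemma boundaryMoment_eq {P : Set Plane} (hP : IsLatticePolygon P) :
    boundaryMoment P = ∑ e ∈ edgeFinset hP, (e.2.2 / 2) • (e.1 + edgeHead e) := by
  classical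
  have : Fintype (orientedEdges P) := (orientedEdges_finite hP).fintype
  have hcont : ∀ e : orientedEdges P, Continuous (fun s : ℝ => e.1.1 + s • toPlane e.1.2.1) :=
    fun e => by fun_prop
  unfold boundaryMoment boundaryMeasure
  rw [Measure.sum_fintype, integral_finsetSum_measure]
  · have : ∀ e : orientedEdges P, ∫ x, x ∂((volume.restrict (Icc (0 : ℝ) e.1.2.2)).map
        fun s : ℝ => e.1.1 + s • toPlane e.1.2.1) = (e.1.2.2 / 2) • (e.1.1 + edgeHead e.1) := by
      intro e
      rw [integral_map (hcont e).aemeasurable (by fun_prop), integral_segment _ _ e.2.2.1.le, edgeHead]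
      apply plane_ext <;> simp <;> ring
    rw [Finset.sum_congr rfl fun e _ => this e]
    refine Finset.sum_bij (fun e _ => e.1) (fun e _ => (mem_edgeFinset hP).2 e.2) (fun e _ e' _ h => Subtype.ext h) ?_ (fun e _ => rfl)
    intro e he
    exact ⟨⟨e, (mem_edgeFinset hP).1 he⟩, Finset.mem_univ _, rfl⟩
  · intro e _
    rw [integrable_map_measure (by fun_prop) (hcont e).aemeasurable]
    exact ((hcont e).continuousOn.integrableOn_Icc)

/-! ### The fan of half-open triangles at a vertex -/

section Fan

variable {P : Set Plane} {e e' : Plane × (Fin 2 → ℤ) × ℝ} {o : Plane}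

/-- The piece of the fan with apex `o` over the half-open edge `e`; it is empty if `e` starts
at `o`. -/
def fanPiece (o : Plane) (e : Plane × (Fin 2 → ℤ) × ℝ) : Set Plane :=
  {x | e.1 ≠ o ∧ ∃ α β : ℝ, 0 < α ∧ 0 ≤ β ∧ α + β ≤ 1 ∧
    x = o + α • (e.1 - o) + β • (edgeHead e - o)}

lemma fanPiece_subset (hc : Convex ℝ P) (ho : o ∈ P) (he : e ∈ orientedEdges P) :
    fanPiece o e ⊆ P := by
  rintro x ⟨-, α, β, hα, hβ, hab, rfl⟩
  have h := hc.sum_mem (t := Finset.univ) (w := ![1 - α - β, α, β]) (z := ![o, e.1, edgeHead e])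
    (by intro i _; fin_cases i <;> simp <;> linarith) (by simp [Fin.sum_univ_three]; ring)
    (by intro i _; fin_cases i
        · exact ho
        · exact edge_tail_mem he
        · exact edge_head_mem he)
  convert h using 1
  simp [Fin.sum_univ_three, sub_smul, smul_sub]
  abel

lemma cross_tail_head (e : Plane × (Fin 2 → ℤ) × ℝ) (o : Plane) :
    cross (e.1 - o) (edgeHead e - o) = e.2.2 * cross (toPlane e.2.1) (o - e.1) := by
  simp only [edgeHead, cross_sub_right, cross_add_right, cross_sub_left, cross_smul_right]
  rw [cross_swap (toPlane e.2.1) o, cross_swap (toPlane e.2.1) e.1, cross_self, cross_self,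
    cross_swap o e.1]
  ring

lemma eq_tail_or_head_of_extreme (he : e ∈ orientedEdges P) (ho : o ∈ P.extremePoints ℝ) {s : ℝ}
    (h0 : 0 ≤ s) (h1 : s ≤ e.2.2) (h : o = e.1 + s • toPlane e.2.1) : e.1 = o ∨ edgeHead e = o := by
  rcases h1.eq_or_lt with rfl | h1
  · exact Or.inr h.symm
  rcases h0.eq_or_lt with rfl | h0
  · left; simpa using h.symm
  have ht := he.2.1
  left
  refine (mem_extremePoints.1 ho).2 _ (edge_tail_mem he) _ (edge_head_mem he) ?_ |>.1
  refine ⟨1 - s / e.2.2, s / e.2.2, ?_, by positivity, by ring, ?_⟩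
  · rw [sub_pos, div_lt_one ht]; exact h1
  · rw [edgeHead, smul_add, smul_smul, div_mul_cancel₀ _ ht.ne', ← add_assoc, ← add_smul, h]
    simp

/-- If the determinant vanishes, the vertex o lies on the edge, and being extreme it must be one of
its ends. -/
lemma edge_trichotomy (he : e ∈ orientedEdges P) (ho : o ∈ P.extremePoints ℝ) :
    e.1 = o ∨ edgeHead e = o ∨ 0 < cross (e.1 - o) (edgeHead e - o) := by
  have h1 := edge_cross_nonneg he ho.1
  rcases h1.eq_or_lt with h | h
  · obtain ⟨s, h0, h1, h2⟩ := edge_of_cross_eq_zero he ho.1 h.symm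
    rcases eq_tail_or_head_of_extreme he ho h0 h1 h2 with h | h
    · exact Or.inl h
    · exact Or.inr (Or.inl h)
  · right; right
    rw [cross_tail_head]
    exact mul_pos he.2.1 h

/-- The ray from o through x leaves P at a boundary point, and the half-open edge through that point
is the base of the piece containing x. -/
lemma fan_cover (hP : IsLatticePolygon P) (ho : o ∈ P) {x : Plane} (hx : x ∈ P) (hxo : x ≠ o) :
    ∃ e ∈ orientedEdges P, x ∈ fanPiece o e := by
  have hd : x - o ≠ 0 := sub_ne_zero.2 hxo
  obtain ⟨r₀, r₁, h0, -, hr⟩ := exists_line_eq_Icc hP.convex hP.isCompact ho hd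
  have h1 : 1 ≤ r₁ := ((hr 1).1 (by simpa using hx)).2
  have hr0 : 0 < r₁ := by linarith
  have hy : o + r₁ • (x - o) ∈ frontier P := by
    refine ⟨subset_closure ((hr r₁).2 ⟨by linarith, le_rfl⟩), fun h => ?_⟩
    obtain ⟨ε, hε, h⟩ := exists_pos_add_smul_mem h (x - o)
    rw [add_assoc, ← add_smul] at h
    have := ((hr _).1 h).2
    linarith
  obtain ⟨e, he, s, hs0, hs1, hs⟩ := exists_edge hP hy
  have ht := he.2.1
  have hxo' : x - o = r₁⁻¹ • (e.1 - o + s • toPlane e.2.1) := by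
    have : r₁ • (x - o) = e.1 - o + s • toPlane e.2.1 := by
      rw [sub_add_eq_add_sub, ← hs]; abel
    rw [← this, smul_smul, inv_mul_cancel₀ hr0.ne', one_smul]
  -- These are the barycentric weights of the exit point on its edge, divided by its ray parameter
  -- `r₁`. An edge starting at o is impossible: its head would lie on the ray beyond the exit point.
  refine ⟨e, he, ?_, (1 - s / e.2.2) / r₁, s / e.2.2 / r₁, ?_, by positivity, ?_, ?_⟩
  · intro heo
    rw [heo] at hs hxo'
    rcases hs0.eq_or_lt with rfl | hs0
    · apply hd; rw [hxo']; simp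
    have hh : o + (e.2.2 / s * r₁) • (x - o) ∈ P := by
      have := edge_head_mem he
      rw [edgeHead, heo] at this
      convert this using 2
      rw [hxo']; simp [smul_smul]; field_simp
    have := ((hr _).1 hh).2
    have h3 : 1 < e.2.2 / s := (one_lt_div hs0).2 hs1
    nlinarith
  · have : s / e.2.2 < 1 := (div_lt_one ht).2 hs1
    exact div_pos (by linarith) hr0
  · rw [← add_div, div_le_one hr0]; linarith
  · have : x = o + (x - o) := by abel
    rw [this, hxo', edgeHead]
    apply plane_ext <;> simp <;> field_simp <;> ring

/-- The point of the edge found here is where the ray from o through x leaves P. It depends on x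
only, which is what makes the pieces disjoint in `fan_disjoint`. If the edge ends at o, the exit
point is its tail, by extremality of that tail. -/
lemma fan_exit (ho : o ∈ P.extremePoints ℝ) (he : e ∈ orientedEdges P)
    {x : Plane} (hx : x ∈ fanPiece o e) :
    ∃ κ s : ℝ, 0 < κ ∧ 0 ≤ s ∧ s < e.2.2 ∧ x = o + κ • (e.1 + s • toPlane e.2.1 - o) ∧
      e.1 + s • toPlane e.2.1 ≠ o ∧
      ∀ r : ℝ, 1 < r → o + r • (e.1 + s • toPlane e.2.1 - o) ∉ P := by
  obtain ⟨hne, α, β, hα, hβ, -, rfl⟩ := hx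
  have ht := he.2.1
  rcases edge_trichotomy he ho with h | h | h
  · exact absurd h hne
  · refine ⟨α, 0, hα, le_rfl, ht, by simp [h], by simpa using hne, ?_⟩
    intro r hr hmem
    simp only [zero_smul, add_zero] at hmem
    refine hne ((mem_extremePoints.1 (edge_tail_extreme he)).2 _ ho.1 _ hmem ?_ |>.1).symm
    have hr0 : 0 < r := by linarith
    refine ⟨1 - r⁻¹, r⁻¹, ?_, by positivity, by ring, ?_⟩
    · rw [sub_pos]; exact inv_lt_one_of_one_lt₀ hr
    · rw [smul_add, smul_smul, inv_mul_cancel₀ hr0.ne', ← add_assoc, ← add_smul]; simp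
  · have hk : 0 < α + β := by linarith
    have hneg : cross (toPlane e.2.1) (e.1 - o) < 0 := by
      rw [cross_tail_head] at h
      have := pos_of_mul_pos_right h ht.le
      rw [cross_sub_right] at *; linarith
    have hse : ∀ s : ℝ, cross (toPlane e.2.1) (e.1 + s • toPlane e.2.1 - o) < 0 := by
      intro s
      have e1 : e.1 + s • toPlane e.2.1 - o = (e.1 - o) + s • toPlane e.2.1 := by abel
      rw [e1, cross_add_right, cross_smul_right, cross_self]
      linarith
    refine ⟨α + β, β / (α + β) * e.2.2, hk, by positivity, ?_, ?_, ?_, ?_⟩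
    · have : β / (α + β) < 1 := (div_lt_one hk).2 (by linarith)
      nlinarith
    · rw [edgeHead]
      apply plane_ext <;> simp <;> field_simp <;> ring
    · intro h0
      have := hse (β / (α + β) * e.2.2)
      rw [h0, sub_self, cross_zero_right] at this
      exact lt_irrefl _ this
    · intro r hr hmem
      have h1 := edge_cross_nonneg he hmem
      have h2 := hse (β / (α + β) * e.2.2)
      set y := e.1 + (β / (α + β) * e.2.2) • toPlane e.2.1 with hy
      have h3 : cross (toPlane e.2.1) (y - e.1) = 0 := by
        rw [hy, add_sub_cancel_left, cross_smul_right, cross_self, mul_zero]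
      have h4 : o + r • (y - o) - e.1 = (y - e.1) + (r - 1) • (y - o) := by
        rw [sub_smul, one_smul]; abel
      rw [h4, cross_add_right, h3, cross_smul_right] at h1
      nlinarith

lemma fan_disjoint (hi : (interior P).Nonempty) (ho : o ∈ P.extremePoints ℝ)
    (he : e ∈ orientedEdges P) (he' : e' ∈ orientedEdges P)
    {x : Plane} (hx : x ∈ fanPiece o e) (hx' : x ∈ fanPiece o e') : e = e' := by
  obtain ⟨κ, s, hκ, h0, h1, h2, -, h3⟩ := fan_exit ho he hx
  obtain ⟨κ', s', hκ', h0', h1', h2', -, h3'⟩ := fan_exit ho he' hx'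
  have hy := edge_mem he h0 h1.le
  have hy' := edge_mem he' h0' h1'.le
  refine edge_unique_tail hi he he' h1 h1' ?_
  set y := e.1 + s • toPlane e.2.1
  set y' := e'.1 + s' • toPlane e'.2.1
  have h : κ • (y - o) = κ' • (y' - o) := add_left_cancel (h2.symm.trans h2')
  rcases lt_trichotomy κ κ' with hlt | heq | hgt
  · exfalso
    apply h3' (κ' / κ) ((one_lt_div hκ).2 hlt)
    rw [div_eq_inv_mul, mul_smul, ← h, smul_smul, inv_mul_cancel₀ hκ.ne', one_smul]
    simpa using hy
  · rw [← heq] at h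
    have := smul_right_injective Plane hκ.ne' h
    simpa using this
  · exfalso
    apply h3 (κ / κ') ((one_lt_div hκ').2 hgt)
    rw [div_eq_inv_mul, mul_smul, h, smul_smul, inv_mul_cancel₀ hκ'.ne', one_smul]
    simpa using hy'

lemma apex_notMem_fanPiece (ho : o ∈ P.extremePoints ℝ) (he : e ∈ orientedEdges P) :
    o ∉ fanPiece o e := by
  intro hx
  obtain ⟨κ, s, hκ, h0, h1, h2, hne, -⟩ := fan_exit ho he hx
  have : κ • (e.1 + s • toPlane e.2.1 - o) = 0 := by
    have := congrArg (fun z => z - o) h2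
    simpa using this.symm
  rcases smul_eq_zero.1 this with h | h
  · exact hκ.ne' h
  · exact hne (sub_eq_zero.1 h)

/-- A lattice polygon is the disjoint union of an extreme point and the pieces of its fan. -/
lemma eq_union_fanPiece (hP : IsLatticePolygon P) (ho : o ∈ P.extremePoints ℝ) :
    P = {o} ∪ ⋃ e ∈ edgeFinset hP, fanPiece o e := by
  ext x
  simp only [mem_union, mem_singleton_iff, mem_iUnion, mem_edgeFinset, exists_prop]
  constructor
  · intro hx
    by_cases h : x = o
    · exact Or.inl h
    · exact Or.inr (fan_cover hP ho.1 hx h)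
  · rintro (rfl | ⟨e, he, hx⟩)
    · exact ho.1
    · exact fanPiece_subset hP.convex ho.1 he hx

/-- A minimum of the second coordinate cannot be interior, so the boundary is not empty and some
edge has a tail. -/
lemma exists_vertex (hP : IsLatticePolygon P) : ∃ o ∈ P.extremePoints ℝ, o ∈ frontier P := by
  obtain ⟨x, hx, hmax⟩ := hP.isCompact.exists_isMinOn (hP.2.mono interior_subset)
    (crossCLM ![1, 0]).continuous.continuousOn
  have hf : x ∈ frontier P := by
    refine ⟨subset_closure hx, fun h => ?_⟩
    obtain ⟨y, hy, hlt⟩ := exists_cross_neg h (d := ![1, 0]) (by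
      intro h0; have := congrFun h0 0; simp at this)
    have := hmax hy
    simp [cross_sub_right] at this hlt
    linarith
  obtain ⟨e, he, -⟩ := exists_edge hP hf
  refine ⟨e.1, edge_tail_extreme he, ?_⟩
  simpa using edge_mem_frontier he le_rfl he.2.1.le

end Fan

/-! ### Finite sums over lattice points and over pairs of naturals -/

section FinSums

variable {M : Type*} [AddCommGroup M] [Module ℝ M]

lemma finsum_mem_add_const {s : Set (Fin 2 → ℤ)} (hs : s.Finite) (f : (Fin 2 → ℤ) → M) (c : M) :
    ∑ᶠ x ∈ s, (f x + c) = ∑ᶠ x ∈ s, f x + (s.ncard : ℝ) • c := by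
  rw [finsum_mem_add_distrib hs, finsum_mem_eq_finite_toFinset_sum _ hs,
    finsum_mem_eq_finite_toFinset_sum _ hs, Finset.sum_const, Set.ncard_eq_toFinset_card _ hs,
    Nat.cast_smul_eq_nsmul]

lemma finsum_mem_const_sub {s : Set (Fin 2 → ℤ)} (hs : s.Finite) (f : (Fin 2 → ℤ) → M) (c : M) :
    ∑ᶠ x ∈ s, (c - f x) = (s.ncard : ℝ) • c - ∑ᶠ x ∈ s, f x := by
  rw [finsum_mem_sub_distrib _ _ hs, finsum_mem_eq_finite_toFinset_sum _ hs,
    finsum_mem_eq_finite_toFinset_sum _ hs, Finset.sum_const, Set.ncard_eq_toFinset_card _ hs,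
    Nat.cast_smul_eq_nsmul]

end FinSums

/-- The pairs of natural numbers with sum less than `n`. -/
def pairs (n : ℕ) : Finset (ℕ × ℕ) :=
  {q ∈ Finset.range n ×ˢ Finset.range n | q.1 + q.2 < n}

lemma mem_pairs {n : ℕ} {q : ℕ × ℕ} : q ∈ pairs n ↔ q.1 + q.2 < n := by
  simp [pairs]; omega

lemma sum_pairs_succ {M : Type*} [AddCommMonoid M] (n : ℕ) (f : ℕ × ℕ → M) :
    ∑ q ∈ pairs (n + 1), f q = ∑ q ∈ pairs n, f q + ∑ q ∈ Finset.HasAntidiagonal.antidiagonal n, f q := by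
  rw [← Finset.sum_union]
  · congr 1
    ext q
    simp [mem_pairs]; omega
  · rw [Finset.disjoint_left]
    intro q h1 h2
    rw [mem_pairs] at h1
    rw [Finset.HasAntidiagonal.mem_antidiagonal] at h2
    omega

lemma sum_antidiagonal_fst (n : ℕ) :
    ∑ q ∈ Finset.HasAntidiagonal.antidiagonal n, (q.1 : ℝ) = n * (n + 1) / 2 := by
  rw [Finset.Nat.sum_antidiagonal_eq_sum_range_succ (fun i _ => (i : ℝ))]
  induction n with
  | zero => simp
  | succ n ih => rw [Finset.sum_range_succ, ih]; push_cast; ring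

lemma sum_antidiagonal_snd (n : ℕ) :
    ∑ q ∈ Finset.HasAntidiagonal.antidiagonal n, (q.2 : ℝ) = n * (n + 1) / 2 := by
  rw [← sum_antidiagonal_fst, ← Finset.Nat.sum_antidiagonal_swap]
  simp

lemma card_pairs (n : ℕ) : ((pairs n).card : ℝ) = n * (n + 1) / 2 := by
  induction n with
  | zero => simp [pairs]
  | succ n ih =>
    have := sum_pairs_succ n (fun _ => (1 : ℝ))
    simp only [Finset.sum_const, nsmul_eq_mul, mul_one, Finset.Nat.card_antidiagonal] at this
    rw [this, ih]; push_cast; ring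

lemma sum_pairs_fst (n : ℕ) : ∑ q ∈ pairs n, (q.1 : ℝ) = (n + 1) * n * (n - 1) / 6 := by
  induction n with
  | zero => simp [pairs]
  | succ n ih => rw [sum_pairs_succ, ih, sum_antidiagonal_fst]; push_cast; ring

lemma sum_pairs_snd (n : ℕ) : ∑ q ∈ pairs n, (q.2 : ℝ) = (n + 1) * n * (n - 1) / 6 := by
  induction n with
  | zero => simp [pairs]
  | succ n ih => rw [sum_pairs_succ, ih, sum_antidiagonal_snd]; push_cast; ring

lemma sum_pairs_affine (n : ℕ) (c A B : Plane) :
    ∑ q ∈ pairs n, (c + ((q.1 : ℝ) • A + (q.2 : ℝ) • B)) =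
      ((n : ℝ) * (n + 1) / 2) • c + (((n : ℝ) + 1) * n * (n - 1) / 6) • (A + B) := by
  rw [Finset.sum_add_distrib, Finset.sum_const, Finset.sum_add_distrib, ← Finset.sum_smul,
    ← Finset.sum_smul, sum_pairs_fst, sum_pairs_snd, ← smul_add, ← card_pairs,
    Nat.cast_smul_eq_nsmul]

/-! ### Tiling a dilated half-open lattice triangle -/

section Crosses

lemma crossZ_self (x : Fin 2 → ℤ) : crossZ x x = 0 := by simp [crossZ]; ring
lemma crossZ_add_right (x y z : Fin 2 → ℤ) : crossZ x (y + z) = crossZ x y + crossZ x z := by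
  simp [crossZ]; ring
lemma crossZ_sub_right (x y z : Fin 2 → ℤ) : crossZ x (y - z) = crossZ x y - crossZ x z := by
  simp [crossZ]; ring
lemma crossZ_smul_right (x y : Fin 2 → ℤ) (c : ℤ) : crossZ x (c • y) = c * crossZ x y := by
  simp [crossZ]; ring
lemma crossZ_add_left (x y z : Fin 2 → ℤ) : crossZ (x + y) z = crossZ x z + crossZ y z := by
  simp [crossZ]; ring
lemma crossZ_sub_left (x y z : Fin 2 → ℤ) : crossZ (x - y) z = crossZ x z - crossZ y z := by
  simp [crossZ]; ring
lemma crossZ_smul_left (x y : Fin 2 → ℤ) (c : ℤ) : crossZ (c • x) y = c * crossZ x y := by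
  simp [crossZ]; ring
lemma crossZ_swap (x y : Fin 2 → ℤ) : crossZ x y = - crossZ y x := by
  simp [crossZ]; ring

end Crosses

section Triangles

variable {A B : Fin 2 → ℤ}

/-- The lattice points `x = α A + β B` with `0 < α`, `0 ≤ β`, `α + β ≤ i`. -/
def halfTri (A B : Fin 2 → ℤ) (i : ℕ) : Set (Fin 2 → ℤ) :=
  {x | 0 < crossZ x B ∧ 0 ≤ crossZ A x ∧ crossZ x B + crossZ A x ≤ i * crossZ A B}

/-- The lattice points `x = α A + β B` with `α ≤ 1`, `β < 1`, `1 < α + β`. -/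
def upperTri (A B : Fin 2 → ℤ) : Set (Fin 2 → ℤ) :=
  {x | crossZ x B ≤ crossZ A B ∧ crossZ A x < crossZ A B ∧ crossZ A B < crossZ x B + crossZ A x}

lemma crossZ_injective (hD : 0 < crossZ A B) :
    Function.Injective fun x : Fin 2 → ℤ => (crossZ x B, crossZ A x) := by
  intro x y h
  simp only [Prod.mk.injEq] at h
  obtain ⟨h1, h2⟩ := h
  unfold crossZ at *
  apply int_ext
  · apply mul_left_cancel₀ hD.ne'
    linear_combination (A 0) * h1 + (B 0) * h2
  · apply mul_left_cancel₀ hD.ne'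
    linear_combination (A 1) * h1 + (B 1) * h2

lemma finite_of_crossZ_bounds (hD : 0 < crossZ A B) {s : Set (Fin 2 → ℤ)} (c : ℤ)
    (h : ∀ x ∈ s, -c ≤ crossZ x B ∧ crossZ x B ≤ c ∧ -c ≤ crossZ A x ∧ crossZ A x ≤ c) :
    s.Finite := by
  refine ((Set.finite_Icc (-c) c).prod (Set.finite_Icc (-c) c)).preimage
    (crossZ_injective hD).injOn |>.subset ?_
  intro x hx
  obtain ⟨h1, h2, h3, h4⟩ := h x hx
  exact ⟨⟨h1, h2⟩, ⟨h3, h4⟩⟩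

lemma halfTri_finite (hD : 0 < crossZ A B) (i : ℕ) : (halfTri A B i).Finite := by
  refine finite_of_crossZ_bounds hD (i * crossZ A B) ?_
  rintro x ⟨h1, h2, h3⟩
  have : 0 ≤ i * crossZ A B := by positivity
  refine ⟨?_, ?_, ?_, ?_⟩ <;> linarith

lemma upperTri_finite (hD : 0 < crossZ A B) : (upperTri A B).Finite := by
  refine finite_of_crossZ_bounds hD (crossZ A B) ?_
  rintro x ⟨h1, h2, h3⟩
  refine ⟨?_, ?_, ?_, ?_⟩ <;> linarith

/-- Subtracting jA + lB moves a lattice point into the half-open parallelogram 0 < α ≤ 1, 0 ≤ β < 1,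
which `halfTri A B 1` and `upperTri A B` share out. A translate of the lower half fits in the i-th
dilate when j + l < i, one of the upper half when j + l < i - 1. -/
lemma halfTri_eq (hD : 0 < crossZ A B) (i : ℕ) :
    halfTri A B i = (⋃ q ∈ pairs i, (fun x => x + ((q.1 : ℤ) • A + (q.2 : ℤ) • B)) '' halfTri A B 1) ∪
      ⋃ q ∈ pairs (i - 1), (fun x => x + ((q.1 : ℤ) • A + (q.2 : ℤ) • B)) '' upperTri A B := by
  ext x
  simp only [mem_union, mem_iUnion, mem_image, exists_prop, mem_pairs]
  constructor
  · rintro ⟨h1, h2, h3⟩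
    set D := crossZ A B
    set X := crossZ x B with hX
    set Y := crossZ A x with hY
    -- Dividing X - 1 instead of X leaves the remainder of X in (0, D], as the condition 0 < α ≤ 1
    -- requires; for Y the usual remainder in [0, D) is right.
    obtain ⟨j, hj⟩ := Int.eq_ofNat_of_zero_le (Int.ediv_nonneg (show 0 ≤ X - 1 by linarith) hD.le)
    obtain ⟨l, hl⟩ := Int.eq_ofNat_of_zero_le (Int.ediv_nonneg h2 hD.le)
    have e1 := Int.mul_ediv_add_emod (X - 1) D
    have e2 := Int.mul_ediv_add_emod Y D
    have p1 := Int.emod_nonneg (X - 1) hD.ne'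
    have p2 := Int.emod_nonneg Y hD.ne'
    have p3 := Int.emod_lt_of_pos (X - 1) hD
    have p4 := Int.emod_lt_of_pos Y hD
    rw [hj] at e1
    rw [hl] at e2
    set y := x - ((j : ℤ) • A + (l : ℤ) • B) with hy
    have hyX : crossZ y B = X - j * D := by
      rw [hy, crossZ_sub_left, crossZ_add_left, crossZ_smul_left, crossZ_smul_left, crossZ_self]
      ring
    have hyY : crossZ A y = Y - l * D := by
      rw [hy, crossZ_sub_right, crossZ_add_right, crossZ_smul_right, crossZ_smul_right, crossZ_self]
      ring
    by_cases hc : crossZ y B + crossZ A y ≤ D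
    · refine Or.inl ⟨(j, l), ?_, y, ⟨by nlinarith, by nlinarith, ?_⟩, by simp [hy]⟩
      · have : ((j : ℤ) + l) * D < i * D := by nlinarith
        exact_mod_cast lt_of_mul_lt_mul_right this hD.le
      · simpa using hc
    · push Not at hc
      refine Or.inr ⟨(j, l), ?_, y, ⟨by nlinarith, by nlinarith, by linarith⟩, by simp [hy]⟩
      have : ((j : ℤ) + l + 1) * D < i * D := by nlinarith
      have := lt_of_mul_lt_mul_right this hD.le
      simp only
      omega
  · have key : ∀ (j l : ℤ) (y : Fin 2 → ℤ), crossZ (y + (j • A + l • B)) B = crossZ y B + j * crossZ A B ∧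
        crossZ A (y + (j • A + l • B)) = crossZ A y + l * crossZ A B := by
      intro j l y
      simp only [crossZ_add_left, crossZ_smul_left, crossZ_add_right, crossZ_smul_right, crossZ_self]
      constructor <;> ring
    rintro (⟨⟨j, l⟩, hq, y, ⟨h1, h2, h3⟩, rfl⟩ | ⟨⟨j, l⟩, hq, y, ⟨h1, h2, h3⟩, rfl⟩)
    · simp only at hq
      obtain ⟨k1, k2⟩ := key j l y
      have hq' : (j : ℤ) + l + 1 ≤ i := by exact_mod_cast hq
      push_cast at h3
      refine ⟨?_, ?_, ?_⟩
      · rw [k1]; positivity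
      · rw [k2]; positivity
      · rw [k1, k2]; nlinarith
    · simp only at hq
      obtain ⟨k1, k2⟩ := key j l y
      have hq' : (j : ℤ) + l + 2 ≤ i := by omega
      refine ⟨?_, ?_, ?_⟩
      · rw [k1]; have : 0 ≤ (j : ℤ) * crossZ A B := by positivity
        linarith
      · rw [k2]; have : 0 ≤ (l : ℤ) * crossZ A B := by positivity
        linarith
      · rw [k1, k2]; nlinarith

lemma shift_unique (hD : 0 < crossZ A B) {j l j' l' : ℕ} {x x' : Fin 2 → ℤ}
    (hx : 0 < crossZ x B ∧ crossZ x B ≤ crossZ A B ∧ 0 ≤ crossZ A x ∧ crossZ A x < crossZ A B)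
    (hx' : 0 < crossZ x' B ∧ crossZ x' B ≤ crossZ A B ∧ 0 ≤ crossZ A x' ∧ crossZ A x' < crossZ A B)
    (h : x + ((j : ℤ) • A + (l : ℤ) • B) = x' + ((j' : ℤ) • A + (l' : ℤ) • B)) :
    j = j' ∧ l = l' := by
  have h1 := congrArg (fun z => crossZ z B) h
  have h2 := congrArg (fun z => crossZ A z) h
  simp only [crossZ_add_left, crossZ_smul_left, crossZ_add_right, crossZ_smul_right, crossZ_self] at h1 h2
  set D := crossZ A B
  obtain ⟨a1, a2, a3, a4⟩ := hx
  obtain ⟨b1, b2, b3, b4⟩ := hx'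
  constructor
  · have u1 : ((j : ℤ) - j') * D < 1 * D := by linarith
    have u2 : ((j' : ℤ) - j) * D < 1 * D := by linarith
    have := lt_of_mul_lt_mul_right u1 hD.le
    have := lt_of_mul_lt_mul_right u2 hD.le
    omega
  · have u1 : ((l : ℤ) - l') * D < 1 * D := by linarith
    have u2 : ((l' : ℤ) - l) * D < 1 * D := by linarith
    have := lt_of_mul_lt_mul_right u1 hD.le
    have := lt_of_mul_lt_mul_right u2 hD.le
    omega

lemma halfTri_one_bounds {x : Fin 2 → ℤ} (hx : x ∈ halfTri A B 1) :
    0 < crossZ x B ∧ crossZ x B ≤ crossZ A B ∧ 0 ≤ crossZ A x ∧ crossZ A x < crossZ A B := by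
  obtain ⟨h1, h2, h3⟩ := hx
  push_cast at h3
  refine ⟨h1, by linarith, h2, by linarith⟩

lemma upperTri_bounds {x : Fin 2 → ℤ} (hx : x ∈ upperTri A B) :
    0 < crossZ x B ∧ crossZ x B ≤ crossZ A B ∧ 0 ≤ crossZ A x ∧ crossZ A x < crossZ A B := by
  obtain ⟨h1, h2, h3⟩ := hx
  refine ⟨by linarith, h1, by linarith, h2⟩

lemma disjoint_halfTri_upperTri : Disjoint (halfTri A B 1) (upperTri A B) := by
  rw [Set.disjoint_left]
  rintro x ⟨-, -, h⟩ ⟨-, -, h'⟩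
  push_cast at h
  linarith

/-- Decomposition of a sum over a dilated lattice triangle. -/
lemma finsum_halfTri {M : Type*} [AddCommMonoid M] (hD : 0 < crossZ A B) (i : ℕ)
    (f : (Fin 2 → ℤ) → M) :
    ∑ᶠ x ∈ halfTri A B i, f x =
      ∑ q ∈ pairs i, ∑ᶠ x ∈ halfTri A B 1, f (x + ((q.1 : ℤ) • A + (q.2 : ℤ) • B)) +
      ∑ q ∈ pairs (i - 1), ∑ᶠ x ∈ upperTri A B, f (x + ((q.1 : ℤ) • A + (q.2 : ℤ) • B)) := by
  have hf1 : ∀ q : ℕ × ℕ, ((fun x => x + ((q.1 : ℤ) • A + (q.2 : ℤ) • B)) '' halfTri A B 1).Finite :=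
    fun q => (halfTri_finite hD 1).image _
  have hf2 : ∀ q : ℕ × ℕ, ((fun x => x + ((q.1 : ℤ) • A + (q.2 : ℤ) • B)) '' upperTri A B).Finite :=
    fun q => (upperTri_finite hD).image _
  have e1 : ∀ (n : ℕ) (t : Set (Fin 2 → ℤ)) (ht : t.Finite) (hb : ∀ x ∈ t, 0 < crossZ x B ∧
        crossZ x B ≤ crossZ A B ∧ 0 ≤ crossZ A x ∧ crossZ A x < crossZ A B),
      ∑ᶠ x ∈ ⋃ q ∈ pairs n, (fun x => x + ((q.1 : ℤ) • A + (q.2 : ℤ) • B)) '' t, f x =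
      ∑ q ∈ pairs n, ∑ᶠ x ∈ t, f (x + ((q.1 : ℤ) • A + (q.2 : ℤ) • B)) := by
    intro n t ht hb
    have := finsum_mem_biUnion (f := f) (I := (pairs n : Set (ℕ × ℕ)))
      (t := fun q => (fun x => x + ((q.1 : ℤ) • A + (q.2 : ℤ) • B)) '' t) ?_
      (pairs n).finite_toSet (fun q _ => ht.image _)
    · simp only [Finset.mem_coe] at this
      rw [this]
      rw [finsum_mem_finset_eq_sum]
      refine Finset.sum_congr rfl fun q _ => ?_
      rw [finsum_mem_image]
      exact (add_left_injective _).injOn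
    · rintro ⟨j, l⟩ - ⟨j', l'⟩ - hne
      rw [Function.onFun, Set.disjoint_left]
      rintro _ ⟨x, hx, rfl⟩ ⟨x', hx', h⟩
      obtain ⟨rfl, rfl⟩ := shift_unique hD (hb _ hx') (hb _ hx) h
      exact hne rfl
  rw [halfTri_eq hD, finsum_mem_union, e1 _ _ (halfTri_finite hD 1) fun x => halfTri_one_bounds,
    e1 _ _ (upperTri_finite hD) fun x => upperTri_bounds]
  · rw [Set.disjoint_left]
    simp only [mem_iUnion, mem_image, exists_prop]
    rintro _ ⟨⟨j, l⟩, -, x, hx, rfl⟩ ⟨⟨j', l'⟩, -, x', hx', h⟩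
    obtain ⟨rfl, rfl⟩ := shift_unique hD (upperTri_bounds hx') (halfTri_one_bounds hx) h
    have := add_right_cancel h
    subst this
    exact Set.disjoint_left.1 disjoint_halfTri_upperTri hx hx'
  · exact (pairs i).finite_toSet.biUnion fun q _ => hf1 q
  · exact (pairs (i - 1)).finite_toSet.biUnion fun q _ => hf2 q

lemma ncard_halfTri (hD : 0 < crossZ A B) {i : ℕ} (hi : 0 < i) :
    ((halfTri A B i).ncard : ℝ) = (i : ℝ) * (i + 1) / 2 * (halfTri A B 1).ncard +
      (i : ℝ) * (i - 1) / 2 * (upperTri A B).ncard := by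
  have := finsum_halfTri hD i (fun _ => (1 : ℕ))
  simp only [finsum_one, Finset.sum_const, smul_eq_mul] at this
  rw [this]
  push_cast
  rw [card_pairs, card_pairs, Nat.cast_pred hi]
  ring

lemma sum_halfTri (hD : 0 < crossZ A B) {i : ℕ} (hi : 0 < i) :
    ∑ᶠ x ∈ halfTri A B i, toPlane x =
      ((i : ℝ) * (i + 1) / 2) • ∑ᶠ x ∈ halfTri A B 1, toPlane x +
      ((i : ℝ) * (i - 1) / 2) • ∑ᶠ x ∈ upperTri A B, toPlane x +
      ((((i : ℝ) + 1) * i * (i - 1) / 6) * (halfTri A B 1).ncard +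
        ((i : ℝ) * (i - 1) * (i - 2) / 6) * (upperTri A B).ncard) • (toPlane A + toPlane B) := by
  rw [finsum_halfTri hD]
  simp only [toPlane_add, toPlane_zsmul, Int.cast_natCast]
  simp only [finsum_mem_add_const (halfTri_finite hD 1), finsum_mem_add_const (upperTri_finite hD),
    smul_add, smul_smul]
  have hc : ∀ (n c : ℝ) , n * c = c * n := fun n c => mul_comm _ _
  simp only [hc ((halfTri A B 1).ncard : ℝ), hc ((upperTri A B).ncard : ℝ)]
  simp only [mul_smul]
  rw [sum_pairs_affine, sum_pairs_affine, Nat.cast_pred hi]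
  module

end Triangles

/-! ### Lattice points on the sides of a triangle; reflection of the upper half -/

lemma exists_smul_of_crossZ_eq_zero {a x : Fin 2 → ℤ} (ha : IsCoprime (a 0) (a 1))
    (h : crossZ a x = 0) : ∃ c : ℤ, x = c • a := by
  obtain ⟨α, β, hab⟩ := ha
  unfold crossZ at h
  refine ⟨α * x 0 + β * x 1, int_ext ?_ ?_⟩
  · simp only [Pi.smul_apply, smul_eq_mul]; linear_combination (-x 0) * hab + (-β) * h
  · simp only [Pi.smul_apply, smul_eq_mul]; linear_combination (-x 1) * hab + α * h

/-- The points `c, c + w, …, c + (n - 1) w`. -/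
def latticeRun (c w : Fin 2 → ℤ) (n : ℕ) : Set (Fin 2 → ℤ) :=
  (fun j : ℕ => c + (j : ℤ) • w) '' (Finset.range n : Set ℕ)

lemma mem_latticeRun {c w x : Fin 2 → ℤ} {n : ℕ} :
    x ∈ latticeRun c w n ↔ ∃ j : ℤ, 0 ≤ j ∧ j < n ∧ x = c + j • w := by
  constructor
  · rintro ⟨j, hj, rfl⟩
    exact ⟨j, by positivity, by simpa using hj, rfl⟩
  · rintro ⟨j, h0, h1, rfl⟩
    lift j to ℕ using h0
    exact ⟨j, by simpa using h1, rfl⟩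

lemma latticeRun_finite (c w : Fin 2 → ℤ) (n : ℕ) : (latticeRun c w n).Finite :=
  (Finset.range n).finite_toSet.image _

lemma latticeRun_injective {w : Fin 2 → ℤ} (hw : w ≠ 0) (c : Fin 2 → ℤ) :
    Function.Injective fun j : ℕ => c + (j : ℤ) • w := by
  intro i j h
  have h1 := add_left_cancel h
  have h2 : ((i : ℤ) - j) • w = 0 := by rw [sub_smul, h1, sub_self]
  rcases smul_eq_zero.1 h2 with h3 | h3
  · omega
  · exact absurd h3 hw

lemma ncard_latticeRun {w : Fin 2 → ℤ} (hw : w ≠ 0) (c : Fin 2 → ℤ) (n : ℕ) :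
    (latticeRun c w n).ncard = n := by
  rw [latticeRun, Set.ncard_image_of_injective _ (latticeRun_injective hw c)]
  simp

lemma sum_latticeRun {w : Fin 2 → ℤ} (hw : w ≠ 0) (c : Fin 2 → ℤ) (n : ℕ) :
    ∑ᶠ x ∈ latticeRun c w n, toPlane x =
      (n : ℝ) • toPlane c + ((n : ℝ) * (n - 1) / 2) • toPlane w := by
  rw [latticeRun, finsum_mem_image (latticeRun_injective hw c).injOn, finsum_mem_coe_finset]
  simp only [toPlane_add, toPlane_zsmul, Int.cast_natCast]
  rw [Finset.sum_add_distrib, ← Finset.sum_smul]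
  have : ∑ j ∈ Finset.range n, (j : ℝ) = (n : ℝ) * (n - 1) / 2 := by
    induction n with
    | zero => simp
    | succ n ih => rw [Finset.sum_range_succ, ih]; push_cast; ring
  rw [this]
  simp [Nat.cast_smul_eq_nsmul]

lemma finsum_mem_one_real (s : Set (Fin 2 → ℤ)) (hs : s.Finite) :
    ∑ᶠ x ∈ s, (1 : ℝ) = s.ncard := by
  rw [finsum_mem_eq_finite_toFinset_sum _ hs, Set.ncard_eq_toFinset_card _ hs]; simp

section Triangles

variable {A B a b w : Fin 2 → ℤ} {gA gB g : ℕ}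

/-- The closed triangle is the half-open one together with its side from 0 to B. Compared with
`sub_two_sides_eq`, it relates the two halves of the parallelogram. -/
lemma sub_side_eq {M : Type*} [AddCommGroup M] (hD : 0 < crossZ A B) (hb : IsCoprime (b 0) (b 1))
    (hB : B = (gB : ℤ) • b) (f : (Fin 2 → ℤ) → M) :
    ∑ᶠ x ∈ {x | 0 ≤ crossZ x B ∧ 0 ≤ crossZ A x ∧ crossZ x B + crossZ A x ≤ crossZ A B}, f x =
      ∑ᶠ x ∈ halfTri A B 1, f x + ∑ᶠ x ∈ latticeRun 0 b (gB + 1), f x := by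
  have hgB : 0 < gB ∧ 0 < crossZ A b := by
    rw [hB, crossZ_smul_right] at hD
    constructor
    · rcases Nat.eq_zero_or_pos gB with h | h
      · simp [h] at hD
      · exact h
    · exact pos_of_mul_pos_right hD (by positivity)
  have hD' : crossZ A B = gB * crossZ A b := by rw [hB, crossZ_smul_right]
  rw [← finsum_mem_union _ (halfTri_finite hD 1) (latticeRun_finite _ _ _)]
  · refine finsum_mem_congr (Set.ext fun x => ?_) fun _ _ => rfl
    simp only [mem_ofPred_eq, mem_union, mem_latticeRun, halfTri, zero_add]
    push_cast
    rw [one_mul]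
    constructor
    · rintro ⟨h1, h2, h3⟩
      rcases h1.eq_or_lt with h | h
      · right
        rw [hB, crossZ_smul_right] at h
        have h4 : crossZ b x = 0 := by
          rw [crossZ_swap, (mul_eq_zero.1 h.symm).resolve_left (by have := hgB.1; positivity), neg_zero]
        obtain ⟨c, rfl⟩ := exists_smul_of_crossZ_eq_zero hb h4
        rw [crossZ_smul_right] at h2 h3
        refine ⟨c, nonneg_of_mul_nonneg_left h2 hgB.2, ?_, rfl⟩
        rw [Int.lt_add_one_iff]
        rw [hB, crossZ_smul_left, crossZ_smul_right, crossZ_smul_right, crossZ_self] at h3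
        exact le_of_mul_le_mul_right (by linarith) hgB.2
      · exact Or.inl ⟨h, h2, h3⟩
    · rintro (⟨h1, h2, h3⟩ | ⟨c, h0, h1, rfl⟩)
      · exact ⟨h1.le, h2, h3⟩
      · have e1 : crossZ (c • b) B = 0 := by
          rw [hB, crossZ_smul_left, crossZ_smul_right, crossZ_self]; ring
        rw [e1, hD', crossZ_smul_right]
        have := hgB.2
        refine ⟨le_rfl, by positivity, ?_⟩
        have : c ≤ gB := by omega
        nlinarith
  · rw [Set.disjoint_left]
    rintro x ⟨h1, -, -⟩ hx
    obtain ⟨c, -, -, rfl⟩ := mem_latticeRun.1 hx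
    rw [hB, zero_add, crossZ_smul_left, crossZ_smul_right, crossZ_self] at h1
    simp at h1

/-- The reflection x ↦ A + B - x carries the upper half to the closed triangle without its sides 0A
and AB. The point A is counted on the first of these, so the run along the second starts at A + w.
-/
lemma sub_two_sides_eq {M : Type*} [AddCommGroup M] (hD : 0 < crossZ A B)
    (ha : IsCoprime (a 0) (a 1)) (hA : A = (gA : ℤ) • a)
    (hw : IsCoprime (w 0) (w 1)) (hAB : B = A + (g : ℤ) • w) (f : (Fin 2 → ℤ) → M) :
    ∑ᶠ x ∈ {x | 0 ≤ crossZ x B ∧ 0 ≤ crossZ A x ∧ crossZ x B + crossZ A x ≤ crossZ A B}, f x =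
      ∑ᶠ x ∈ upperTri A B, f (A + B - x) + ∑ᶠ x ∈ latticeRun 0 a (gA + 1), f x +
        ∑ᶠ x ∈ latticeRun (A + w) w g, f x := by
  have hgA : 0 < gA ∧ 0 < crossZ a B := by
    have hD := hD
    rw [hA, crossZ_smul_left] at hD
    constructor
    · rcases Nat.eq_zero_or_pos gA with h | h
      · simp [h] at hD
      · exact h
    · exact pos_of_mul_pos_right hD (by positivity)
  have hD' : crossZ A B = gA * crossZ a B := by rw [hA, crossZ_smul_left]
  have hD'' : crossZ A B = g * crossZ A w := by
    rw [hAB, crossZ_add_right, crossZ_self, crossZ_smul_right, zero_add]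
  have hg : 0 < g ∧ 0 < crossZ A w := by
    have hD := hD
    rw [hD''] at hD
    constructor
    · rcases Nat.eq_zero_or_pos g with h | h
      · simp [h] at hD
      · exact h
    · exact pos_of_mul_pos_right hD (by positivity)
  have hrefl : ∀ x, crossZ (A + B - x) B = crossZ A B - crossZ x B ∧
      crossZ A (A + B - x) = crossZ A B - crossZ A x := by
    intro x
    simp only [crossZ_add_left, crossZ_sub_left, crossZ_add_right, crossZ_sub_right, crossZ_self]
    constructor <;> ring
  have hinj : Function.Injective fun x : Fin 2 → ℤ => A + B - x := fun x y h => sub_right_injective h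
  rw [← finsum_mem_image (s := upperTri A B) (g := fun x => A + B - x) hinj.injOn,
    ← finsum_mem_union _ ((upperTri_finite hD).image _) (latticeRun_finite _ _ _),
    ← finsum_mem_union _ (((upperTri_finite hD).image _).union (latticeRun_finite _ _ _))
      (latticeRun_finite _ _ _)]
  · refine finsum_mem_congr (Set.ext fun x => ?_) fun _ _ => rfl
    simp only [mem_ofPred_eq, mem_union, mem_latticeRun, mem_image, upperTri, zero_add]
    push_cast
    constructor
    · rintro ⟨h1, h2, h3⟩
      rcases h2.eq_or_lt with h | h
      · left; right
        rw [hA, crossZ_smul_left] at h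
        have h4 : crossZ a x = 0 := 
          (mul_eq_zero.1 h.symm).resolve_left (by have := hgA.1; positivity)
        obtain ⟨c, rfl⟩ := exists_smul_of_crossZ_eq_zero ha h4
        rw [crossZ_smul_left] at h1 h3
        refine ⟨c, nonneg_of_mul_nonneg_left h1 hgA.2, ?_, rfl⟩
        rw [Int.lt_add_one_iff]
        rw [hA, crossZ_smul_left, crossZ_smul_left, crossZ_smul_right, crossZ_self] at h3
        exact le_of_mul_le_mul_right (by linarith) hgA.2
      rcases h3.eq_or_lt with h' | h'
      · right
        have h4 : g * crossZ w (x - A) = 0 := by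
          rw [← crossZ_smul_left]
          have : (g : ℤ) • w = B - A := by rw [hAB]; abel
          rw [this]
          simp only [crossZ_sub_left, crossZ_sub_right, crossZ_self]
          rw [crossZ_swap B A, crossZ_swap B x]
          linarith
        have h5 := (mul_eq_zero.1 h4).resolve_left (by have := hg.1; positivity)
        obtain ⟨c, hc⟩ := exists_smul_of_crossZ_eq_zero hw h5
        have hx : x = A + c • w := by rw [← hc]; abel
        have hcY : crossZ A x = c * crossZ A w := by
          rw [hx, crossZ_add_right, crossZ_self, crossZ_smul_right, zero_add]
        refine ⟨c - 1, ?_, ?_, ?_⟩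
        · rw [hcY] at h
          have := pos_of_mul_pos_left h hg.2.le
          linarith
        · rw [hcY] at h'
          have : c * crossZ A w ≤ g * crossZ A w := by rw [← hD'']; linarith
          have := le_of_mul_le_mul_right this hg.2
          linarith
        · rw [hx, sub_smul, one_smul]; abel
      · left; left
        refine ⟨A + B - x, ⟨?_, ?_, ?_⟩, by simp⟩
        · rw [(hrefl x).1]; linarith
        · rw [(hrefl x).2]; linarith
        · rw [(hrefl x).1, (hrefl x).2]; linarith
    · rintro ((⟨y, ⟨h1, h2, h3⟩, rfl⟩ | ⟨c, h0, h1, rfl⟩) | ⟨c, h0, h1, rfl⟩)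
      · rw [(hrefl y).1, (hrefl y).2]
        refine ⟨?_, ?_, ?_⟩ <;> linarith
      · have e1 : crossZ A (c • a) = 0 := by
          rw [hA, crossZ_smul_left, crossZ_smul_right, crossZ_self]; ring
        rw [e1, hD', crossZ_smul_left]
        have := hgA.2
        refine ⟨by positivity, le_rfl, ?_⟩
        have : c ≤ gA := by omega
        nlinarith
      · have e1 : A + w + c • w = A + (c + 1) • w := by rw [add_smul, one_smul]; abel
        have hY : crossZ A (A + w + c • w) = (c + 1) * crossZ A w := by
          rw [e1, crossZ_add_right, crossZ_self, crossZ_smul_right, zero_add]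
        have hX : crossZ (A + w + c • w) B = crossZ A B - (c + 1) * crossZ A w := by
          rw [e1, crossZ_add_left, crossZ_smul_left]
          nth_rewrite 2 [hAB]
          rw [crossZ_add_right, crossZ_smul_right, crossZ_self, crossZ_swap w A]; ring
        have := hg.2
        rw [hX, hY, hD'']
        refine ⟨?_, by positivity, by linarith⟩
        have : c + 1 ≤ g := by omega
        nlinarith
  · rw [Set.disjoint_left]
    rintro x hx hx3
    obtain ⟨c, h0, h1, rfl⟩ := mem_latticeRun.1 hx3
    have e1 : A + w + c • w = A + (c + 1) • w := by rw [add_smul, one_smul]; abel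
    have hY : crossZ A (A + w + c • w) = (c + 1) * crossZ A w := by
      rw [e1, crossZ_add_right, crossZ_self, crossZ_smul_right, zero_add]
    have hX : crossZ (A + w + c • w) B = crossZ A B - (c + 1) * crossZ A w := by
      rw [e1, crossZ_add_left, crossZ_smul_left]
      nth_rewrite 2 [hAB]
      rw [crossZ_add_right, crossZ_smul_right, crossZ_self, crossZ_swap w A]; ring
    have := hg.2
    rcases hx with ⟨y, ⟨k1, k2, k3⟩, hy⟩ | hx
    · simp only at hy
      rw [← hy, (hrefl y).1] at hX
      rw [← hy, (hrefl y).2] at hY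
      linarith
    · obtain ⟨c', -, -, hc'⟩ := mem_latticeRun.1 hx
      rw [hc', zero_add] at hY
      nth_rewrite 1 [hA] at hY
      rw [crossZ_smul_left, crossZ_smul_right, crossZ_self] at hY
      have : 0 < (c + 1) * crossZ A w := by positivity
      simp at hY
      omega
  · rw [Set.disjoint_left]
    rintro x ⟨y, ⟨k1, k2, k3⟩, hy⟩ hx
    simp only at hy
    obtain ⟨c', -, -, hc'⟩ := mem_latticeRun.1 hx
    have h1 := (hrefl y).2
    rw [hy, hc', zero_add] at h1
    nth_rewrite 1 [hA] at h1
    rw [crossZ_smul_left, crossZ_smul_right, crossZ_self] at h1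
    linarith

/-- The number of lattice points in a half-open fundamental parallelogram. -/
lemma ncard_halfTri_add_upperTri (hD : 0 < crossZ A B) (ha : IsCoprime (a 0) (a 1))
    (hA : A = (gA : ℤ) • a) :
    ((halfTri A B 1).ncard : ℝ) + (upperTri A B).ncard = crossZ A B := by
  rw [← Nat.cast_add, ← Set.ncard_union_eq disjoint_halfTri_upperTri (halfTri_finite hD 1)
    (upperTri_finite hD)]
  obtain ⟨α, β, hab⟩ := ha
  -- Complete a to a lattice basis (a, c). On each line of constant c-coordinate q in [0, h) the
  -- parallelogram has exactly gA points, those with a-coordinate in (qr/h, qr/h + gA].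
  set c : Fin 2 → ℤ := ![-β, α] with hc
  have hac : crossZ a c = 1 := by simp [crossZ, hc]; linarith
  set r := crossZ B c with hr
  set h := crossZ a B with hh
  have hD' : crossZ A B = gA * h := by rw [hA, crossZ_smul_left]
  have hgA : 0 < gA ∧ 0 < h := by
    rw [hD'] at hD
    constructor
    · rcases Nat.eq_zero_or_pos gA with h | h
      · simp [h] at hD
      · exact h
    · exact pos_of_mul_pos_right hD (by positivity)
  have hbasis : ∀ x : Fin 2 → ℤ, x = crossZ x c • a + crossZ a x • c := by
    intro x
    unfold crossZ at *
    apply int_ext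
    · simp only [Pi.add_apply, Pi.smul_apply, smul_eq_mul]; linear_combination (-x 0) * hac
    · simp only [Pi.add_apply, Pi.smul_apply, smul_eq_mul]; linear_combination (-x 1) * hac
  have hBe : ∀ p q : ℤ, crossZ (p • a + q • c) B = p * h - q * r := by
    intro p q
    rw [crossZ_add_left, crossZ_smul_left, crossZ_smul_left, crossZ_swap c B]; ring
  have hAe : ∀ p q : ℤ, crossZ A (p • a + q • c) = gA * q := by
    intro p q
    rw [hA, crossZ_smul_left, crossZ_add_right, crossZ_smul_right, crossZ_smul_right, crossZ_self, hac]
    ring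
  have himg : halfTri A B 1 ∪ upperTri A B =
      (fun z : ℤ × ℤ => (z.2 + z.1 * r / h) • a + z.1 • c) ''
        (Finset.Ico 0 h ×ˢ Finset.Ioc 0 (gA : ℤ) : Finset (ℤ × ℤ)) := by
    ext x
    simp only [mem_image, Finset.mem_coe, Finset.mem_product, Finset.mem_Ico, Finset.mem_Ioc, Prod.exists]
    constructor
    · intro hx
      have hb : 0 < crossZ x B ∧ crossZ x B ≤ crossZ A B ∧ 0 ≤ crossZ A x ∧ crossZ A x < crossZ A B := by
        rcases hx with hx | hx
        · exact halfTri_one_bounds hx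
        · exact upperTri_bounds hx
      obtain ⟨h1, h2, h3, h4⟩ := hb
      rw [hbasis x, hBe] at h1 h2
      rw [hbasis x, hAe] at h3 h4
      rw [hD'] at h2 h4
      set p := crossZ x c
      set q := crossZ a x
      have hg' : (0 : ℤ) < gA := by exact_mod_cast hgA.1
      refine ⟨q, p - q * r / h, ⟨⟨nonneg_of_mul_nonneg_right h3 hg', lt_of_mul_lt_mul_left h4 hg'.le⟩,
        ?_, ?_⟩, ?_⟩
      · have : q * r / h < p := by rw [Int.ediv_lt_iff_lt_mul hgA.2]; linarith
        linarith
      · have : p - gA ≤ q * r / h := by rw [Int.le_ediv_iff_mul_le hgA.2]; linarith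
        linarith
      · rw [sub_add_cancel]; exact (hbasis x).symm
    · rintro ⟨q, p, ⟨⟨h1, h2⟩, h3, h4⟩, rfl⟩
      have hp : q * r / h < p + q * r / h := by linarith
      have hp' : (p + q * r / h) - gA ≤ q * r / h := by linarith
      rw [Int.ediv_lt_iff_lt_mul hgA.2] at hp
      rw [Int.le_ediv_iff_mul_le hgA.2] at hp'
      have hg' : (0 : ℤ) < gA := by exact_mod_cast hgA.1
      by_cases hs : crossZ ((p + q * r / h) • a + q • c) B + crossZ A ((p + q * r / h) • a + q • c) ≤ crossZ A B
      · left
        refine ⟨?_, ?_, by simpa using hs⟩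
        · rw [hBe]; linarith
        · rw [hAe]; positivity
      · right
        refine ⟨?_, ?_, by simpa using hs⟩
        · rw [hBe, hD']; linarith
        · rw [hAe, hD']; nlinarith
  rw [himg, Set.InjOn.ncard_image, Set.ncard_coe_finset, Finset.card_product, Int.card_Ico, Int.card_Ioc]
  · simp only [sub_zero, Int.toNat_natCast]
    have : ((h.toNat : ℤ) : ℝ) = h := by rw [Int.toNat_of_nonneg hgA.2.le]
    push_cast at this ⊢
    rw [hD', this]; push_cast; ring
  · rintro ⟨q, p⟩ - ⟨q', p'⟩ - he
    simp only at he
    have h1 := congrArg (crossZ A) he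
    rw [hAe, hAe] at h1
    have hg' : (gA : ℤ) ≠ 0 := by have := hgA.1; positivity
    have hq := mul_left_cancel₀ hg' h1
    subst hq
    have h2 := congrArg (fun z => crossZ z B) he
    simp only [hBe] at h2
    have h3 : (p + q * r / h) * h = (p' + q * r / h) * h := by linarith
    have h4 := mul_right_cancel₀ hgA.2.ne' h3
    have : p = p' := by linarith
    rw [this]

/-- The number of lattice points in a dilated half-open lattice triangle. -/
theorem ncard_halfTri_eq (hD : 0 < crossZ A B)
    (ha : IsCoprime (a 0) (a 1)) (hA : A = (gA : ℤ) • a)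
    (hb : IsCoprime (b 0) (b 1)) (hB : B = (gB : ℤ) • b)
    (hw : IsCoprime (w 0) (w 1)) (hAB : B = A + (g : ℤ) • w) {i : ℕ} (hi : 0 < i) :
    ((halfTri A B i).ncard : ℝ) =
      (i : ℝ) ^ 2 * (crossZ A B / 2) + (i : ℝ) * ((gA + g - gB) / 2) := by
  have h1 := sub_side_eq hD hb hB (fun _ => (1 : ℝ))
  rw [sub_two_sides_eq hD ha hA hw hAB] at h1
  have ne : ∀ {w : Fin 2 → ℤ}, IsCoprime (w 0) (w 1) → w ≠ 0 := by
    rintro _ h rfl; simp [isCoprime_zero_left] at h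
  rw [finsum_mem_one_real _ (upperTri_finite hD), finsum_mem_one_real _ (latticeRun_finite _ _ _),
    finsum_mem_one_real _ (latticeRun_finite _ _ _), finsum_mem_one_real _ (latticeRun_finite _ _ _),
    finsum_mem_one_real _ (halfTri_finite hD 1), ncard_latticeRun (ne ha), ncard_latticeRun (ne hb),
    ncard_latticeRun (ne hw)] at h1
  have h2 := ncard_halfTri_add_upperTri hD ha hA
  rw [ncard_halfTri hD hi]
  push_cast at h1
  -- The i² coefficient is half the sum of the two counts, given by the parallelogram; the i
  -- coefficient is half their difference, given by the reflection.
  linear_combination (-(i : ℝ) / 2) * h1 + ((i : ℝ) ^ 2 / 2) * h2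

/-- The sum of the lattice points in a dilated half-open lattice triangle. -/
theorem exists_sum_halfTri_eq (hD : 0 < crossZ A B)
    (ha : IsCoprime (a 0) (a 1)) (hA : A = (gA : ℤ) • a)
    (hb : IsCoprime (b 0) (b 1)) (hB : B = (gB : ℤ) • b)
    (hw : IsCoprime (w 0) (w 1)) (hAB : B = A + (g : ℤ) • w) :
    ∃ c : Plane, ∀ i : ℕ, 0 < i → ∑ᶠ x ∈ halfTri A B i, toPlane x =
      ((i : ℝ) ^ 3 * (crossZ A B / 6)) • (toPlane A + toPlane B) +
        ((i : ℝ) ^ 2 / 4) • ((gA : ℝ) • toPlane A - (gB : ℝ) • toPlane B +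
          (g : ℝ) • (toPlane A + toPlane B)) + (i : ℝ) • c := by
  have h1 := sub_side_eq hD hb hB toPlane
  rw [sub_two_sides_eq hD ha hA hw hAB] at h1
  have ne : ∀ {w : Fin 2 → ℤ}, IsCoprime (w 0) (w 1) → w ≠ 0 := by
    rintro _ h rfl; simp [isCoprime_zero_left] at h
  have hA' : toPlane A = (gA : ℝ) • toPlane a := by rw [hA, toPlane_zsmul, Int.cast_natCast]
  have hB' : toPlane B = (gB : ℝ) • toPlane b := by rw [hB, toPlane_zsmul, Int.cast_natCast]
  have hw' : (g : ℝ) • toPlane w = toPlane B - toPlane A := by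
    rw [hAB, toPlane_add, toPlane_zsmul, Int.cast_natCast]; abel
  simp only [toPlane_sub] at h1
  rw [finsum_mem_const_sub (upperTri_finite hD), sum_latticeRun (ne ha), sum_latticeRun (ne hb),
    sum_latticeRun (ne hw)] at h1
  have h2 := ncard_halfTri_add_upperTri hD ha hA
  -- The witness collects the terms of `sum_halfTri` linear in i. It needs no closed form, since it
  -- only enters the constant term of the lattice-sum polynomial.
  refine ⟨(1 / 2 : ℝ) • ∑ᶠ x ∈ halfTri A B 1, toPlane x -
    (1 / 2 : ℝ) • ∑ᶠ x ∈ upperTri A B, toPlane x + ((-1 / 6 : ℝ) * (halfTri A B 1).ncard +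
        (1 / 3 : ℝ) * (upperTri A B).ncard) • (toPlane A + toPlane B), fun i hi => ?_⟩
  rw [sum_halfTri hD hi]
  set S1 := ∑ᶠ x ∈ halfTri A B 1, toPlane x
  set S2 := ∑ᶠ x ∈ upperTri A B, toPlane x
  set n1 := ((halfTri A B 1).ncard : ℝ)
  set n2 := ((upperTri A B).ncard : ℝ)
  rw [← h2]
  funext j
  have k1 := congrFun h1 j
  have k2 := congrFun hA' j
  have k3 := congrFun hB' j
  have k4 := congrFun hw' j
  simp only [Pi.add_apply, Pi.sub_apply, Pi.smul_apply, smul_eq_mul, toPlane_add, toPlane_zero,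
    Pi.zero_apply] at k1 k2 k3 k4 ⊢
  push_cast at k1
  -- Only S1 + S2 occurs in the i² coefficient, and the reflection expresses it through n2 and the
  -- three side sums; the other relations rewrite multiples of primitive vectors as side vectors.
  linear_combination (-(i:ℝ)^2/2) * k1 - (i:ℝ)^2/4 * (gA + 1) * k2 + (i:ℝ)^2/4 * (gB + 1) * k3 + (i:ℝ)^2/4 * (g + 1) * k4
  
end Triangles

/-! ### Area and moment of a half-open triangle -/

/-- The half-open standard simplex. -/
def stdSimplexHalf : Set Plane := {z | 0 < z 0 ∧ 0 ≤ z 1 ∧ z 0 + z 1 ≤ 1}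

lemma measurableSet_stdSimplexHalf : MeasurableSet stdSimplexHalf := by
  refine (measurableSet_lt measurable_const (measurable_pi_apply 0)).inter
    ((measurableSet_le measurable_const (measurable_pi_apply 1)).inter
    (measurableSet_le ((measurable_pi_apply 0).add (measurable_pi_apply 1)) measurable_const))

/-- Fubini on the standard triangle. An affine integrand yields area and moment at once and is
preserved by the affine substitution in `integral_triHalf`. -/
lemma integral_stdSimplexHalf (c₀ c₁ c₂ : ℝ) :
    ∫ z in stdSimplexHalf, (c₀ + c₁ * z 0 + c₂ * z 1) = c₀ / 2 + c₁ / 6 + c₂ / 6 := by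
  set T : Set (ℝ × ℝ) := {z | 0 < z.1 ∧ 0 ≤ z.2 ∧ z.1 + z.2 ≤ 1} with hT
  have hTm : MeasurableSet T := by
    refine (measurableSet_lt measurable_const measurable_fst).inter
      ((measurableSet_le measurable_const measurable_snd).inter
      (measurableSet_le (measurable_fst.add measurable_snd) measurable_const))
  have h1 := (volume_preserving_finTwoArrow ℝ).setIntegral_preimage_emb
    (MeasurableEquiv.finTwoArrow (α := ℝ)).measurableEmbedding
    (fun z : ℝ × ℝ => c₀ + c₁ * z.1 + c₂ * z.2) T
  have h2 : (MeasurableEquiv.finTwoArrow (α := ℝ)) ⁻¹' T = stdSimplexHalf := by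
    ext z; simp [hT, stdSimplexHalf, MeasurableEquiv.finTwoArrow]
  rw [h2] at h1
  have h3 : ∫ z in stdSimplexHalf, (c₀ + c₁ * z 0 + c₂ * z 1) =
      ∫ z in T, (c₀ + c₁ * z.1 + c₂ * z.2) := by
    rw [← h1]; rfl
  rw [h3, ← integral_indicator hTm, Measure.volume_eq_prod, integral_prod]
  · have h4 : ∀ x : ℝ, ∫ y : ℝ, T.indicator (fun z : ℝ × ℝ => c₀ + c₁ * z.1 + c₂ * z.2) (x, y) =
        (Ioc (0 : ℝ) 1).indicator (fun x => (c₀ + c₁ * x) * (1 - x) + c₂ * ((1 - x) ^ 2 / 2)) x := by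
      intro x
      by_cases hx : x ∈ Ioc (0 : ℝ) 1
      · have h5 : ∀ y, T.indicator (fun z : ℝ × ℝ => c₀ + c₁ * z.1 + c₂ * z.2) (x, y) =
            (Icc (0 : ℝ) (1 - x)).indicator (fun y => c₀ + c₁ * x + c₂ * y) y := by
          intro y
          simp only [indicator, hT, mem_ofPred_eq, mem_Icc]
          congr 1
          simp only [hx.1, true_and, eq_iff_iff]
          constructor
          · rintro ⟨h, h'⟩; exact ⟨h, by linarith⟩
          · rintro ⟨h, h'⟩; exact ⟨h, by linarith⟩
        have hx1 : 0 ≤ 1 - x := by linarith [hx.2]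
        rw [integral_congr_ae (Filter.Eventually.of_forall h5), integral_indicator measurableSet_Icc,
          integral_Icc_eq_integral_Ioc, ← intervalIntegral.integral_of_le hx1, indicator_of_mem hx,
          intervalIntegral.integral_add (by simp)
            (Continuous.intervalIntegrable (by fun_prop) _ _),
          intervalIntegral.integral_const_mul, intervalIntegral.integral_const, integral_id]
        simp
        ring
      · rw [indicator_of_notMem hx]
        have h5 : ∀ y, T.indicator (fun z : ℝ × ℝ => c₀ + c₁ * z.1 + c₂ * z.2) (x, y) = 0 := by
          intro y
          apply indicator_of_notMem
          rintro ⟨ha, hb, hc⟩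
          simp only at ha hb hc
          exact hx ⟨ha, by linarith⟩
        simp [h5]
    rw [integral_congr_ae (Filter.Eventually.of_forall h4), integral_indicator measurableSet_Ioc,
      ← intervalIntegral.integral_of_le zero_le_one]
    have h6 : ∀ x : ℝ, (c₀ + c₁ * x) * (1 - x) + c₂ * ((1 - x) ^ 2 / 2) =
      (c₀ + c₂ / 2) + ((c₁ - c₀ - c₂) * x + (c₂ / 2 - c₁) * x ^ 2) := fun x => by ring
    have h7 : ∀ d₀ d₁ d₂ : ℝ, ∫ x in (0 : ℝ)..1, (d₀ + (d₁ * x + d₂ * x ^ 2)) =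
        d₀ + d₁ / 2 + d₂ / 3 := by
      intro d₀ d₁ d₂
      rw [intervalIntegral.integral_add (by simp) (Continuous.intervalIntegrable (by fun_prop) _ _),
        intervalIntegral.integral_add (Continuous.intervalIntegrable (by fun_prop) _ _)
          (Continuous.intervalIntegrable (by fun_prop) _ _), intervalIntegral.integral_const_mul,
        intervalIntegral.integral_const_mul, intervalIntegral.integral_const, integral_id,
        integral_pow]
      norm_num
      ring
    simp_rw [h6]
    rw [h7]
    ring
  · rw [integrable_indicator_iff hTm]
    have hc : Continuous fun z : ℝ × ℝ => c₀ + c₁ * z.1 + c₂ * z.2 := by fun_prop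
    refine (hc.continuousOn.integrableOn_compact (isCompact_Icc (a := ((0:ℝ), (0:ℝ))) (b := (1, 1)))).mono_set ?_
    rintro ⟨x, y⟩ ⟨h1, h2, h3⟩
    simp only at h1 h2 h3
    exact ⟨⟨h1.le, h2⟩, ⟨by simp only; linarith, by simp only; linarith⟩⟩

/-- The half-open triangle `o + α A + β B` with `0 < α`, `0 ≤ β`, `α + β ≤ 1`. -/
def triHalf (o A B : Plane) : Set Plane :=
  {x | ∃ α β : ℝ, 0 < α ∧ 0 ≤ β ∧ α + β ≤ 1 ∧ x = o + α • A + β • B}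

section TriHalf

variable {o A B : Plane}

lemma smul_eq_of_cross (hD : cross A B ≠ 0) (x : Plane) :
    x = (cross x B / cross A B) • A + (cross A x / cross A B) • B := by
  have h0 : cross A B * x 0 = cross x B * A 0 + cross A x * B 0 := by unfold cross; ring
  have h1 : cross A B * x 1 = cross x B * A 1 + cross A x * B 1 := by unfold cross; ring
  apply plane_ext
  · simp only [Pi.add_apply, Pi.smul_apply, smul_eq_mul]; field_simp; linarith
  · simp only [Pi.add_apply, Pi.smul_apply, smul_eq_mul]; field_simp; linarith

lemma mem_triHalf_iff (hD : 0 < cross A B) {x : Plane} :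
    x ∈ triHalf o A B ↔ 0 < cross (x - o) B ∧ 0 ≤ cross A (x - o) ∧
      cross (x - o) B + cross A (x - o) ≤ cross A B := by
  constructor
  · rintro ⟨α, β, hα, hβ, hab, rfl⟩
    have e : o + α • A + β • B - o = α • A + β • B := by abel
    rw [e, cross_add_left, cross_add_right, cross_smul_left, cross_smul_left, cross_smul_right,
      cross_smul_right, cross_self, cross_self]
    refine ⟨by simp; positivity, by simp; positivity, by nlinarith⟩
  · rintro ⟨h1, h2, h3⟩
    refine ⟨cross (x - o) B / cross A B, cross A (x - o) / cross A B, by positivity, by positivity, ?_, ?_⟩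
    · rw [← add_div, div_le_one hD]; exact h3
    · rw [add_assoc, ← smul_eq_of_cross hD.ne']; abel

lemma triHalf_eq_image : triHalf o A B = (fun z : Plane => o + z 0 • A + z 1 • B) '' stdSimplexHalf := by
  ext x
  constructor
  · rintro ⟨α, β, hα, hβ, hab, rfl⟩
    exact ⟨![α, β], ⟨hα, hβ, hab⟩, rfl⟩
  · rintro ⟨z, ⟨hα, hβ, hab⟩, rfl⟩
    exact ⟨z 0, z 1, hα, hβ, hab, rfl⟩

lemma measurableSet_triHalf (hD : 0 < cross A B) : MeasurableSet (triHalf o A B) := by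
  have : triHalf o A B = {x | 0 < cross (x - o) B} ∩ ({x | 0 ≤ cross A (x - o)} ∩
      {x | cross (x - o) B + cross A (x - o) ≤ cross A B}) := by
    ext x; rw [mem_triHalf_iff hD]; rfl
  rw [this]
  unfold cross
  refine MeasurableSet.inter (measurableSet_lt ?_ ?_) (MeasurableSet.inter (measurableSet_le ?_ ?_)
    (measurableSet_le ?_ ?_))
  all_goals
    apply Continuous.measurable
    fun_prop

lemma integral_triHalf (hD : 0 < cross A B) (c₀ c₁ c₂ : ℝ) :
    ∫ x in triHalf o A B, (c₀ + c₁ * x 0 + c₂ * x 1) =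
      cross A B * ((c₀ + c₁ * o 0 + c₂ * o 1) / 2 + (c₁ * (A 0 + B 0) + c₂ * (A 1 + B 1)) / 6) := by
  set L : Plane →L[ℝ] Plane := (ContinuousLinearMap.proj (R := ℝ) (φ := fun _ : Fin 2 => ℝ) 0).smulRight A +
    (ContinuousLinearMap.proj (R := ℝ) (φ := fun _ : Fin 2 => ℝ) 1).smulRight B with hL
  have hdet : L.det = cross A B := by
    rw [ContinuousLinearMap.det, ← LinearMap.det_toMatrix', Matrix.det_fin_two]
    simp [LinearMap.toMatrix'_apply, hL, cross]
    ring
  have hderiv : ∀ z ∈ stdSimplexHalf, HasFDerivWithinAt (fun z : Plane => o + z 0 • A + z 1 • B) L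
      stdSimplexHalf z := by
    intro z _
    have : (fun z : Plane => o + z 0 • A + z 1 • B) = fun z => o + L z := by
      funext z; simp [hL, add_assoc]
    rw [this]
    exact (L.hasFDerivAt.const_add o).hasFDerivWithinAt
  have hinj : InjOn (fun z : Plane => o + z 0 • A + z 1 • B) stdSimplexHalf := by
    intro z _ y _ h
    simp only [add_assoc] at h
    have h := add_left_cancel h
    have h1 := congrArg (fun t => cross t B) h
    have h2 := congrArg (fun t => cross A t) h
    simp only [cross_add_left, cross_add_right, cross_smul_left, cross_smul_right, cross_self, mul_zero,
      add_zero, zero_add] at h1 h2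
    exact plane_ext (mul_right_cancel₀ hD.ne' h1) (mul_right_cancel₀ hD.ne' h2)
  rw [triHalf_eq_image, integral_image_eq_integral_abs_det_fderiv_smul volume
    measurableSet_stdSimplexHalf hderiv hinj, hdet, abs_of_pos hD]
  simp only [Pi.add_apply, Pi.smul_apply, smul_eq_mul]
  rw [integral_const_mul]
  have : ∀ z : Plane, c₀ + c₁ * (o 0 + z 0 * A 0 + z 1 * B 0) + c₂ * (o 1 + z 0 * A 1 + z 1 * B 1) =
      (c₀ + c₁ * o 0 + c₂ * o 1) + (c₁ * A 0 + c₂ * A 1) * z 0 + (c₁ * B 0 + c₂ * B 1) * z 1 :=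
    fun z => by ring
  simp_rw [this]
  rw [integral_stdSimplexHalf]
  ring

lemma triHalf_subset_compact (o A B : Plane) : ∃ K, IsCompact K ∧ triHalf o A B ⊆ K := by
  refine ⟨(fun z : Plane => o + z 0 • A + z 1 • B) '' Icc 0 1, isCompact_Icc.image (by fun_prop), ?_⟩
  rw [triHalf_eq_image]
  apply image_mono
  rintro z ⟨h1, h2, h3⟩
  refine ⟨Fin.forall_fin_two.2 ⟨h1.le, h2⟩, Fin.forall_fin_two.2 ⟨?_, ?_⟩⟩ <;> simp <;> linarith

lemma area_triHalf (hD : 0 < cross A B) : volume.real (triHalf o A B) = cross A B / 2 := by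
  have := integral_triHalf (o := o) hD 1 0 0
  simp at this
  rw [this]; ring

lemma moment_triHalf (hD : 0 < cross A B) :
    ∫ x in triHalf o A B, x = (cross A B / 2) • o + (cross A B / 6) • (A + B) := by
  obtain ⟨K, hK, hsub⟩ := triHalf_subset_compact o A B
  have hint : ∀ j, IntegrableOn (fun x : Plane => x j) (triHalf o A B) := fun j =>
    ((continuous_apply j).continuousOn.integrableOn_compact hK).mono_set hsub
  apply plane_ext
  · rw [eval_integral hint]
    have := integral_triHalf (o := o) hD 0 1 0
    simp at this
    rw [this]; simp; ring
  · rw [eval_integral hint]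
    have := integral_triHalf (o := o) hD 0 0 1
    simp at this
    rw [this]; simp; ring

end TriHalf

/-! ### Lattice points in the pieces of the fan -/

/-- The integer parts of the coordinates. -/
def floorVec (x : Plane) : Fin 2 → ℤ := fun j => ⌊x j⌋

@[simp] lemma floorVec_toPlane (a : Fin 2 → ℤ) : floorVec (toPlane a) = a := by
  funext j; simp [floorVec, toPlane]

/-- The lattice length of the segment from `o` to `x`, for lattice points `o` and `x`. -/
def latticeDist (o x : Plane) : ℝ := Int.gcd (floorVec x 0 - floorVec o 0) (floorVec x 1 - floorVec o 1)

lemma latticeDist_self (o : Plane) : latticeDist o o = 0 := by simp [latticeDist]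

/-- With the lattice length of an inner side written as a function of its outer end point alone,
`sum_head_eq_sum_tail` can cancel these lengths between neighbouring pieces. -/
lemma latticeDist_eq {n a w : Fin 2 → ℤ} {g : ℕ} (hw : IsCoprime (w 0) (w 1))
    (h : a - n = (g : ℤ) • w) : latticeDist (toPlane n) (toPlane a) = g := by
  have h0 := congrFun h 0
  have h1 := congrFun h 1
  simp only [Pi.sub_apply, Pi.smul_apply, smul_eq_mul] at h0 h1
  rw [latticeDist, floorVec_toPlane, floorVec_toPlane, h0, h1, Int.gcd_mul_left,
    Int.isCoprime_iff_gcd_eq_one.1 hw]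
  simp

lemma ne_zero_of_coprime {w : Fin 2 → ℤ} (hw : IsCoprime (w 0) (w 1)) : w ≠ 0 := by
  rintro rfl; simp [isCoprime_zero_left] at hw

lemma neg_coprime {w : Fin 2 → ℤ} (hw : IsCoprime (w 0) (w 1)) : IsCoprime ((-w) 0) ((-w) 1) := by
  simpa using hw.neg_neg

lemma inv_smul_sub_eq {i : ℕ} (hi : 0 < i) (x n : Fin 2 → ℤ) :
    (i : ℝ)⁻¹ • toPlane x - toPlane n = (i : ℝ)⁻¹ • toPlane (x - (i : ℤ) • n) := by
  have : (i : ℝ) ≠ 0 := by positivity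
  rw [toPlane_sub, toPlane_zsmul, smul_sub, smul_smul, Int.cast_natCast, inv_mul_cancel₀ this, one_smul]

lemma scaledLatticePoints_finite {P : Set Plane} (hP : Bornology.IsBounded P) {i : ℕ} (hi : 0 < i) :
    (scaledLatticePoints P i).Finite := by
  obtain ⟨C, hC⟩ := hP.exists_norm_le
  have hi' : (0 : ℝ) < i := by exact_mod_cast hi
  refine (Set.finite_Icc (fun _ : Fin 2 => -⌈(i : ℝ) * C⌉) (fun _ => ⌈(i : ℝ) * C⌉)).subset ?_
  intro a ha
  have h1 : ∀ j, |(a j : ℝ)| ≤ i * C := by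
    intro j
    have h2 := (norm_le_pi_norm ((i : ℝ)⁻¹ • toPlane a) j).trans (hC _ ha)
    rw [Pi.smul_apply, smul_eq_mul, norm_mul, norm_inv, Real.norm_natCast, inv_mul_le_iff₀ hi'] at h2
    exact h2
  refine ⟨fun j => ?_, fun j => ?_⟩
  · have h3 : -(i * C) ≤ (a j : ℝ) := (abs_le.1 (h1 j)).1
    have h4 := Int.le_ceil ((i : ℝ) * C)
    have : (-⌈(i : ℝ) * C⌉ : ℝ) ≤ a j := by linarith
    exact_mod_cast this
  · have h3 : (a j : ℝ) ≤ i * C := (abs_le.1 (h1 j)).2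
    have h4 := Int.le_ceil ((i : ℝ) * C)
    have : (a j : ℝ) ≤ ⌈(i : ℝ) * C⌉ := by linarith
    exact_mod_cast this

section Pieces

variable {P : Set Plane} {e : Plane × (Fin 2 → ℤ) × ℝ} {n : Fin 2 → ℤ}

lemma fanPiece_eq_triHalf {o : Plane} (h : e.1 ≠ o) :
    fanPiece o e = triHalf o (e.1 - o) (edgeHead e - o) := by
  ext x
  exact ⟨fun hx => hx.2, fun hx => ⟨h, hx⟩⟩

lemma scaled_triHalf {A B : Fin 2 → ℤ} (hD : 0 < crossZ A B) {i : ℕ} (hi : 0 < i) :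
    scaledLatticePoints (triHalf (toPlane n) (toPlane A) (toPlane B)) i =
      (fun x => x + (i : ℤ) • n) '' halfTri A B i := by
  have hi' : (0 : ℝ) < i := by exact_mod_cast hi
  have hD' : 0 < cross (toPlane A) (toPlane B) := by rw [cross_toPlane]; exact_mod_cast hD
  have key : ∀ x, (i : ℝ)⁻¹ • toPlane x ∈ triHalf (toPlane n) (toPlane A) (toPlane B) ↔
      x - (i : ℤ) • n ∈ halfTri A B i := by
    intro x
    rw [mem_triHalf_iff hD', inv_smul_sub_eq hi, cross_smul_left, cross_smul_right, cross_toPlane,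
      cross_toPlane, cross_toPlane, ← mul_add, mul_pos_iff_of_pos_left (by positivity),
      mul_nonneg_iff_of_pos_left (by positivity), inv_mul_le_iff₀ hi']
    unfold halfTri
    simp only [mem_ofPred_eq]
    norm_cast
  ext x
  rw [scaledLatticePoints, mem_ofPred_eq, key]
  constructor
  · intro h; exact ⟨_, h, by simp⟩
  · rintro ⟨y, hy, rfl⟩; simpa using hy

lemma sum_image_add {s : Set (Fin 2 → ℤ)} (hs : s.Finite) (c : Fin 2 → ℤ) :
    ∑ᶠ x ∈ (fun x => x + c) '' s, toPlane x = ∑ᶠ x ∈ s, toPlane x + (s.ncard : ℝ) • toPlane c := by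
  rw [finsum_mem_image (add_left_injective c).injOn, ← finsum_mem_add_const hs]
  simp only [toPlane_add]

/-- Number and sum of the lattice points in the dilates of a piece of the fan. -/
lemma exists_fanPiece_sums (hP : IsLatticePolygon P) (hn : toPlane n ∈ P.extremePoints ℝ)
    (he : e ∈ orientedEdges P) :
    ∃ c : Plane, ∀ i : ℕ, 0 < i →
      ((scaledLatticePoints (fanPiece (toPlane n) e) i).ncard : ℝ) =
        (i : ℝ) ^ 2 * (cross (e.1 - toPlane n) (edgeHead e - toPlane n) / 2) +
        (i : ℝ) * ((latticeDist (toPlane n) e.1 + e.2.2 - latticeDist (toPlane n) (edgeHead e)) / 2) ∧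
      ∑ᶠ x ∈ scaledLatticePoints (fanPiece (toPlane n) e) i, toPlane x =
        ((scaledLatticePoints (fanPiece (toPlane n) e) i).ncard * (i : ℝ)) • toPlane n +
        ((i : ℝ) ^ 3 * (cross (e.1 - toPlane n) (edgeHead e - toPlane n) / 6)) •
          ((e.1 - toPlane n) + (edgeHead e - toPlane n)) +
        ((i : ℝ) ^ 2 / 4) • (latticeDist (toPlane n) e.1 • (e.1 - toPlane n) -
          latticeDist (toPlane n) (edgeHead e) • (edgeHead e - toPlane n) +
          e.2.2 • ((e.1 - toPlane n) + (edgeHead e - toPlane n))) + (i : ℝ) • c := by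
  obtain ⟨a, g, hg, ha, ht, hb⟩ := edge_lattice hP he
  have hg' : (0 : ℝ) < g := by exact_mod_cast hg
  rcases eq_or_ne e.1 (toPlane n) with h | hne
  · refine ⟨0, fun i hi => ?_⟩
    have hemp : scaledLatticePoints (fanPiece (toPlane n) e) i = ∅ := by
      ext x
      simp [scaledLatticePoints, fanPiece, h]
    have hd : latticeDist (toPlane n) (edgeHead e) = e.2.2 := by
      rw [hb, ht]
      refine latticeDist_eq he.1 ?_
      rw [show a = n from toPlane_injective (ha.symm.trans h)]; abel
    rw [hemp, h, hd, latticeDist_self]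
    simp [cross_zero_left]
  rcases edge_trichotomy he hn with h | h | hD
  · exact absurd h hne
  · have han : a + (g : ℤ) • e.2.1 = n := toPlane_injective (hb.symm.trans h)
    have hA : a - n = (g : ℤ) • (-e.2.1) := by rw [← han, smul_neg]; abel
    have hd : latticeDist (toPlane n) e.1 = g := by
      rw [ha]; exact latticeDist_eq (neg_coprime he.1) hA
    have hA' : e.1 - toPlane n = (g : ℝ) • toPlane (-e.2.1) := by
      rw [ha, ← toPlane_sub, hA, toPlane_zsmul, Int.cast_natCast]
    -- An edge ending at the apex gives a segment without the apex. Its lattice points form an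
    -- arithmetic progression, and the general formulas hold with determinant zero; the witness is
    -- the linear part of its sum.
    refine ⟨(1 / 2 : ℝ) • (e.1 - toPlane n), fun i hi => ?_⟩
    have hi' : (0 : ℝ) < i := by exact_mod_cast hi
    have hrun : scaledLatticePoints (fanPiece (toPlane n) e) i =
        latticeRun ((i : ℤ) • n + -e.2.1) (-e.2.1) (i * g) := by
      ext x
      rw [scaledLatticePoints, mem_ofPred_eq, mem_latticeRun]
      constructor
      · rintro ⟨-, α, β, hα, hβ, hab, hx⟩
        rw [h, sub_self, smul_zero, add_zero, hA', smul_smul, ← sub_eq_iff_eq_add',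
          inv_smul_sub_eq hi] at hx
        have hx2 : toPlane (x - (i : ℤ) • n) = (i * (α * g) : ℝ) • toPlane (-e.2.1) := by
          rw [mul_smul, ← hx, smul_smul, mul_inv_cancel₀ hi'.ne', one_smul]
        obtain ⟨j, hj⟩ := int_of_smul_primitive (neg_coprime he.1) hx2.symm
        rw [hj, ← toPlane_zsmul] at hx2
        have hx3 := toPlane_injective hx2
        have hjpos : 0 < j := by
          have : (0 : ℝ) < j := by rw [← hj]; positivity
          exact_mod_cast this
        have hjle : j ≤ (i * g : ℕ) := by
          have : (j : ℝ) ≤ (i * g : ℕ) := by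
            rw [← hj]; push_cast
            have : α ≤ 1 := by linarith
            nlinarith [mul_pos hi' hg']
          exact_mod_cast this
        refine ⟨j - 1, by omega, by omega, ?_⟩
        rw [sub_smul, one_smul, ← hx3]; abel
      · rintro ⟨j, h0, h1, rfl⟩
        refine ⟨hne, (j + 1) / (i * g), 0, ?_, le_rfl, ?_, ?_⟩
        · have : (0 : ℝ) ≤ j := by exact_mod_cast h0
          positivity
        · rw [add_zero, div_le_one (by positivity)]
          have h2 : j + 1 ≤ (i * g : ℕ) := by omega
          exact_mod_cast h2
        · rw [hA', zero_smul, add_zero, ← sub_eq_iff_eq_add', inv_smul_sub_eq hi, smul_smul]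
          have : (i : ℤ) • n + -e.2.1 + j • -e.2.1 - (i : ℤ) • n = (j + 1) • (-e.2.1) := by
            rw [add_smul, one_smul]; abel
          rw [this, toPlane_zsmul, smul_smul]
          congr 1
          push_cast
          field_simp
    have hw : -e.2.1 ≠ 0 := ne_zero_of_coprime (neg_coprime he.1)
    rw [hrun, ncard_latticeRun hw, sum_latticeRun hw, h, latticeDist_self, hd, sub_self, cross_zero_right,
      hA', ht, toPlane_add, toPlane_zsmul]
    push_cast
    constructor
    · ring
    · module
  · have hD1 : cross (e.1 - toPlane n) (edgeHead e - toPlane n) = crossZ (a - n) (a + (g : ℤ) • e.2.1 - n) := by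
      rw [ha, hb, ← toPlane_sub, ← toPlane_sub, cross_toPlane]
    have hDZ : 0 < crossZ (a - n) (a + (g : ℤ) • e.2.1 - n) := by
      rw [hD1] at hD; exact_mod_cast hD
    have hA0 : a - n ≠ 0 := by intro h; rw [h] at hDZ; simp [crossZ] at hDZ
    have hB0 : a + (g : ℤ) • e.2.1 - n ≠ 0 := by intro h; rw [h] at hDZ; simp [crossZ] at hDZ
    obtain ⟨wa, ga, hwa, -, hga⟩ := exists_primitive hA0
    obtain ⟨wb, gb, hwb, -, hgb⟩ := exists_primitive hB0
    have hAB : a + (g : ℤ) • e.2.1 - n = (a - n) + (g : ℤ) • e.2.1 := by abel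
    have hda : latticeDist (toPlane n) e.1 = ga := by rw [ha]; exact latticeDist_eq hwa hga
    have hdb : latticeDist (toPlane n) (edgeHead e) = gb := by rw [hb]; exact latticeDist_eq hwb hgb
    obtain ⟨c, hc⟩ := exists_sum_halfTri_eq hDZ hwa hga hwb hgb he.1 hAB
    refine ⟨c, fun i hi => ?_⟩
    have hset : scaledLatticePoints (fanPiece (toPlane n) e) i =
        (fun x => x + (i : ℤ) • n) '' halfTri (a - n) (a + (g : ℤ) • e.2.1 - n) i := by
      rw [← scaled_triHalf hDZ hi, fanPiece_eq_triHalf hne, toPlane_sub, toPlane_sub, ← ha, ← hb]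
    rw [hset, Set.ncard_image_of_injective _ (add_left_injective _), sum_image_add (halfTri_finite hDZ i)]
    refine ⟨?_, ?_⟩
    · rw [ncard_halfTri_eq hDZ hwa hga hwb hgb he.1 hAB hi, hD1, hda, hdb, ht]
    · rw [hc i hi, hD1, hda, hdb, ht, toPlane_zsmul]
      rw [toPlane_sub, toPlane_sub, ← ha, ← hb]
      push_cast
      module

end Pieces

/-! ### Ehrhart's formula and the lattice-sum polynomial -/

section LatticePolygon

variable {P : Set Plane} {n : Fin 2 → ℤ}

lemma scaled_eq_union (hP : IsLatticePolygon P) (hn : toPlane n ∈ P.extremePoints ℝ)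
    {i : ℕ} (hi : 0 < i) :
    scaledLatticePoints P i = {(i : ℤ) • n} ∪
      ⋃ e ∈ (edgeFinset hP : Set (Plane × (Fin 2 → ℤ) × ℝ)),
        scaledLatticePoints (fanPiece (toPlane n) e) i := by
  have hi' : (i : ℝ) ≠ 0 := by positivity
  ext x
  have hx : (i : ℝ)⁻¹ • toPlane x = toPlane n ↔ x = (i : ℤ) • n := by
    rw [← sub_eq_zero, inv_smul_sub_eq hi, smul_eq_zero, or_iff_right (inv_ne_zero hi'), ← toPlane_zero,
      toPlane_injective.eq_iff, sub_eq_zero]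
  have h1 : x ∈ scaledLatticePoints P i ↔ (i : ℝ)⁻¹ • toPlane x ∈ P := Iff.rfl
  rw [h1]
  nth_rewrite 1 [eq_union_fanPiece hP hn]
  simp only [mem_union, mem_singleton_iff, mem_iUnion, exists_prop, hx, Finset.mem_coe]
  rfl

lemma finsum_scaled {M : Type*} [AddCommMonoid M] (hP : IsLatticePolygon P)
    (hn : toPlane n ∈ P.extremePoints ℝ) {i : ℕ} (hi : 0 < i) (f : (Fin 2 → ℤ) → M) :
    ∑ᶠ x ∈ scaledLatticePoints P i, f x = f ((i : ℤ) • n) +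
      ∑ e ∈ edgeFinset hP, ∑ᶠ x ∈ scaledLatticePoints (fanPiece (toPlane n) e) i, f x := by
  have hi' : (i : ℝ) ≠ 0 := by positivity
  have hfin : ∀ e ∈ (edgeFinset hP : Set (Plane × (Fin 2 → ℤ) × ℝ)),
      (scaledLatticePoints (fanPiece (toPlane n) e) i).Finite := by
    intro e he
    refine (scaledLatticePoints_finite hP.isCompact.isBounded hi).subset ?_
    intro x hx
    exact fanPiece_subset hP.convex hn.1 ((mem_edgeFinset hP).1 he) hx
  rw [scaled_eq_union hP hn hi, finsum_mem_union _ (finite_singleton _)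
    ((edgeFinset hP).finite_toSet.biUnion hfin), finsum_mem_singleton, finsum_mem_biUnion _
      (edgeFinset hP).finite_toSet hfin, finsum_mem_coe_finset]
  · intro e he e' he' hne
    rw [Function.onFun, Set.disjoint_left]
    intro x hx hx'
    exact hne (fan_disjoint hP.2 hn ((mem_edgeFinset hP).1 he) ((mem_edgeFinset hP).1 he') hx hx')
  · rw [Set.disjoint_left]
    simp only [mem_singleton_iff, mem_iUnion, not_exists]
    rintro _ rfl e he hx
    apply apex_notMem_fanPiece hn ((mem_edgeFinset hP).1 he)
    have : (i : ℝ)⁻¹ • toPlane ((i : ℤ) • n) ∈ fanPiece (toPlane n) e := hx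
    rwa [toPlane_zsmul, smul_smul, Int.cast_natCast, inv_mul_cancel₀ hi', one_smul] at this

/-- The half-open edges partition the boundary, and one of lattice length t carries exactly t
lattice points. -/
lemma boundaryCount_eq (hP : IsLatticePolygon P) :
    (boundaryCount P : ℝ) = ∑ e ∈ edgeFinset hP, e.2.2 := by
  have hdata : ∀ e ∈ orientedEdges P, e.1 = toPlane (floorVec e.1) ∧ e.2.2 = (⌊e.2.2⌋₊ : ℝ) := by
    intro e he
    obtain ⟨a, g, hg, ha, ht, hb⟩ := edge_lattice hP he
    rw [ha, ht]; simp
  have hset : {a : Fin 2 → ℤ | toPlane a ∈ frontier P} =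
      ⋃ e ∈ (edgeFinset hP : Set (Plane × (Fin 2 → ℤ) × ℝ)), latticeRun (floorVec e.1) e.2.1 ⌊e.2.2⌋₊ := by
    ext x
    simp only [mem_ofPred_eq, mem_iUnion, Finset.mem_coe, exists_prop, mem_edgeFinset, mem_latticeRun]
    constructor
    · intro hx
      obtain ⟨e, he, s, h0, h1, hs⟩ := exists_edge hP hx
      obtain ⟨ha, ht⟩ := hdata e he
      have h2 : s • toPlane e.2.1 = toPlane (x - floorVec e.1) := by
        rw [toPlane_sub, ← ha, hs]; abel
      obtain ⟨j, hj⟩ := int_of_smul_primitive he.1 h2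
      rw [ht, hj] at h1
      rw [hj] at h0
      refine ⟨e, he, j, by exact_mod_cast h0, by exact_mod_cast h1, ?_⟩
      rw [hj, ← toPlane_zsmul] at h2
      rw [toPlane_injective h2]; abel
    · rintro ⟨e, he, j, h0, h1, rfl⟩
      obtain ⟨ha, ht⟩ := hdata e he
      rw [toPlane_add, toPlane_zsmul, ← ha]
      refine edge_mem_frontier he (by exact_mod_cast h0) ?_
      rw [ht]
      exact_mod_cast h1.le
  have hfin := fun e (_ : e ∈ (edgeFinset hP : Set (Plane × (Fin 2 → ℤ) × ℝ))) =>
    latticeRun_finite (floorVec e.1) e.2.1 ⌊e.2.2⌋₊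
  rw [boundaryCount, hset, ← finsum_mem_one_real _ ((edgeFinset hP).finite_toSet.biUnion hfin),
    finsum_mem_biUnion _ (edgeFinset hP).finite_toSet hfin, finsum_mem_coe_finset]
  · refine Finset.sum_congr rfl fun e he => ?_
    have he := (mem_edgeFinset hP).1 he
    rw [finsum_mem_one_real _ (latticeRun_finite _ _ _), ncard_latticeRun (ne_zero_of_coprime he.1)]
    exact (hdata e he).2.symm
  · intro e he e' he' hne
    have he := (mem_edgeFinset hP).1 he
    have he' := (mem_edgeFinset hP).1 he'
    rw [Function.onFun, Set.disjoint_left]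
    intro x hx hx'
    obtain ⟨j, h0, h1, hj⟩ := mem_latticeRun.1 hx
    obtain ⟨j', h0', h1', hj'⟩ := mem_latticeRun.1 hx'
    obtain ⟨ha, ht⟩ := hdata e he
    obtain ⟨ha', ht'⟩ := hdata e' he'
    refine hne (edge_unique_tail hP.2 he he' (s := j) (s' := j') ?_ ?_ ?_)
    · rw [ht]; exact_mod_cast h1
    · rw [ht']; exact_mod_cast h1'
    · rw [ha, ha', ← toPlane_zsmul, ← toPlane_add, ← toPlane_zsmul, ← toPlane_add, ← hj, ← hj']

-- The degenerate pieces lie on edges through the apex, hence in the frontier, which is a null set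
-- for a convex set.
open Classical in
lemma ae_eq_biUnion_fanPiece (hP : IsLatticePolygon P) (hn : toPlane n ∈ P.extremePoints ℝ)
    (hf : toPlane n ∈ frontier P) :
    P =ᵐ[volume] ⋃ e ∈ (edgeFinset hP).filter
      (fun e => 0 < cross (e.1 - toPlane n) (edgeHead e - toPlane n)), fanPiece (toPlane n) e := by
  refine Filter.EventuallyLE.antisymm ?_ (Filter.Eventually.of_forall ?_)
  · rw [ae_le_set]
    refine measure_mono_null ?_ (hP.convex.addHaar_frontier volume)
    rintro x ⟨hx, hx'⟩
    by_cases hxo : x = toPlane n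
    · rwa [hxo]
    obtain ⟨e, he, hxe⟩ := fan_cover hP hn.1 hx hxo
    rcases edge_trichotomy he hn with h | h | h
    · exact absurd h hxe.1
    · obtain ⟨-, α, β, hα, hβ, hab, rfl⟩ := hxe
      have hh := h
      rw [edgeHead] at h
      have ht := he.2.1
      have : toPlane n + α • (e.1 - toPlane n) + β • (edgeHead e - toPlane n) =
          e.1 + ((1 - α) * e.2.2) • toPlane e.2.1 := by
        rw [hh, sub_self, smul_zero, add_zero, ← h]; module
      rw [this]
      exact edge_mem_frontier he (mul_nonneg (by linarith) ht.le) (by nlinarith)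
    · exfalso
      apply hx'
      simp only [mem_iUnion, Finset.mem_filter, mem_edgeFinset]
      exact ⟨e, ⟨he, h⟩, hxe⟩
  · intro x hx
    have hx : x ∈ ⋃ e ∈ (edgeFinset hP).filter
      (fun e => 0 < cross (e.1 - toPlane n) (edgeHead e - toPlane n)), fanPiece (toPlane n) e := hx
    simp only [mem_iUnion, Finset.mem_filter, mem_edgeFinset] at hx
    obtain ⟨e, ⟨he, -⟩, hxe⟩ := hx
    exact fanPiece_subset hP.convex hn.1 he hxe

lemma area_moment_eq (hP : IsLatticePolygon P) (hn : toPlane n ∈ P.extremePoints ℝ)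
    (hf : toPlane n ∈ frontier P) :
    area P = ∑ e ∈ edgeFinset hP, cross (e.1 - toPlane n) (edgeHead e - toPlane n) / 2 ∧
    moment P = area P • toPlane n + ∑ e ∈ edgeFinset hP,
      (cross (e.1 - toPlane n) (edgeHead e - toPlane n) / 6) •
        ((e.1 - toPlane n) + (edgeHead e - toPlane n)) := by
  classical
  have hae := ae_eq_biUnion_fanPiece hP hn hf
  set E := (edgeFinset hP).filter
      (fun e => 0 < cross (e.1 - toPlane n) (edgeHead e - toPlane n)) with hE
  have hmem : ∀ e ∈ E, e ∈ orientedEdges P ∧ 0 < cross (e.1 - toPlane n) (edgeHead e - toPlane n) ∧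
      e.1 ≠ toPlane n := by
    intro e he
    rw [hE, Finset.mem_filter, mem_edgeFinset] at he
    refine ⟨he.1, he.2, fun h => ?_⟩
    have := he.2
    rw [h, sub_self, cross_zero_left] at this
    exact lt_irrefl _ this
  have hmeas : ∀ e ∈ E, MeasurableSet (fanPiece (toPlane n) e) := by
    intro e he
    obtain ⟨h1, h2, h3⟩ := hmem e he
    rw [fanPiece_eq_triHalf h3]
    exact measurableSet_triHalf h2
  have hdisj : Set.PairwiseDisjoint (E : Set (Plane × (Fin 2 → ℤ) × ℝ)) (fanPiece (toPlane n)) := by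
    intro e he e' he' hne
    rw [Function.onFun, Set.disjoint_left]
    intro x hx hx'
    exact hne (fan_disjoint hP.2 hn (hmem e he).1 (hmem e' he').1 hx hx')
  have hsum : ∀ {M : Type} [AddCommMonoid M] (f : Plane × (Fin 2 → ℤ) × ℝ → M),
      (∀ e ∈ orientedEdges P, cross (e.1 - toPlane n) (edgeHead e - toPlane n) = 0 → f e = 0) →
      ∑ e ∈ E, f e = ∑ e ∈ edgeFinset hP, f e := by
    intro M _ f h
    apply Finset.sum_subset (Finset.filter_subset _ _)
    intro e he he'
    have he := (mem_edgeFinset hP).1 he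
    apply h e he
    rcases edge_trichotomy he hn with h | h | h
    · rw [h, sub_self, cross_zero_left]
    · rw [h, sub_self, cross_zero_right]
    · exact absurd (Finset.mem_filter.2 ⟨(mem_edgeFinset hP).2 he, h⟩) he'
  have hfinP : volume P ≠ ⊤ := hP.isCompact.measure_lt_top.ne
  have harea : area P = ∑ e ∈ edgeFinset hP, cross (e.1 - toPlane n) (edgeHead e - toPlane n) / 2 := by
    rw [area, measureReal_congr hae, measureReal_biUnion_finset hdisj hmeas fun e he =>
      measure_ne_top_of_subset (fanPiece_subset hP.convex hn.1 (hmem e he).1) hfinP, ← hsum]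
    · refine Finset.sum_congr rfl fun e he => ?_
      obtain ⟨h1, h2, h3⟩ := hmem e he
      rw [fanPiece_eq_triHalf h3, area_triHalf h2]
    · intro e _ h; rw [h, zero_div]
  refine ⟨harea, ?_⟩
  rw [harea, Finset.sum_smul, ← Finset.sum_add_distrib, moment, setIntegral_congr_set hae,
    integral_biUnion_finset _ hmeas hdisj, ← hsum]
  · refine Finset.sum_congr rfl fun e he => ?_
    obtain ⟨h1, h2, h3⟩ := hmem e he
    rw [fanPiece_eq_triHalf h3, moment_triHalf h2]
  · intro e _ h; rw [h]; simp
  · intro e he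
    exact (continuous_id.continuousOn.integrableOn_compact hP.isCompact).mono_set
      (fanPiece_subset hP.convex hn.1 (hmem e he).1)

/-- Ehrhart's formula and the lattice-sum polynomial of a lattice polygon. -/
theorem exists_latticeSum_const (hP : IsLatticePolygon P) :
    ∃ s : Plane, ∀ i : ℕ, 0 < i →
      (ehrhart P i : ℝ) = (i : ℝ) ^ 2 * area P + (i : ℝ) * (boundaryCount P / 2) + 1 ∧
      latticeSum P i = ((i : ℝ) ^ 2) • moment P + ((i : ℝ) / 2) • boundaryMoment P + s := by
  obtain ⟨o, ho, hf⟩ := exists_vertex hP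
  obtain ⟨n, rfl⟩ := hP.exists_of_extreme ho
  obtain ⟨harea, hmom⟩ := area_moment_eq hP ho hf
  choose! c hc using fun e (he : e ∈ orientedEdges P) => exists_fanPiece_sums hP ho he
  refine ⟨toPlane n + ∑ e ∈ edgeFinset hP, c e, fun i hi => ?_⟩
  have hi' : (i : ℝ) ≠ 0 := by positivity
  have hfin := scaledLatticePoints_finite hP.isCompact.isBounded hi
  have hfin' : ∀ e ∈ edgeFinset hP, (scaledLatticePoints (fanPiece (toPlane n) e) i).Finite := by
    intro e he
    refine hfin.subset fun x hx => ?_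
    exact fanPiece_subset hP.convex ho.1 ((mem_edgeFinset hP).1 he) hx
  have hcount : (ehrhart P i : ℝ) =
      1 + ∑ e ∈ edgeFinset hP, ((scaledLatticePoints (fanPiece (toPlane n) e) i).ncard : ℝ) := by
    rw [ehrhart, ← finsum_mem_one_real _ hfin, finsum_scaled hP ho hi]
    congr 1
    exact Finset.sum_congr rfl fun e he => finsum_mem_one_real _ (hfin' e he)
  have hE : (ehrhart P i : ℝ) = (i : ℝ) ^ 2 * area P + (i : ℝ) * (boundaryCount P / 2) + 1 := by
    -- The lattice distances from the apex to heads and to tails have equal sums, so only the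
    -- lengths of the boundary edges survive.
    rw [hcount, Finset.sum_congr rfl fun e he => (hc e ((mem_edgeFinset hP).1 he) i hi).1,
      Finset.sum_add_distrib, ← Finset.mul_sum, ← Finset.mul_sum, ← harea, ← Finset.sum_div,
      Finset.sum_sub_distrib, Finset.sum_add_distrib, sum_head_eq_sum_tail hP, boundaryCount_eq hP]
    ring
  refine ⟨hE, ?_⟩
  have hS : ∑ᶠ x ∈ scaledLatticePoints P i, toPlane x = (ehrhart P i * (i : ℝ)) • toPlane n +
      ((i : ℝ) ^ 3) • ∑ e ∈ edgeFinset hP, (cross (e.1 - toPlane n) (edgeHead e - toPlane n) / 6) •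
          ((e.1 - toPlane n) + (edgeHead e - toPlane n)) +
      ((i : ℝ) ^ 2 / 4) • ∑ e ∈ edgeFinset hP, e.2.2 • ((e.1 - toPlane n) + (edgeHead e - toPlane n)) +
      (i : ℝ) • ∑ e ∈ edgeFinset hP, c e := by
    rw [finsum_scaled hP ho hi,
      Finset.sum_congr rfl fun e he => (hc e ((mem_edgeFinset hP).1 he) i hi).2]
    simp only [Finset.sum_add_distrib, mul_smul]
    rw [← Finset.sum_smul, ← Finset.smul_sum, ← Finset.smul_sum, ← Finset.smul_sum,
      Finset.sum_add_distrib, Finset.sum_sub_distrib,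
      sum_head_eq_sum_tail hP (fun x => latticeDist (toPlane n) x • (x - toPlane n)), sub_self, zero_add,
      hcount, toPlane_zsmul, Int.cast_natCast]
    module
  have hb : ∑ e ∈ edgeFinset hP, e.2.2 • ((e.1 - toPlane n) + (edgeHead e - toPlane n)) =
      (2 : ℝ) • boundaryMoment P - (2 * (boundaryCount P : ℝ)) • toPlane n := by
    rw [boundaryMoment_eq hP, boundaryCount_eq hP, Finset.smul_sum, Finset.mul_sum, Finset.sum_smul,
      ← Finset.sum_sub_distrib]
    refine Finset.sum_congr rfl fun e _ => ?_
    module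
  have hm : ∑ e ∈ edgeFinset hP, (cross (e.1 - toPlane n) (edgeHead e - toPlane n) / 6) •
          ((e.1 - toPlane n) + (edgeHead e - toPlane n)) = moment P - area P • toPlane n := by
    rw [hmom]; abel
  rw [hb, hm, hE] at hS
  rw [latticeSum, ← smul_finsum_mem hfin, hS]
  apply plane_ext <;> simp <;> field_simp <;> ring

end LatticePolygon

/-! ### The shape of a corner -/

lemma mem_triangle_iff {p A B x : Plane} :
    x ∈ convexHull ℝ {p, p + A, p + B} ↔
      ∃ α β : ℝ, 0 ≤ α ∧ 0 ≤ β ∧ α + β ≤ 1 ∧ x = p + α • A + β • B := by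
  constructor
  · intro hx
    have hc : Convex ℝ {x : Plane | ∃ α β : ℝ, 0 ≤ α ∧ 0 ≤ β ∧ α + β ≤ 1 ∧ x = p + α • A + β • B} := by
      rintro _ ⟨α, β, h1, h2, h3, rfl⟩ _ ⟨α', β', h1', h2', h3', rfl⟩ s t hs ht hst
      refine ⟨s * α + t * α', s * β + t * β', by positivity, by positivity, by nlinarith, ?_⟩
      obtain rfl : t = 1 - s := by linarith
      module
    refine convexHull_min ?_ hc hx
    rintro _ (rfl | rfl | rfl)
    · exact ⟨0, 0, by simp⟩
    · exact ⟨1, 0, by simp⟩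
    · exact ⟨0, 1, by simp⟩
  · rintro ⟨α, β, h1, h2, h3, rfl⟩
    have hc := convex_convexHull ℝ ({p, p + A, p + B} : Set Plane)
    have h := hc.sum_mem (t := Finset.univ) (w := ![1 - α - β, α, β]) (z := ![p, p + A, p + B])
      (by intro i _; fin_cases i <;> simp <;> linarith) (by simp [Fin.sum_univ_three]; ring)
      (by intro i _; fin_cases i <;> exact subset_convexHull ℝ _ (by simp))
    convert h using 1
    simp [Fin.sum_univ_three]
    module

lemma IsTriangle.interior_nonempty {D : Set Plane} (hD : IsTriangle D) : (interior D).Nonempty := by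
  obtain ⟨z, hz, rfl⟩ := hD
  rw [interior_convexHull_nonempty_iff_affineSpan_eq_top,
    hz.affineSpan_eq_top_iff_card_eq_finrank_add_one]
  simp

lemma IsTriangle.convex {D : Set Plane} (hD : IsTriangle D) : Convex ℝ D := by
  obtain ⟨z, hz, rfl⟩ := hD
  exact convex_convexHull ℝ _

lemma IsTriangle.isCompact {D : Set Plane} (hD : IsTriangle D) : IsCompact D := by
  obtain ⟨z, hz, rfl⟩ := hD
  exact (Set.finite_range z).isCompact_convexHull ℝ

lemma cross_ne_zero_of_interior {p A B : Plane}
    (h : (interior (convexHull ℝ {p, p + A, p + B})).Nonempty) : cross A B ≠ 0 := by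
  intro h0
  obtain ⟨d, hd, hA, hB⟩ : ∃ d : Plane, d ≠ 0 ∧ cross d A = 0 ∧ cross d B = 0 := by
    by_cases hA : A = 0
    · by_cases hB : B = 0
      · refine ⟨![1, 0], fun h => ?_, ?_, ?_⟩
        · have := congrFun h 0; simp at this
        · rw [hA, cross_zero_right]
        · rw [hB, cross_zero_right]
      · exact ⟨B, hB, by rw [hA, cross_zero_right], cross_self B⟩
    · exact ⟨A, hA, cross_self A, h0⟩
  obtain ⟨y, hy, hne⟩ := exists_cross_ne h hd p
  obtain ⟨α, β, -, -, -, rfl⟩ := mem_triangle_iff.1 hy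
  apply hne
  have : p + α • A + β • B - p = α • A + β • B := by abel
  rw [this, cross_add_right, cross_smul_right, cross_smul_right, hA, hB]; ring

/-- An extreme point of a triangle is one of its three generators; the other two have the indices i
+ 1 and i + 2 modulo 3. -/
lemma IsTriangle.exists_apex {D : Set Plane} (hD : IsTriangle D) {p : Plane}
    (hp : p ∈ D.extremePoints ℝ) :
    ∃ A B : Plane, cross A B ≠ 0 ∧ D = convexHull ℝ {p, p + A, p + B} := by
  have hi := hD.interior_nonempty
  obtain ⟨z, hz, rfl⟩ := hD
  have h : p ∈ range z := extremePoints_convexHull_subset hp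
  obtain ⟨i, rfl⟩ := h
  have hr : range z = {z i, z i + (z (i + 1) - z i), z i + (z (i + 2) - z i)} := by
    ext x
    simp only [add_sub_cancel, mem_range, mem_insert_iff, mem_singleton_iff]
    constructor
    · rintro ⟨j, rfl⟩
      fin_cases i <;> fin_cases j <;> simp
    · rintro (rfl | rfl | rfl) <;> exact ⟨_, rfl⟩
  rw [hr] at hi
  exact ⟨_, _, cross_ne_zero_of_interior hi, by rw [hr]⟩

/-- A convex body whose interior misses a convex set is cut off from it by a line; if it is one of
finitely many disjoint closed pieces that together with the convex set form a convex set, then it is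
the whole part beyond the line. -/
lemma exists_cut {ι : Type*} [Finite ι] {Δ Δ' : Set Plane} {D : ι → Set Plane} (hΔ : Convex ℝ Δ)
    (hΔ' : Convex ℝ Δ') (hD : ∀ a, IsTriangle (D a)) (hU : Δ = Δ' ∪ ⋃ a, D a)
    (hdisj : ∀ a b, a ≠ b → D a ∩ D b = ∅) {a : ι} (hint : D a ∩ Δ' = frontier (D a) ∩ Δ') :
    ∃ (f : Plane →L[ℝ] ℝ) (c : ℝ), D a = {x ∈ Δ | f x ≤ c} ∧ (∀ x ∈ Δ', c ≤ f x) ∧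
      ∃ x ∈ D a, f x < c := by
  have hdis : Disjoint (interior (D a)) Δ' := by
    rw [Set.disjoint_left]
    intro x hx hx'
    have : x ∈ frontier (D a) ∩ Δ' := by rw [← hint]; exact ⟨interior_subset hx, hx'⟩
    exact this.1.2 hx
  obtain ⟨f, c, h1, h2⟩ := geometric_hahn_banach_open (hD a).convex.interior isOpen_interior hΔ' hdis
  obtain ⟨z, hz⟩ := (hD a).interior_nonempty
  have hcl : IsClosed {x : Plane | f x ≤ c} := isClosed_le f.continuous continuous_const
  have hDle : ∀ x ∈ D a, f x ≤ c := by
    have hsub : closure (interior (D a)) ⊆ {x : Plane | f x ≤ c} :=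
      closure_minimal (fun x hx => (h1 x hx).le) hcl
    intro x hx
    apply hsub
    rw [(hD a).convex.closure_interior_eq_closure_of_nonempty_interior ⟨z, hz⟩]
    exact subset_closure hx
  have hDΔ : ∀ b, D b ⊆ Δ := fun b x hx => by rw [hU]; exact Or.inr (mem_iUnion.2 ⟨b, hx⟩)
  -- W misses Δ', so the disjoint closed sets D_a and the union of the other corners cover it. Being
  -- connected and meeting D_a, it lies in D_a.
  set W := {x ∈ Δ | f x < c} with hW
  have hWc : IsPreconnected W := by
    have : Convex ℝ W := hΔ.inter (convex_halfSpace_lt f.toLinearMap.isLinear c)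
    exact this.isPreconnected
  have hWD : W ⊆ D a := by
    by_contra hcon
    rw [Set.not_subset] at hcon
    obtain ⟨y, hy, hya⟩ := hcon
    have hWsub : W ⊆ D a ∪ ⋃ b ∈ {b | b ≠ a}, D b := by
      rintro x ⟨hx, hxc⟩
      rw [hU] at hx
      rcases hx with hx | hx
      · exact absurd (h2 x hx) (not_le.2 hxc)
      · obtain ⟨b, hb⟩ := mem_iUnion.1 hx
        by_cases hba : b = a
        · left; rwa [← hba]
        · right; exact mem_iUnion₂.2 ⟨b, hba, hb⟩
    have hclosed : IsClosed (⋃ b ∈ {b | b ≠ a}, D b) :=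
      (Set.toFinite _).isClosed_biUnion fun b _ => (hD b).isCompact.isClosed
    obtain ⟨x, -, hxa, hxb⟩ := isPreconnected_closed_iff.1 hWc _ _ (hD a).isCompact.isClosed hclosed hWsub
      ⟨z, ⟨hDΔ a (interior_subset hz), h1 z hz⟩, interior_subset hz⟩
      ⟨y, hy, (hWsub hy).resolve_left hya⟩
    obtain ⟨b, hb, hxb⟩ := mem_iUnion₂.1 hxb
    have : x ∈ D a ∩ D b := ⟨hxa, hxb⟩
    rw [hdisj a b (Ne.symm hb)] at this
    exact this
  refine ⟨f, c, ?_, h2, z, interior_subset hz, h1 z hz⟩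
  ext x
  refine ⟨fun hx => ⟨hDΔ a hx, hDle x hx⟩, ?_⟩
  rintro ⟨hx, hxc⟩
  -- Points of Δ on the line itself are limits of points of W on the way to z, and D_a is closed.
  have hcont : Filter.Tendsto (fun r : ℝ => x + r • (z - x)) (nhdsWithin 0 (Ioi 0)) (nhds x) := by
    have : Continuous (fun r : ℝ => x + r • (z - x)) := by fun_prop
    simpa using (this.tendsto 0).mono_left nhdsWithin_le_nhds
  refine (hD a).isCompact.isClosed.mem_of_tendsto hcont ?_
  have hmem : Ioo (0 : ℝ) 1 ∈ nhdsWithin (0 : ℝ) (Ioi 0) := Ioo_mem_nhdsGT zero_lt_one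
  filter_upwards [hmem] with r hr
  apply hWD
  refine ⟨hΔ.add_smul_sub_mem hx (hDΔ a (interior_subset hz)) ⟨hr.1.le, hr.2.le⟩, ?_⟩
  have hzc := h1 z hz
  rw [map_add, map_smul, map_sub, smul_eq_mul]
  nlinarith [hr.1, hr.2]

section Corner

variable {Δ Δ' D : Set Plane} {p : Plane} {f : Plane →L[ℝ] ℝ} {c : ℝ}

/-- In a corner cut off by a line at a single vertex, the other vertices of the corner lie on the
line. -/
lemma corner_vertex_on_line (hΔ : Convex ℝ Δ) (hDf : D = {x ∈ Δ | f x ≤ c})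
    (hv : Δ.extremePoints ℝ ∩ D = {p}) {A B : Plane} (hAB : cross A B ≠ 0)
    (hD : D = convexHull ℝ {p, p + A, p + B}) : f (p + A) = c := by
  have hA : p + A ∈ D := by
    rw [hD]; exact subset_convexHull ℝ _ (by simp)
  have hA' := hA
  rw [hDf] at hA'
  by_contra hne
  have hlt : f (p + A) < c := lt_of_le_of_ne hA'.2 hne
  -- Strictly beyond the line Δ and D coincide, so from p + A a small step towards any point of Δ
  -- stays in D. Extremality is therefore local, and p + A, a vertex of the triangle D, would be a
  -- second vertex of Δ in D.
  have hext : p + A ∈ Δ.extremePoints ℝ := by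
    rw [mem_extremePoints]
    refine ⟨hA'.1, ?_⟩
    intro x hx y hy ⟨s, t, hs, ht, hst, he⟩
    have hfl : ∀ w ∈ Δ, ∃ ε : ℝ, 0 < ε ∧ ε ≤ 1 ∧ p + A + ε • (w - (p + A)) ∈ D := by
      intro w hw
      have hcont : Filter.Tendsto (fun r : ℝ => f (p + A + r • (w - (p + A)))) (nhdsWithin 0 (Ioi 0))
          (nhds (f (p + A))) := by
        have : Continuous (fun r : ℝ => f (p + A + r • (w - (p + A)))) := by fun_prop
        simpa using (this.tendsto 0).mono_left nhdsWithin_le_nhds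
      have hmem : Ioo (0 : ℝ) 1 ∈ nhdsWithin (0 : ℝ) (Ioi 0) := Ioo_mem_nhdsGT zero_lt_one
      obtain ⟨r, hr, hr'⟩ := ((hcont.eventually (gt_mem_nhds hlt)).and hmem).exists
      refine ⟨r, hr'.1, hr'.2.le, ?_⟩
      rw [hDf]
      exact ⟨hΔ.add_smul_sub_mem hA'.1 hw ⟨hr'.1.le, hr'.2.le⟩, hr.le⟩
    obtain ⟨ε, hε, -, h1⟩ := hfl x hx
    obtain ⟨δ, hδ, -, h2⟩ := hfl y hy
    rw [hD, mem_triangle_iff] at h1 h2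
    obtain ⟨α, β, hα, hβ, hab, h1⟩ := h1
    obtain ⟨α', β', hα', hβ', hab', h2⟩ := h2
    set X := x - (p + A) with hX
    set Y := y - (p + A) with hY
    have hXY : s • X + t • Y = 0 := by
      have : s • X + t • Y = s • x + t • y - (s + t) • (p + A) := by rw [hX, hY]; module
      rw [this, he, hst, one_smul, sub_self]
    have e1 : ε • X = (α - 1) • A + β • B := by
      have : ε • X = (p + A + ε • X) - (p + A) := by abel
      rw [this, h1]; module
    have e2 : δ • Y = (α' - 1) • A + β' • B := by
      have : δ • Y = (p + A + δ • Y) - (p + A) := by abel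
      rw [this, h2]; module
    have e3 : (s * δ) • ((α - 1) • A + β • B) + (t * ε) • ((α' - 1) • A + β' • B) = 0 := by
      rw [← e1, ← e2, smul_smul, smul_smul]
      have : (s * δ * ε) • X + (t * ε * δ) • Y = (δ * ε) • (s • X + t • Y) := by module
      rw [this, hXY, smul_zero]
    have g1 := congrArg (fun w => cross w B) e3
    have g2 := congrArg (fun w => cross A w) e3
    simp only [cross_add_left, cross_add_right, cross_smul_left, cross_smul_right, cross_self,
      cross_zero_left, cross_zero_right, mul_zero, add_zero, zero_add] at g1 g2
    have g1' : (s * δ) * (α - 1) + (t * ε) * (α' - 1) = 0 := by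
      apply mul_right_cancel₀ hAB; linarith
    have g2' : (s * δ) * β + (t * ε) * β' = 0 := by
      apply mul_right_cancel₀ hAB; linarith
    have hsδ := mul_pos hs hδ
    have htε := mul_pos ht hε
    have hb0 : β = 0 := by
      have : (s * δ) * β = 0 := by nlinarith [mul_nonneg hsδ.le hβ, mul_nonneg htε.le hβ']
      exact (mul_eq_zero.1 this).resolve_left hsδ.ne'
    have hb0' : β' = 0 := by
      have : (t * ε) * β' = 0 := by nlinarith [mul_nonneg hsδ.le hβ, mul_nonneg htε.le hβ']
      exact (mul_eq_zero.1 this).resolve_left htε.ne'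
    have ha1 : α = 1 := by
      have h3 : (s * δ) * (1 - α) = 0 := by
        nlinarith [mul_nonneg hsδ.le (show 0 ≤ 1 - α by linarith),
          mul_nonneg htε.le (show 0 ≤ 1 - α' by linarith)]
      have := (mul_eq_zero.1 h3).resolve_left hsδ.ne'
      linarith
    have ha1' : α' = 1 := by
      have h3 : (t * ε) * (1 - α') = 0 := by
        nlinarith [mul_nonneg hsδ.le (show 0 ≤ 1 - α by linarith),
          mul_nonneg htε.le (show 0 ≤ 1 - α' by linarith)]
      have := (mul_eq_zero.1 h3).resolve_left htε.ne'
      linarith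
    rw [ha1, hb0, sub_self, zero_smul, zero_smul, add_zero] at e1
    rw [ha1', hb0', sub_self, zero_smul, zero_smul, add_zero] at e2
    have hX0 := (smul_eq_zero.1 e1).resolve_left hε.ne'
    have hY0 := (smul_eq_zero.1 e2).resolve_left hδ.ne'
    exact ⟨sub_eq_zero.1 hX0, sub_eq_zero.1 hY0⟩
  have : p + A ∈ Δ.extremePoints ℝ ∩ D := ⟨hext, hA⟩
  rw [hv, mem_singleton_iff] at this
  have hA0 : A = 0 := by simpa using this
  rw [hA0, cross_zero_left] at hAB
  exact hAB rfl

/-- An edge of the polygon at the vertex of a corner contains a side of the corner. -/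
lemma corner_edge (hDf : D = {x ∈ Δ | f x ≤ c}) (hp : p ∈ Δ) (hpc : f p < c)
    (hv : Δ.extremePoints ℝ ∩ D = {p}) {A B : Plane} (hAB : cross A B ≠ 0)
    (hD : D = convexHull ℝ {p, p + A, p + B}) {w : Fin 2 → ℤ} (hw : w ∈ edgeVectors Δ p) :
    ∃ s t : ℝ, 0 < s ∧ s < t ∧ IsExposed ℝ Δ (segment ℝ p (p + t • toPlane w)) ∧
      (A = s • toPlane w ∨ B = s • toPlane w) := by
  obtain ⟨hwc, t, ht, hexp⟩ := hw
  obtain ⟨l, hl⟩ := hexp ⟨_, left_mem_segment _ _ _⟩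
  have hpl : ∀ x ∈ Δ, l x ≤ l p := by
    have : p ∈ segment ℝ p (p + t • toPlane w) := left_mem_segment _ _ _
    rw [hl] at this
    exact this.2
  have hseg : ∀ {y}, y ∈ segment ℝ p (p + t • toPlane w) ↔ ∃ r, 0 ≤ r ∧ r ≤ t ∧ y = p + r • toPlane w := by
    intro y
    have := mem_segment_line (x := p) (d := toPlane w) (y := y) (r₀ := 0) (r₁ := t) ht.le
    simpa using this
  have hDΔ : D ⊆ Δ := by rw [hDf]; exact sep_subset _ _
  -- The edge starts inside D. Written in A and B, this short piece is a nonnegative combination on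
  -- which l vanishes while l A, l B ≤ 0, so l vanishes on A or on B, and that side lies on the
  -- edge.
  obtain ⟨ε, hε, hεt, hεD⟩ : ∃ ε : ℝ, 0 < ε ∧ ε ≤ t ∧ p + ε • toPlane w ∈ D := by
    have hcont : Filter.Tendsto (fun r : ℝ => f (p + r • toPlane w)) (nhdsWithin 0 (Ioi 0))
        (nhds (f p)) := by
      have : Continuous (fun r : ℝ => f (p + r • toPlane w)) := by fun_prop
      simpa using (this.tendsto 0).mono_left nhdsWithin_le_nhds
    have hmem : Ioo (0 : ℝ) t ∈ nhdsWithin (0 : ℝ) (Ioi 0) := Ioo_mem_nhdsGT ht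
    obtain ⟨r, hr, hr'⟩ := ((hcont.eventually (gt_mem_nhds hpc)).and hmem).exists
    refine ⟨r, hr'.1, hr'.2.le, ?_⟩
    rw [hDf]
    exact ⟨hexp.subset (hseg.2 ⟨r, hr'.1.le, hr'.2.le, rfl⟩), hr.le⟩
  have hεl : l (p + ε • toPlane w) = l p := by
    have : p + ε • toPlane w ∈ segment ℝ p (p + t • toPlane w) := hseg.2 ⟨ε, hε.le, hεt, rfl⟩
    rw [hl] at this
    exact le_antisymm (hpl _ this.1) (this.2 p hp)
  have hAD : p + A ∈ D := by rw [hD]; exact subset_convexHull ℝ _ (by simp)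
  have hBD : p + B ∈ D := by rw [hD]; exact subset_convexHull ℝ _ (by simp)
  have hA0 : A ≠ 0 := by rintro rfl; rw [cross_zero_left] at hAB; exact hAB rfl
  have hB0 : B ≠ 0 := by rintro rfl; rw [cross_zero_right] at hAB; exact hAB rfl
  have key : ∀ C : Plane, C ≠ 0 → p + C ∈ D → l C = 0 → ∃ s, 0 < s ∧ s < t ∧ C = s • toPlane w := by
    intro C hC0 hCD hlC
    have : p + C ∈ segment ℝ p (p + t • toPlane w) := by
      rw [hl]
      refine ⟨hDΔ hCD, fun x hx => ?_⟩
      rw [map_add, hlC, add_zero]; exact hpl x hx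
    obtain ⟨s, h0, h1, h2⟩ := hseg.1 this
    have hC : C = s • toPlane w := add_left_cancel h2
    refine ⟨s, lt_of_le_of_ne h0 ?_, lt_of_le_of_ne h1 ?_, hC⟩
    · rintro rfl; rw [zero_smul] at hC; exact hC0 hC
    -- A side filling the whole edge would put the far vertex of the edge into D.
    · rintro rfl
      rw [segment_symm, ← hC] at hexp
      have : p + C ∈ Δ.extremePoints ℝ ∩ D := ⟨left_mem_extremePoints hexp, hCD⟩
      rw [hv, mem_singleton_iff] at this
      exact hC0 (by simpa using this)
  have hlA : l A ≤ 0 := by have := hpl _ (hDΔ hAD); rw [map_add] at this; linarith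
  have hlB : l B ≤ 0 := by have := hpl _ (hDΔ hBD); rw [map_add] at this; linarith
  rw [hD, mem_triangle_iff] at hεD
  obtain ⟨α, β, hα, hβ, -, he⟩ := hεD
  have hsum : α * l A + β * l B = 0 := by
    rw [he] at hεl
    simp only [map_add, map_smul, smul_eq_mul] at hεl
    linarith
  have hαA : α * l A ≤ 0 := mul_nonpos_of_nonneg_of_nonpos hα hlA
  have hβB : β * l B ≤ 0 := mul_nonpos_of_nonneg_of_nonpos hβ hlB
  rcases hα.eq_or_lt with h | h
  · rcases hβ.eq_or_lt with h' | h'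
    · exfalso
      rw [← h, ← h', zero_smul, zero_smul, add_zero, add_zero] at he
      have : ε • toPlane w = 0 := by simpa using he
      rcases smul_eq_zero.1 this with h3 | h3
      · exact hε.ne' h3
      · exact toPlane_ne_zero hwc h3
    · have : l B = 0 := by
        have h3 : β * l B = 0 := by linarith
        exact (mul_eq_zero.1 h3).resolve_left h'.ne'
      obtain ⟨s, h1, h2, h3⟩ := key B hB0 hBD this
      exact ⟨s, t, h1, h2, hexp, Or.inr h3⟩
  · have : l A = 0 := by
      have h3 : α * l A = 0 := by linarith
      exact (mul_eq_zero.1 h3).resolve_left h.ne'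
    obtain ⟨s, h1, h2, h3⟩ := key A hA0 hAD this
    exact ⟨s, t, h1, h2, hexp, Or.inl h3⟩

end Corner

/-! ### Edges of the remaining polygon and the Delzant condition -/

lemma smul_segment_line (k : ℝ) (y w : Plane) (t : ℝ) :
    k • segment ℝ y (y + t • w) = segment ℝ (k • y) (k • y + (k * t) • w) := by
  rw [segment_eq_image', segment_eq_image']
  ext x
  constructor
  · rintro ⟨_, ⟨θ, hθ, rfl⟩, rfl⟩
    exact ⟨θ, hθ, by simp only; module⟩
  · rintro ⟨θ, hθ, rfl⟩
    exact ⟨_, ⟨θ, hθ, rfl⟩, by simp only; module⟩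

lemma IsExposed.smul_set {A B : Set Plane} (h : IsExposed ℝ A B) {k : ℝ} (hk : 0 < k) :
    IsExposed ℝ (k • A) (k • B) := by
  intro hne
  obtain ⟨l, hl⟩ := h (by simpa using hne)
  refine ⟨l, ?_⟩
  ext x
  constructor
  · rintro ⟨y, hy, rfl⟩
    rw [hl] at hy
    refine ⟨⟨y, hy.1, rfl⟩, ?_⟩
    rintro _ ⟨z, hz, rfl⟩
    simp only [map_smul, smul_eq_mul]
    exact mul_le_mul_of_nonneg_left (hy.2 z hz) hk.le
  · rintro ⟨⟨y, hy, rfl⟩, h⟩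
    refine ⟨y, ?_, rfl⟩
    rw [hl]
    refine ⟨hy, fun z hz => ?_⟩
    have := h (k • z) ⟨z, hz, rfl⟩
    simp only [map_smul, smul_eq_mul] at this
    exact le_of_mul_le_mul_left this hk

lemma mem_edgeVectors_smul {Q : Set Plane} {y : Plane} {t k : ℝ} {w : Fin 2 → ℤ}
    (hw : IsCoprime (w 0) (w 1)) (ht : 0 < t) (hk : 0 < k)
    (h : IsExposed ℝ Q (segment ℝ y (y + t • toPlane w))) : w ∈ edgeVectors (k • Q) (k • y) := by
  refine ⟨hw, k * t, by positivity, ?_⟩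
  rw [← smul_segment_line]
  exact IsExposed.smul_set h hk

lemma coprime_of_crossZ {u v : Fin 2 → ℤ} (h : |crossZ u v| = 1) : IsCoprime (u 0) (u 1) := by
  unfold crossZ at h
  rcases (abs_eq zero_le_one).1 h with h | h
  · exact ⟨v 1, -v 0, by linarith⟩
  · exact ⟨-v 1, v 0, by linarith⟩

section Corner

variable {Δ Δ' D : Set Plane} {p : Plane} {f : Plane →L[ℝ] ℝ} {c : ℝ} {u v : Fin 2 → ℤ}

lemma corner_shape (hΔ : Convex ℝ Δ) (hDt : IsTriangle D) (hDf : D = {x ∈ Δ | f x ≤ c})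
    (hlt : ∃ x ∈ D, f x < c) (hv : Δ.extremePoints ℝ ∩ D = {p}) (huv : |crossZ u v| = 1)
    (hu : u ∈ edgeVectors Δ p) (hv' : v ∈ edgeVectors Δ p) :
    ∃ s t s' t' : ℝ, 0 < s ∧ s < t ∧ IsExposed ℝ Δ (segment ℝ p (p + t • toPlane u)) ∧
      0 < s' ∧ s' < t' ∧ IsExposed ℝ Δ (segment ℝ p (p + t' • toPlane v)) ∧
      D = convexHull ℝ {p, p + s • toPlane u, p + s' • toPlane v} ∧
      f p < c ∧ f (p + s • toPlane u) = c ∧ f (p + s' • toPlane v) = c := by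
  have hpv : p ∈ Δ.extremePoints ℝ ∩ D := by rw [hv]; rfl
  have hDΔ : D ⊆ Δ := by rw [hDf]; exact sep_subset _ _
  have hpD : p ∈ D.extremePoints ℝ := by
    rw [mem_extremePoints] at *
    exact ⟨hpv.2, fun x hx y hy => (mem_extremePoints.1 hpv.1).2 x (hDΔ hx) y (hDΔ hy)⟩
  obtain ⟨A, B, hAB, hD⟩ := hDt.exists_apex hpD
  have hD' : D = convexHull ℝ {p, p + B, p + A} := by rw [hD, pair_comm]
  have hBA : cross B A ≠ 0 := by rw [cross_swap]; simpa using hAB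
  have hfA := corner_vertex_on_line hΔ hDf hv hAB hD
  have hfB := corner_vertex_on_line hΔ hDf hv hBA hD'
  have hpc : f p < c := by
    obtain ⟨x, hx, hxc⟩ := hlt
    by_contra hcon
    push Not at hcon
    rw [hD, mem_triangle_iff] at hx
    obtain ⟨α, β, h1, h2, h3, rfl⟩ := hx
    simp only [map_add, map_smul, smul_eq_mul] at *
    nlinarith
  obtain ⟨s, t, hs, hst, hexp, hor⟩ := corner_edge hDf hpv.1.1 hpc hv hAB hD hu
  obtain ⟨s', t', hs', hst', hexp', hor'⟩ := corner_edge hDf hpv.1.1 hpc hv hAB hD hv'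
  have hcr : cross (toPlane u) (toPlane v) ≠ 0 := by
    rw [cross_toPlane]
    intro h
    have : crossZ u v = 0 := by exact_mod_cast h
    rw [this] at huv; simp at huv
  have hno : s • toPlane u ≠ s' • toPlane v := by
    intro h
    have := congrArg (cross (toPlane u)) h
    rw [cross_smul_right, cross_smul_right, cross_self, mul_zero] at this
    rcases mul_eq_zero.1 this.symm with h | h
    · exact hs'.ne' h
    · exact hcr h
  rcases hor with h | h <;> rcases hor' with h' | h'
  · exact absurd (h.symm.trans h') hno
  · subst h h'
    exact ⟨s, t, s', t', hs, hst, hexp, hs', hst', hexp', hD, hpc, hfA, hfB⟩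
  · subst h h'
    exact ⟨s, t, s', t', hs, hst, hexp, hs', hst', hexp', hD', hpc, hfB, hfA⟩
  · exact absurd (h.symm.trans h') hno

/-- Just beyond the end of its side along an edge, a corner is adjacent to the remaining polygon. -/
lemma corner_beyond {ι : Type*} [Finite ι] {E : ι → Set Plane} (hE : ∀ b, IsClosed (E b))
    (hΔ'c : IsClosed Δ') (hU : Δ ⊆ Δ' ∪ D ∪ ⋃ b, E b) (hDf : D = {x ∈ Δ | f x ≤ c})
    {s t : ℝ} (hs : 0 < s) (hst : s < t) (hexp : IsExposed ℝ Δ (segment ℝ p (p + t • toPlane u)))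
    (hpc : f p < c) (hfc : f (p + s • toPlane u) = c) (hyE : ∀ b, p + s • toPlane u ∉ E b) :
    p + s • toPlane u ∈ Δ' ∧ ∃ τ : ℝ, 0 < τ ∧ p + s • toPlane u + τ • toPlane u ∈ Δ' := by
  set y := p + s • toPlane u with hy
  have hfu : 0 < f (toPlane u) := by
    rw [hy, map_add, map_smul, smul_eq_mul] at hfc
    have : 0 < s * f (toPlane u) := by linarith
    exact pos_of_mul_pos_right this hs.le
  have hcont : Filter.Tendsto (fun r : ℝ => y + r • toPlane u) (nhdsWithin 0 (Ioi 0)) (nhds y) := by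
    have : Continuous (fun r : ℝ => y + r • toPlane u) := by fun_prop
    simpa using (this.tendsto 0).mono_left nhdsWithin_le_nhds
  have hmem : Ioo (0 : ℝ) (t - s) ∈ nhdsWithin (0 : ℝ) (Ioi 0) := Ioo_mem_nhdsGT (by linarith)
  -- The other corners are closed and miss y, and beyond y the functional f exceeds c. So points of
  -- the edge just past y can only belong to Δ', and y does too by closedness.
  have hev : ∀ᶠ r : ℝ in nhdsWithin 0 (Ioi 0), ∀ b, y + r • toPlane u ∉ E b := by
    rw [Filter.eventually_all]
    exact fun b => hcont.eventually ((hE b).isOpen_compl.mem_nhds (hyE b))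
  have hev' : ∀ᶠ r : ℝ in nhdsWithin 0 (Ioi 0), 0 < r ∧ y + r • toPlane u ∈ Δ' := by
    filter_upwards [hmem, hev] with r hr hrE
    refine ⟨hr.1, ?_⟩
    have hΔm : y + r • toPlane u ∈ Δ := by
      apply hexp.subset
      have := (mem_segment_line (x := p) (d := toPlane u) (y := y + r • toPlane u) (r₀ := 0) (r₁ := t)
        (by linarith)).2 ⟨s + r, by linarith [hr.1], by linarith [hr.2], by rw [hy]; module⟩
      simpa using this
    rcases hU hΔm with (h | h) | h
    · exact h
    · exfalso
      rw [hDf] at h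
      have h1 := h.2
      rw [map_add, hfc, map_smul, smul_eq_mul] at h1
      nlinarith [hr.1]
    · obtain ⟨b, hb⟩ := mem_iUnion.1 h
      exact absurd hb (hrE b)
  exact ⟨hΔ'c.mem_of_tendsto hcont (hev'.mono fun r hr => hr.2), hev'.exists⟩

/-- The remaining part of an edge is an edge of the remaining polygon. -/
lemma corner_exposed_side (hΔ' : Convex ℝ Δ') (hΔ'k : IsCompact Δ') (hsub : Δ' ⊆ Δ)
    (hf : ∀ x ∈ Δ', c ≤ f x) (hu : toPlane u ≠ 0)
    {s t : ℝ} (hs : 0 < s) (hst : s < t) (hexp : IsExposed ℝ Δ (segment ℝ p (p + t • toPlane u)))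
    (hpc : f p < c) (hfc : f (p + s • toPlane u) = c) (hy : p + s • toPlane u ∈ Δ')
    (hτ : ∃ τ : ℝ, 0 < τ ∧ p + s • toPlane u + τ • toPlane u ∈ Δ') :
    ∃ τ : ℝ, 0 < τ ∧
      IsExposed ℝ Δ' (segment ℝ (p + s • toPlane u) (p + s • toPlane u + τ • toPlane u)) := by
  obtain ⟨τ, hτ, hτΔ⟩ := hτ
  obtain ⟨r₀, r₁, h0, h1, hr⟩ := exists_line_eq_Icc hΔ' hΔ'k hy hu
  have hfu : 0 < f (toPlane u) := by
    rw [map_add, map_smul, smul_eq_mul] at hfc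
    have : 0 < s * f (toPlane u) := by linarith
    exact pos_of_mul_pos_right this hs.le
  refine ⟨r₁, by linarith [((hr τ).1 hτΔ).2], ?_⟩
  obtain ⟨l, hl⟩ := hexp ⟨_, left_mem_segment _ _ _⟩
  have hseg : ∀ {x}, x ∈ segment ℝ p (p + t • toPlane u) ↔ ∃ r, 0 ≤ r ∧ r ≤ t ∧ x = p + r • toPlane u := by
    intro x
    have := mem_segment_line (x := p) (d := toPlane u) (y := x) (r₀ := 0) (r₁ := t) (by linarith)
    simpa using this
  have hseg' : ∀ {x}, x ∈ segment ℝ (p + s • toPlane u) (p + s • toPlane u + r₁ • toPlane u) ↔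
      ∃ r, 0 ≤ r ∧ r ≤ r₁ ∧ x = p + s • toPlane u + r • toPlane u := by
    intro x
    have := mem_segment_line (x := p + s • toPlane u) (d := toPlane u) (y := x) (r₀ := 0) (r₁ := r₁) h1
    simpa using this
  have hyseg : p + s • toPlane u ∈ segment ℝ p (p + t • toPlane u) := hseg.2 ⟨s, hs.le, hst.le, rfl⟩
  have hpseg : p ∈ segment ℝ p (p + t • toPlane u) := left_mem_segment _ _ _
  rw [hl] at hyseg hpseg
  have hlu : l (toPlane u) = 0 := by
    have h2 := hyseg.2 p hpseg.1
    have h3 := hpseg.2 _ hyseg.1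
    rw [map_add, map_smul, smul_eq_mul] at h2 h3
    nlinarith
  intro _
  refine ⟨l, ?_⟩
  ext x
  rw [hseg']
  constructor
  · rintro ⟨r, hr0, hr1, rfl⟩
    refine ⟨(hr r).2 ⟨by linarith, hr1⟩, fun z hz => ?_⟩
    have := hyseg.2 z (hsub hz)
    rw [map_add, map_smul, hlu]; simpa using this
  · rintro ⟨hx, hmax⟩
    have hxs : x ∈ segment ℝ p (p + t • toPlane u) := by
      rw [hl]
      exact ⟨hsub hx, fun z hz => (hyseg.2 z hz).trans (hmax _ hy)⟩
    obtain ⟨r, hr0, hr1, rfl⟩ := hseg.1 hxs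
    have e : p + r • toPlane u = p + s • toPlane u + (r - s) • toPlane u := by module
    have hfx := hf _ hx
    rw [e, map_add, hfc, map_smul, smul_eq_mul] at hfx
    have hrs : 0 ≤ r - s := nonneg_of_mul_nonneg_left (by linarith) hfu
    rw [e] at hx
    exact ⟨r - s, hrs, ((hr _).1 hx).2, e⟩

/-- The cutting line meets the remaining polygon in the third side of the corner. -/
lemma corner_inter (hΔ' : Convex ℝ Δ') (hf : ∀ x ∈ Δ', c ≤ f x) {A B : Plane}
    (hD : D = convexHull ℝ {p, p + A, p + B}) (hpc : f p < c) (hfA : f (p + A) = c)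
    (hfB : f (p + B) = c) (hA : p + A ∈ Δ') (hB : p + B ∈ Δ') :
    D ∩ Δ' = segment ℝ (p + A) (p + B) := by
  ext x
  constructor
  · rintro ⟨hx, hx'⟩
    rw [hD, mem_triangle_iff] at hx
    obtain ⟨α, β, h1, h2, h3, rfl⟩ := hx
    have h4 := hf _ hx'
    simp only [map_add, map_smul, smul_eq_mul] at *
    have h5 : (1 - α - β) * (c - f p) ≤ 0 := by
      have e1 : f A = c - f p := by linarith
      have e2 : f B = c - f p := by linarith
      rw [e1, e2] at h4
      nlinarith
    have h6 : 1 - α - β ≤ 0 := nonpos_of_mul_nonpos_left h5 (by linarith)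
    have h7 : α + β = 1 := by linarith
    refine ⟨α, β, h1, h2, h7, ?_⟩
    have : p = α • p + β • p := by rw [← add_smul, h7, one_smul]
    rw [smul_add, smul_add]
    conv_rhs => rw [this]
    abel
  · intro hx
    refine ⟨?_, hΔ'.segment_subset hA hB hx⟩
    rw [hD]
    exact (convex_convexHull ℝ _).segment_subset (subset_convexHull ℝ _ (by simp))
      (subset_convexHull ℝ _ (by simp)) hx

/-- On Δ' the functional f is at least c, with equality exactly on the part shared with D, so -f
exposes the cut. -/
lemma corner_exposed_cut (hDf : D = {x ∈ Δ | f x ≤ c}) (hsub : Δ' ⊆ Δ) {y z : Plane}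
    (hf : ∀ x ∈ Δ', c ≤ f x) (hfy : f y = c) (hy : y ∈ Δ')
    (hseg : D ∩ Δ' = segment ℝ y z) : IsExposed ℝ Δ' (segment ℝ y z) := by
  intro _
  refine ⟨-f, ?_⟩
  rw [← hseg]
  ext x
  constructor
  · rintro ⟨hx, hx'⟩
    refine ⟨hx', fun w hw => ?_⟩
    rw [hDf] at hx
    have h1 := hf w hw
    have h2 := hx.2
    simp
    linarith
  · rintro ⟨hx, hmax⟩
    refine ⟨?_, hx⟩
    rw [hDf]
    refine ⟨hsub hx, ?_⟩
    have := hmax y hy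
    simp at this
    linarith

/-- At a vertex of a Delzant polygon any two edge vectors that are not parallel form a basis. -/
lemma abs_crossZ_eq_one_of_delzant {Q : Set Plane} (hQ : IsDelzantPolygon Q) {y : Plane}
    (hy : y ∈ Q.extremePoints ℝ) {u w : Fin 2 → ℤ} (hu : u ∈ edgeVectors Q y)
    (hw : w ∈ edgeVectors Q y) (h : crossZ u w ≠ 0) : |crossZ u w| = 1 := by
  obtain ⟨a, b, hab, hdet⟩ := hQ.2 y hy
  have hdet' : crossZ a b = 1 := by rw [crossZ, mul_comm (a 1)]; exact hdet
  rw [hab] at hu hw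
  rcases hu with rfl | hu <;> rcases hw with rfl | hw
  · exact absurd (crossZ_self _) h
  · rw [mem_singleton_iff] at hw
    subst hw
    rw [hdet']; rfl
  · rw [mem_singleton_iff] at hu
    subst hu
    rw [crossZ_swap, hdet']; rfl
  · rw [mem_singleton_iff] at hu hw
    subst hu hw
    exact absurd (crossZ_self _) h

/-- In a polygon whose multiple is Delzant, the ratio of the sides of a corner is integral. -/
lemma dvd_of_delzant {k m m' : ℕ} (hk : 0 < k) (hm' : 0 < m')
    (hQ : IsDelzantPolygon ((k : ℝ) • Δ')) (huv : |crossZ u v| = 1)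
    {τ : ℝ} (hτ : 0 < τ)
    (hside : IsExposed ℝ Δ' (segment ℝ (p + ((m : ℝ) / k) • toPlane u)
      (p + ((m : ℝ) / k) • toPlane u + τ • toPlane u)))
    (hcut : IsExposed ℝ Δ' (segment ℝ (p + ((m : ℝ) / k) • toPlane u)
      (p + ((m' : ℝ) / k) • toPlane v))) : m' ∣ m := by
  have hk' : (0 : ℝ) < k := by exact_mod_cast hk
  set y := p + ((m : ℝ) / k) • toPlane u with hy
  -- With m = g b and m' = g b' the cut runs along w = b' v - b u, which is primitive because (u, v)
  -- is a basis and b, b' are coprime. The determinant of u and w is ±b', so the Delzant condition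
  -- gives b' = 1.
  set g := Nat.gcd m m' with hg
  have hgpos : 0 < g := Nat.gcd_pos_of_pos_right _ hm'
  obtain ⟨b, hb⟩ : g ∣ m := Nat.gcd_dvd_left _ _
  obtain ⟨b', hb'⟩ : g ∣ m' := Nat.gcd_dvd_right _ _
  set w : Fin 2 → ℤ := (b' : ℤ) • v - (b : ℤ) • u with hw
  have huw : crossZ u w = b' * crossZ u v := by
    rw [hw, crossZ_sub_right, crossZ_smul_right, crossZ_smul_right, crossZ_self]; ring
  have hvw : crossZ v w = b * crossZ u v := by
    rw [hw, crossZ_sub_right, crossZ_smul_right, crossZ_smul_right, crossZ_self, crossZ_swap v u]; ring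
  have hcop : IsCoprime (b' : ℤ) (b : ℤ) := by
    rw [Nat.isCoprime_iff_coprime, Nat.coprime_comm]
    have h1 : Nat.gcd (g * b) (g * b') = g := by rw [← hb, ← hb']
    rw [Nat.gcd_mul_left] at h1
    exact Nat.eq_of_mul_eq_mul_left hgpos (by rw [h1, mul_one])
  have hwc : IsCoprime (w 0) (w 1) := by
    obtain ⟨α, β, hαβ⟩ := hcop
    have hunit : crossZ u v * crossZ u v = 1 := by
      rcases (abs_eq zero_le_one).1 huv with h | h <;> rw [h] <;> rfl
    have h1 : crossZ u v * (α * crossZ u w + β * crossZ v w) = 1 := by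
      rw [huw, hvw]; linear_combination (α * b' + β * b) * hunit + hαβ
    refine ⟨crossZ u v * (-α * u 1 - β * v 1), crossZ u v * (α * u 0 + β * v 0), ?_⟩
    rw [← h1]
    unfold crossZ
    ring
  have hz : p + ((m' : ℝ) / k) • toPlane v = y + ((g : ℝ) / k) • toPlane w := by
    rw [hy, hw, toPlane_sub, toPlane_zsmul, toPlane_zsmul]
    have e1 : (m : ℝ) = g * b := by exact_mod_cast hb
    have e2 : (m' : ℝ) = g * b' := by exact_mod_cast hb'
    rw [e1, e2]
    push_cast
    module
  rw [hz] at hcut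
  have h1 : u ∈ edgeVectors ((k : ℝ) • Δ') ((k : ℝ) • y) :=
    mem_edgeVectors_smul (coprime_of_crossZ huv) hτ hk' hside
  have h2 : w ∈ edgeVectors ((k : ℝ) • Δ') ((k : ℝ) • y) :=
    mem_edgeVectors_smul hwc (by positivity) hk' hcut
  have hext : (k : ℝ) • y ∈ ((k : ℝ) • Δ').extremePoints ℝ := by
    have := IsExposed.smul_set hside hk'
    rw [smul_segment_line] at this
    exact left_mem_extremePoints this
  have hb'pos : 0 < b' := by
    rcases Nat.eq_zero_or_pos b' with h | h
    · rw [h, mul_zero] at hb'; omega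
    · exact h
  have hne : crossZ u w ≠ 0 := by
    rw [huw]
    refine mul_ne_zero (by positivity) ?_
    intro h; rw [h] at huv; simp at huv
  have h3 := abs_crossZ_eq_one_of_delzant hQ hext h1 h2 hne
  rw [huw, abs_mul, huv, mul_one, Nat.abs_cast] at h3
  have h4 : b' = 1 := by exact_mod_cast h3
  rw [h4, mul_one] at hb'
  rw [hb']
  exact ⟨b, hb⟩

end Corner

/-! ### Existence and uniqueness of the corner sizes -/

section Decomposition

variable {ℓ : ℕ} {Δ Δ' : Set Plane} {D : Fin ℓ → Set Plane} {p : Fin ℓ → Plane} {k : ℕ}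
  {u v : Fin ℓ → Fin 2 → ℤ}

lemma IsOrientedEdgeBasis.crossZ_eq {P : Set Plane} {q : Plane} {a b : Fin 2 → ℤ}
    (h : IsOrientedEdgeBasis P q a b) : crossZ a b = 1 := by
  rw [crossZ, mul_comm (a 1)]; exact h.2

/-- The near end of the remaining edge becomes a vertex of the lattice polygon kQ, hence a lattice
point; it differs from the lattice point kq by ks times a primitive vector, so ks is an integer. -/
lemma exists_nat_of_extreme {Q : Set Plane} (hQ : IsLatticePolygon ((k : ℝ) • Q)) (hk : 0 < k)
    {q : Plane} {n w : Fin 2 → ℤ} (hq : q = toPlane n) (hw : IsCoprime (w 0) (w 1)) {s τ : ℝ}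
    (hs : 0 < s)
    (h : IsExposed ℝ Q (segment ℝ (q + s • toPlane w) (q + s • toPlane w + τ • toPlane w))) :
    ∃ m : ℕ, 0 < m ∧ s = m / k := by
  have hk' : (0 : ℝ) < k := by exact_mod_cast hk
  have h1 := IsExposed.smul_set h hk'
  rw [smul_segment_line] at h1
  obtain ⟨b, hb⟩ := hQ.exists_of_extreme (left_mem_extremePoints h1)
  obtain ⟨g, hg⟩ := int_of_smul_primitive (n := b - (k : ℤ) • n) hw (t := k * s) (by
    rw [toPlane_sub, hb, toPlane_zsmul, hq, Int.cast_natCast]; module)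
  have hpos : (0 : ℝ) < g := by rw [← hg]; positivity
  have hpos' : 0 < g := by exact_mod_cast hpos
  lift g to ℕ using hpos'.le
  refine ⟨g, by exact_mod_cast hpos', ?_⟩
  rw [eq_div_iff hk'.ne', mul_comm]
  exact_mod_cast hg

lemma IsCornerDecomposition.pos (hdec : IsCornerDecomposition Δ Δ' D p k) : 0 < k := hdec.least.1.1

lemma IsCornerDecomposition.eq_inv_smul (hdec : IsCornerDecomposition Δ Δ' D p k) :
    Δ' = (k : ℝ)⁻¹ • ((k : ℝ) • Δ') := by
  rw [smul_smul, inv_mul_cancel₀ (by have := hdec.pos; positivity), one_smul]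

lemma IsCornerDecomposition.convex_rest (hdec : IsCornerDecomposition Δ Δ' D p k) :
    Convex ℝ Δ' := by
  rw [hdec.eq_inv_smul]; exact hdec.least.1.2.1.convex.smul _

lemma IsCornerDecomposition.isCompact_rest (hdec : IsCornerDecomposition Δ Δ' D p k) :
    IsCompact Δ' := by
  rw [hdec.eq_inv_smul]; exact hdec.least.1.2.1.isCompact.smul _

/-- The corners have equal sides of length a multiple of `1 / k`, and they meet the remaining
polygon in the third side. -/
theorem exists_cornerSize (hdec : IsCornerDecomposition Δ Δ' D p k)
    (huv : ∀ a, IsOrientedEdgeBasis Δ (p a) (u a) (v a)) (a : Fin ℓ) :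
    ∃ m : ℕ, 0 < m ∧ D a = convexHull ℝ
      {p a, p a + ((m : ℝ) / k) • toPlane (u a), p a + ((m : ℝ) / k) • toPlane (v a)} ∧
      D a ∩ Δ' = segment ℝ (p a + ((m : ℝ) / k) • toPlane (u a))
        (p a + ((m : ℝ) / k) • toPlane (v a)) := by
  have hk := hdec.pos
  have hQ := hdec.least.1.2
  have hΔ := hdec.delzant.1.convex
  have hΔ'c := hdec.convex_rest
  have hΔ'k := hdec.isCompact_rest
  have hsub : Δ' ⊆ Δ := by
    have h : Δ' ⊆ Δ' ∪ ⋃ b, D b := subset_union_left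
    rwa [← hdec.eq_union] at h
  have hcr : |crossZ (u a) (v a)| = 1 := by rw [(huv a).crossZ_eq]; rfl
  have hcr' : |crossZ (v a) (u a)| = 1 := by rw [crossZ_swap, (huv a).crossZ_eq]; rfl
  have hu : u a ∈ edgeVectors Δ (p a) := by rw [(huv a).1]; exact Or.inl rfl
  have hv : v a ∈ edgeVectors Δ (p a) := by rw [(huv a).1]; exact Or.inr rfl
  obtain ⟨f, c, hDf, hf, hlt⟩ := exists_cut hΔ hΔ'c hdec.triangle hdec.eq_union hdec.disjoint (hdec.inter a)
  obtain ⟨s, t, s', t', hs, hst, hexp, hs', hst', hexp', hD, hpc, hfu, hfv⟩ :=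
    corner_shape hΔ (hdec.triangle a) hDf hlt (hdec.unique_vertex a) hcr hu hv
  have hU : Δ ⊆ Δ' ∪ D a ∪ ⋃ b : {b // b ≠ a}, D b := by
    intro x hx
    rw [hdec.eq_union] at hx
    rcases hx with hx | hx
    · exact Or.inl (Or.inl hx)
    · obtain ⟨b, hb⟩ := mem_iUnion.1 hx
      by_cases hba : b = a
      · left; right; rwa [← hba]
      · right; exact mem_iUnion.2 ⟨⟨b, hba⟩, hb⟩
  have hnot : ∀ x ∈ D a, ∀ b : {b // b ≠ a}, x ∉ D b := by
    intro x hx b hb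
    have : x ∈ D a ∩ D b := ⟨hx, hb⟩
    rw [hdec.disjoint a b (Ne.symm b.2)] at this
    exact this
  have hyD : p a + s • toPlane (u a) ∈ D a := by rw [hD]; exact subset_convexHull ℝ _ (by simp)
  have hzD : p a + s' • toPlane (v a) ∈ D a := by rw [hD]; exact subset_convexHull ℝ _ (by simp)
  have hEc : ∀ b : {b // b ≠ a}, IsClosed (D b) := fun b => (hdec.triangle b).isCompact.isClosed
  obtain ⟨hy, hτ⟩ := corner_beyond hEc hΔ'k.isClosed hU hDf hs hst hexp hpc hfu (hnot _ hyD)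
  obtain ⟨hz, hτ'⟩ := corner_beyond hEc hΔ'k.isClosed hU hDf hs' hst' hexp' hpc hfv (hnot _ hzD)
  obtain ⟨τ, hτ0, hside⟩ := corner_exposed_side hΔ'c hΔ'k hsub hf (toPlane_ne_zero hu.1) hs hst hexp hpc
    hfu hy hτ
  obtain ⟨τ', hτ0', hside'⟩ := corner_exposed_side hΔ'c hΔ'k hsub hf (toPlane_ne_zero hv.1) hs' hst' hexp'
    hpc hfv hz hτ'
  have hseg := corner_inter hΔ'c hf hD hpc hfu hfv hy hz
  have hcut := corner_exposed_cut hDf hsub hf hfu hy hseg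
  have hpe : p a ∈ Δ.extremePoints ℝ := by
    have : p a ∈ Δ.extremePoints ℝ ∩ D a := by rw [hdec.unique_vertex a]; rfl
    exact this.1
  obtain ⟨n, hn⟩ := hdec.delzant.1.exists_of_extreme hpe
  obtain ⟨m, hm, rfl⟩ := exists_nat_of_extreme hQ.1 hk hn.symm hu.1 hs hside
  obtain ⟨m', hm', rfl⟩ := exists_nat_of_extreme hQ.1 hk hn.symm hv.1 hs' hside'
  -- The Delzant condition at one end of the cut gives one divisibility, at the other end the
  -- reverse one.
  have h1 : m' ∣ m := dvd_of_delzant hk hm' hQ hcr hτ0 hside hcut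
  have h2 : m ∣ m' := by
    rw [segment_symm] at hcut
    exact dvd_of_delzant hk hm hQ hcr' hτ0' hside' hcut
  obtain rfl := Nat.dvd_antisymm h1 h2
  exact ⟨m', hm, hD, hseg⟩

lemma cornerSize_le {q : Plane} {a b : Fin 2 → ℤ} (hab : crossZ a b = 1) {s s' : ℝ} (hs' : 0 ≤ s')
    (h : q + s • toPlane a ∈ convexHull ℝ {q, q + s' • toPlane a, q + s' • toPlane b}) : s ≤ s' := by
  obtain ⟨α, β, h1, h2, h3, h4⟩ := mem_triangle_iff.1 h
  have h5 := congrArg (fun x => cross x (toPlane b)) h4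
  have h6 : cross (toPlane a) (toPlane b) = 1 := by rw [cross_toPlane, hab]; simp
  simp only [cross_add_left, cross_smul_left, cross_self, h6] at h5
  nlinarith

lemma IsCornerSize.unique (huv : ∀ a, IsOrientedEdgeBasis Δ (p a) (u a) (v a)) (hk : 0 < k)
    {m m' : Fin ℓ → ℕ} (h : IsCornerSize D p k u v m) (h' : IsCornerSize D p k u v m') : m = m' := by
  have hk' : (0 : ℝ) < k := by exact_mod_cast hk
  have key : ∀ {m m' : Fin ℓ → ℕ}, IsCornerSize D p k u v m → IsCornerSize D p k u v m' →
      ∀ a, m a ≤ m' a := by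
    intro m m' h h' a
    have h1 : p a + ((m a : ℝ) / k) • toPlane (u a) ∈ D a := by
      rw [(h a).2]; exact subset_convexHull ℝ _ (by simp)
    rw [(h' a).2] at h1
    have h2 := cornerSize_le (huv a).crossZ_eq (by positivity) h1
    rw [div_le_div_iff_of_pos_right hk'] at h2
    exact_mod_cast h2
  funext a
  exact le_antisymm (key h h' a) (key h' h a)

theorem existsUnique_cornerSize (hdec : IsCornerDecomposition Δ Δ' D p k)
    (huv : ∀ a, IsOrientedEdgeBasis Δ (p a) (u a) (v a)) :
    ∃! m : Fin ℓ → ℕ, IsCornerSize D p k u v m := by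
  choose m hm using exists_cornerSize hdec huv
  exact ⟨m, fun a => ⟨(hm a).1, (hm a).2.1⟩, fun m' h' =>
    IsCornerSize.unique huv hdec.pos h' fun a => ⟨(hm a).1, (hm a).2.1⟩⟩

/-- `IsCornerSize` records only the shape of each D_a; uniqueness identifies m with the constructed
sizes, for which the common side with Δ' is known. -/
lemma IsCornerSize.inter_eq (hdec : IsCornerDecomposition Δ Δ' D p k)
    (huv : ∀ a, IsOrientedEdgeBasis Δ (p a) (u a) (v a)) {m : Fin ℓ → ℕ}
    (hm : IsCornerSize D p k u v m) (a : Fin ℓ) :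
    D a ∩ Δ' = segment ℝ (p a + ((m a : ℝ) / k) • toPlane (u a))
        (p a + ((m a : ℝ) / k) • toPlane (v a)) := by
  choose m' hm' using exists_cornerSize hdec huv
  have : m = m' := IsCornerSize.unique huv hdec.pos hm fun a => ⟨(hm' a).1, (hm' a).2.1⟩
  rw [this]
  exact (hm' a).2.2

end Decomposition

/-! ### The dilated polygon, and the area and moment of a cut-off triangle -/

lemma IsLatticePolygon.natCast_smul {P : Set Plane} (hP : IsLatticePolygon P) {k : ℕ} (hk : 0 < k) :
    IsLatticePolygon ((k : ℝ) • P) := by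
  classical
  have hk' : (k : ℝ) ≠ 0 := by positivity
  obtain ⟨⟨S, rfl⟩, hi⟩ := hP
  refine ⟨⟨S.image fun x => (k : ℤ) • x, ?_⟩, ?_⟩
  · rw [← convexHull_smul]
    congr 1
    ext x
    simp only [Finset.coe_image, mem_image, Finset.mem_coe, exists_exists_and_eq_and, mem_smul_set,
      toPlane_zsmul, Int.cast_natCast]
  · rw [interior_smul₀ hk']
    exact hi.smul_set

/-- The lattice-sum polynomial of a lattice polygon exists, and its constant term determines the
lattice sums. -/
theorem latticeSumPolynomial_spec {P : Set Plane} (hP : IsLatticePolygon P) :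
    IsLatticeSumPolynomial P (latticeSumPolynomial P) ∧ ∀ i : ℕ, 0 < i →
      latticeSum P i = ((i : ℝ) ^ 2) • moment P + ((i : ℝ) / 2) • boundaryMoment P +
        latticeSumConst P := by
  obtain ⟨s, hs⟩ := exists_latticeSum_const hP
  set q : Fin 2 → ℝ[X] := fun j => Polynomial.C (moment P j) * Polynomial.X ^ 2 +
    Polynomial.C (boundaryMoment P j / 2) * Polynomial.X + Polynomial.C (s j) with hq
  have hqP : IsLatticeSumPolynomial P q := by
    intro i hi j
    rw [(hs i hi).2, hq]
    simp
    ring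
  have hex : ∃ q, IsLatticeSumPolynomial P q := ⟨q, hqP⟩
  have hspec : IsLatticeSumPolynomial P (latticeSumPolynomial P) := by
    rw [latticeSumPolynomial, dif_pos hex]
    exact hex.choose_spec
  refine ⟨hspec, fun i hi => ?_⟩
  have : latticeSumConst P = s := by
    funext j
    rw [latticeSumConst, hspec.unique hqP, hq]
    simp
  rw [this, (hs i hi).2]

/-- The half-open triangle `q + α A + β B` with `0 ≤ α`, `0 ≤ β`, `α + β < 1`. -/
def cornerPiece (q A B : Plane) : Set Plane :=
  {x | ∃ α β : ℝ, 0 ≤ α ∧ 0 ≤ β ∧ α + β < 1 ∧ x = q + α • A + β • B}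

/-- Taking q + B as apex turns the missing third side into the missing side of `triHalf`, so its
integrals can be reused. -/
lemma cornerPiece_eq_triHalf (q A B : Plane) : cornerPiece q A B = triHalf (q + B) (-B) (A - B) := by
  ext x
  constructor
  · rintro ⟨α, β, h1, h2, h3, rfl⟩
    exact ⟨1 - α - β, α, by linarith, h1, by linarith, by module⟩
  · rintro ⟨α, β, h1, h2, h3, rfl⟩
    exact ⟨β, 1 - α - β, h2, by linarith, by linarith, by module⟩

lemma cross_rebase (A B : Plane) : cross (-B) (A - B) = cross A B := by
  rw [cross_neg_left, cross_sub_right, cross_self, cross_swap A B]; ring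

lemma area_cornerPiece {q A B : Plane} (h : 0 < cross A B) :
    volume.real (cornerPiece q A B) = cross A B / 2 := by
  rw [cornerPiece_eq_triHalf, area_triHalf (by rwa [cross_rebase]), cross_rebase]

lemma moment_cornerPiece {q A B : Plane} (h : 0 < cross A B) :
    ∫ x in cornerPiece q A B, x = (cross A B / 2) • q + (cross A B / 6) • (A + B) := by
  rw [cornerPiece_eq_triHalf, moment_triHalf (by rwa [cross_rebase]), cross_rebase]
  module

lemma measurableSet_cornerPiece {q A B : Plane} (h : 0 < cross A B) :
    MeasurableSet (cornerPiece q A B) := by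
  rw [cornerPiece_eq_triHalf]
  exact measurableSet_triHalf (by rwa [cross_rebase])

lemma triangle_sdiff_segment {q A B : Plane} (h : cross A B ≠ 0) :
    convexHull ℝ {q, q + A, q + B} \ segment ℝ (q + A) (q + B) = cornerPiece q A B := by
  ext x
  constructor
  · rintro ⟨hx, hx'⟩
    obtain ⟨α, β, h1, h2, h3, rfl⟩ := mem_triangle_iff.1 hx
    refine ⟨α, β, h1, h2, lt_of_le_of_ne h3 fun h4 => hx' ⟨α, β, h1, h2, h4, ?_⟩, rfl⟩
    obtain rfl : β = 1 - α := by linarith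
    module
  · rintro ⟨α, β, h1, h2, h3, rfl⟩
    refine ⟨mem_triangle_iff.2 ⟨α, β, h1, h2, h3.le, rfl⟩, ?_⟩
    rintro ⟨α', β', -, -, h4, h5⟩
    have e : α • A + β • B = α' • A + β' • B := by
      obtain rfl : β' = 1 - α' := by linarith
      have h6 : q + α • A + β • B - q = _ - q := congrArg (fun z => z - q) h5.symm
      have e1 : q + α • A + β • B - q = α • A + β • B := by abel
      rw [e1] at h6
      rw [h6]; module
    have g1 := congrArg (fun w => cross w B) e
    have g2 := congrArg (fun w => cross A w) e
    simp only [cross_add_left, cross_add_right, cross_smul_left, cross_smul_right, cross_self,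
      mul_zero, add_zero, zero_add] at g1 g2
    have := mul_right_cancel₀ h g1
    have := mul_right_cancel₀ h g2
    linarith

lemma smul_cornerPiece (k : ℝ) (q A B : Plane) :
    k • cornerPiece q A B = cornerPiece (k • q) (k • A) (k • B) := by
  ext x
  constructor
  · rintro ⟨_, ⟨α, β, h1, h2, h3, rfl⟩, rfl⟩
    exact ⟨α, β, h1, h2, h3, by simp only; module⟩
  · rintro ⟨α, β, h1, h2, h3, rfl⟩
    exact ⟨_, ⟨α, β, h1, h2, h3, rfl⟩, by simp only; module⟩

/-! ### Lattice points of a cut-off triangle -/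

section Count

variable {N u v : Fin 2 → ℤ} {m i : ℕ}

/-- In the lattice basis (u, v) centred at iN lattice points have integer coordinates, and α + β < 1
becomes X + Y < m i. -/
lemma scaled_cornerPiece (huv : crossZ u v = 1) (hm : 0 < m) (hi : 0 < i) :
    scaledLatticePoints (cornerPiece (toPlane N) ((m : ℝ) • toPlane u) ((m : ℝ) • toPlane v)) i =
      (fun z : ℕ × ℕ => (i : ℤ) • N + ((z.1 : ℤ) • u + (z.2 : ℤ) • v)) '' (pairs (m * i) : Set (ℕ × ℕ)) := by
  have hi' : (0 : ℝ) < i := by exact_mod_cast hi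
  have hm' : (0 : ℝ) < m := by exact_mod_cast hm
  ext x
  simp only [scaledLatticePoints, mem_ofPred_eq, mem_image, Finset.mem_coe, mem_pairs, Prod.exists]
  constructor
  · rintro ⟨α, β, h1, h2, h3, hx⟩
    rw [add_assoc, ← sub_eq_iff_eq_add', inv_smul_sub_eq hi] at hx
    set y := x - (i : ℤ) • N with hy
    have hy2 : toPlane y = (i * m * α : ℝ) • toPlane u + (i * m * β : ℝ) • toPlane v := by
      have := congrArg (fun z => (i : ℝ) • z) hx
      simp only [smul_smul, mul_inv_cancel₀ hi'.ne', one_smul] at this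
      rw [this]; module
    have hcr : cross (toPlane u) (toPlane v) = 1 := by rw [cross_toPlane, huv]; simp
    have eX : (crossZ y v : ℝ) = i * m * α := by
      rw [← cross_toPlane, hy2, cross_add_left, cross_smul_left, cross_smul_left, cross_self, hcr]; ring
    have eY : (crossZ u y : ℝ) = i * m * β := by
      rw [← cross_toPlane, hy2, cross_add_right, cross_smul_right, cross_smul_right, cross_self, hcr]; ring
    have hX : 0 ≤ crossZ y v := by
      have : (0 : ℝ) ≤ crossZ y v := by rw [eX]; positivity
      exact_mod_cast this
    have hY : 0 ≤ crossZ u y := by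
      have : (0 : ℝ) ≤ crossZ u y := by rw [eY]; positivity
      exact_mod_cast this
    have hXY : crossZ y v + crossZ u y < (m * i : ℕ) := by
      have : (crossZ y v : ℝ) + crossZ u y < (m * i : ℕ) := by
        rw [eX, eY]; push_cast
        nlinarith [mul_pos hi' hm']
      exact_mod_cast this
    obtain ⟨X, hX'⟩ := Int.eq_ofNat_of_zero_le hX
    obtain ⟨Y, hY'⟩ := Int.eq_ofNat_of_zero_le hY
    refine ⟨X, Y, by omega, ?_⟩
    have hyy : y = (X : ℤ) • u + (Y : ℤ) • v := by
      apply toPlane_injective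
      rw [hy2, toPlane_add, toPlane_zsmul, toPlane_zsmul, ← hX', ← hY', eX, eY]
    rw [← hyy, hy]; abel
  · rintro ⟨X, Y, hXY, rfl⟩
    refine ⟨X / (m * i), Y / (m * i), by positivity, by positivity, ?_, ?_⟩
    · rw [← add_div, div_lt_one (by positivity)]; exact_mod_cast hXY
    · rw [add_assoc, ← sub_eq_iff_eq_add', inv_smul_sub_eq hi, add_sub_cancel_left, toPlane_add,
        toPlane_zsmul, toPlane_zsmul, smul_add, smul_smul, smul_smul, smul_smul, smul_smul]
      push_cast
      congr 2 <;> field_simp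

lemma corner_coords_injective (huv : crossZ u v = 1) (c : Fin 2 → ℤ) :
    Function.Injective fun z : ℕ × ℕ => c + ((z.1 : ℤ) • u + (z.2 : ℤ) • v) := by
  rintro ⟨X, Y⟩ ⟨X', Y'⟩ h
  have h := add_left_cancel h
  simp only at h
  have h1 := congrArg (fun z => crossZ z v) h
  have h2 := congrArg (crossZ u) h
  simp only [crossZ_add_left, crossZ_add_right, crossZ_smul_left, crossZ_smul_right, crossZ_self, huv,
    mul_one, mul_zero, add_zero, zero_add] at h1 h2
  rw [Nat.cast_injective h1, Nat.cast_injective h2]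

lemma ncard_scaled_cornerPiece (huv : crossZ u v = 1) (hm : 0 < m) (hi : 0 < i) :
    ((scaledLatticePoints (cornerPiece (toPlane N) ((m : ℝ) • toPlane u) ((m : ℝ) • toPlane v)) i).ncard : ℝ)
      = (m * i : ℝ) * (m * i + 1) / 2 := by
  rw [scaled_cornerPiece huv hm hi, Set.ncard_image_of_injective _ (corner_coords_injective huv _),
    Set.ncard_coe_finset, card_pairs]
  push_cast; ring

lemma sum_scaled_cornerPiece (huv : crossZ u v = 1) (hm : 0 < m) (hi : 0 < i) :
    ∑ᶠ x ∈ scaledLatticePoints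
        (cornerPiece (toPlane N) ((m : ℝ) • toPlane u) ((m : ℝ) • toPlane v)) i,
        (i : ℝ)⁻¹ • toPlane x =
      ((m * i : ℝ) * (m * i + 1) / 2) • toPlane N +
        (((m : ℝ) ^ 3 * i ^ 2 - m) / 6) • (toPlane u + toPlane v) := by
  have hi' : (i : ℝ) ≠ 0 := by positivity
  rw [scaled_cornerPiece huv hm hi, finsum_mem_image (corner_coords_injective huv _).injOn,
    finsum_mem_coe_finset, ← Finset.smul_sum]
  simp only [toPlane_add, toPlane_zsmul, Int.cast_natCast]
  rw [sum_pairs_affine]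
  push_cast
  rw [smul_add, smul_smul, smul_smul, smul_smul]
  congr 2 <;> field_simp
  ring

end Count

/-! ### Additivity over the cut and comparison of the Chow weights -/

section Decomposition

variable {ℓ : ℕ} {Δ Δ' : Set Plane} {D : Fin ℓ → Set Plane} {p : Fin ℓ → Plane} {k : ℕ}
  {u v : Fin ℓ → Fin 2 → ℤ} {m : Fin ℓ → ℕ}

/-- The part of `kΔ` cut off at the vertex `k p_a`. -/
def cutPiece (p : Fin ℓ → Plane) (k : ℕ) (u v : Fin ℓ → Fin 2 → ℤ) (m : Fin ℓ → ℕ) (a : Fin ℓ) :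
    Set Plane :=
  cornerPiece ((k : ℝ) • p a) ((m a : ℝ) • toPlane (u a)) ((m a : ℝ) • toPlane (v a))

/-- D_a meets Δ' exactly in its third side, so removing Δ' leaves the half-open triangle. -/
lemma cutPiece_eq (hdec : IsCornerDecomposition Δ Δ' D p k)
    (huv : ∀ a, IsOrientedEdgeBasis Δ (p a) (u a) (v a)) (hm : IsCornerSize D p k u v m) (a : Fin ℓ) :
    cutPiece p k u v m a = (k : ℝ) • (D a \ Δ') := by
  have hk' : (0 : ℝ) < k := by exact_mod_cast hdec.pos
  have hma : (0 : ℝ) < m a := by exact_mod_cast (hm a).1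
  have h1 : D a \ Δ' = D a \ (D a ∩ Δ') := by rw [sdiff_self_inter]
  have hcr : cross (((m a : ℝ) / k) • toPlane (u a)) (((m a : ℝ) / k) • toPlane (v a)) ≠ 0 := by
    rw [cross_smul_left, cross_smul_right, cross_toPlane, (huv a).crossZ_eq]
    push_cast
    positivity
  rw [h1, hm.inter_eq hdec huv a, (hm a).2, triangle_sdiff_segment hcr, smul_cornerPiece, cutPiece,
    smul_smul, smul_smul, mul_div_cancel₀ _ hk'.ne']

lemma smul_eq_union_cutPiece (hdec : IsCornerDecomposition Δ Δ' D p k)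
    (huv : ∀ a, IsOrientedEdgeBasis Δ (p a) (u a) (v a)) (hm : IsCornerSize D p k u v m) :
    (k : ℝ) • Δ = (k : ℝ) • Δ' ∪ ⋃ a, cutPiece p k u v m a := by
  simp only [cutPiece_eq hdec huv hm]
  rw [← smul_set_iUnion, ← smul_set_union, ← iUnion_sdiff, union_sdiff_self, ← hdec.eq_union]

lemma disjoint_rest_cutPiece (hdec : IsCornerDecomposition Δ Δ' D p k)
    (huv : ∀ a, IsOrientedEdgeBasis Δ (p a) (u a) (v a)) (hm : IsCornerSize D p k u v m) (a : Fin ℓ) :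
    Disjoint ((k : ℝ) • Δ') (cutPiece p k u v m a) := by
  have hk' : (k : ℝ) ≠ 0 := by have := hdec.pos; positivity
  rw [cutPiece_eq hdec huv hm, Set.disjoint_left]
  rintro _ ⟨x, hx, rfl⟩ ⟨y, hy, h⟩
  have : y = x := smul_right_injective Plane hk' h
  subst this
  exact hy.2 hx

lemma disjoint_cutPiece (hdec : IsCornerDecomposition Δ Δ' D p k)
    (huv : ∀ a, IsOrientedEdgeBasis Δ (p a) (u a) (v a)) (hm : IsCornerSize D p k u v m) {a b : Fin ℓ}
    (hab : a ≠ b) : Disjoint (cutPiece p k u v m a) (cutPiece p k u v m b) := by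
  have hk' : (k : ℝ) ≠ 0 := by have := hdec.pos; positivity
  rw [cutPiece_eq hdec huv hm, cutPiece_eq hdec huv hm, Set.disjoint_left]
  rintro _ ⟨x, hx, rfl⟩ ⟨y, hy, h⟩
  have : y = x := smul_right_injective Plane hk' h
  subst this
  have h1 : y ∈ D a ∩ D b := ⟨hx.1, hy.1⟩
  rw [hdec.disjoint a b hab] at h1
  exact h1

lemma cutPiece_cross (huv : ∀ a, IsOrientedEdgeBasis Δ (p a) (u a) (v a)) (a : Fin ℓ) :
    cross ((m a : ℝ) • toPlane (u a)) ((m a : ℝ) • toPlane (v a)) = (m a : ℝ) ^ 2 := by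
  rw [cross_smul_left, cross_smul_right, cross_toPlane, (huv a).crossZ_eq]
  push_cast; ring

lemma area_moment_cut (hdec : IsCornerDecomposition Δ Δ' D p k)
    (huv : ∀ a, IsOrientedEdgeBasis Δ (p a) (u a) (v a)) (hm : IsCornerSize D p k u v m) :
    area ((k : ℝ) • Δ) = area ((k : ℝ) • Δ') + ∑ a, (m a : ℝ) ^ 2 / 2 ∧
    moment ((k : ℝ) • Δ) = moment ((k : ℝ) • Δ') + ∑ a, (((m a : ℝ) ^ 2 / 2) • (k : ℝ) • p a +
      ((m a : ℝ) ^ 3 / 6) • (toPlane (u a) + toPlane (v a))) := by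
  have hcr : ∀ a, 0 < cross ((m a : ℝ) • toPlane (u a)) ((m a : ℝ) • toPlane (v a)) := by
    intro a
    have := (hm a).1
    rw [cutPiece_cross huv]; positivity
  have hP := hdec.delzant.1.natCast_smul hdec.pos
  have hQ := hdec.least.1.2.1
  have hmeas : ∀ a, MeasurableSet (cutPiece p k u v m a) := fun a => measurableSet_cornerPiece (hcr a)
  have hU := smul_eq_union_cutPiece hdec huv hm
  have hsub : ∀ a, cutPiece p k u v m a ⊆ (k : ℝ) • Δ := by
    intro a x hx
    rw [hU]; exact Or.inr (mem_iUnion.2 ⟨a, hx⟩)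
  have hsub' : (k : ℝ) • Δ' ⊆ (k : ℝ) • Δ := by
    intro x hx
    rw [hU]; exact Or.inl hx
  have hfin : volume ((k : ℝ) • Δ) ≠ ⊤ := hP.isCompact.measure_lt_top.ne
  have hint : IntegrableOn (fun x : Plane => x) ((k : ℝ) • Δ) :=
    continuous_id.continuousOn.integrableOn_compact hP.isCompact
  have hdisj : Disjoint ((k : ℝ) • Δ') (⋃ a, cutPiece p k u v m a) := by
    rw [disjoint_iUnion_right]; exact disjoint_rest_cutPiece hdec huv hm
  have hpair : Pairwise (Function.onFun Disjoint (cutPiece p k u v m)) := fun a b hab =>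
    disjoint_cutPiece hdec huv hm hab
  have hbU : (⋃ a, cutPiece p k u v m a) = ⋃ a ∈ (Finset.univ : Finset (Fin ℓ)), cutPiece p k u v m a := by
    simp
  constructor
  · rw [area, area, hU, measureReal_union hdisj (MeasurableSet.iUnion hmeas)
      (measure_ne_top_of_subset hsub' hfin)
      (measure_ne_top_of_subset (iUnion_subset hsub) hfin), hbU,
      measureReal_biUnion_finset (fun a _ b _ hab => hpair hab) (fun a _ => hmeas a)
        fun a _ => measure_ne_top_of_subset (hsub a) hfin]
    congr 1
    refine Finset.sum_congr rfl fun a _ => ?_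
    rw [cutPiece, area_cornerPiece (hcr a), cutPiece_cross huv]
  · rw [moment, moment, hU, setIntegral_union hdisj (MeasurableSet.iUnion hmeas)
      (hint.mono_set hsub') (hint.mono_set (iUnion_subset hsub)), hbU,
      integral_biUnion_finset _ (fun a _ => hmeas a) (fun a _ b _ hab => hpair hab)
        fun a _ => hint.mono_set (hsub a)]
    congr 1
    refine Finset.sum_congr rfl fun a _ => ?_
    rw [cutPiece, moment_cornerPiece (hcr a), cutPiece_cross huv]
    module

lemma finsum_scaled_cut {M : Type*} [AddCommMonoid M] (hdec : IsCornerDecomposition Δ Δ' D p k)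
    (huv : ∀ a, IsOrientedEdgeBasis Δ (p a) (u a) (v a)) (hm : IsCornerSize D p k u v m) {i : ℕ}
    (hi : 0 < i) (f : (Fin 2 → ℤ) → M) :
    ∑ᶠ x ∈ scaledLatticePoints ((k : ℝ) • Δ) i, f x =
      ∑ᶠ x ∈ scaledLatticePoints ((k : ℝ) • Δ') i, f x +
        ∑ a, ∑ᶠ x ∈ scaledLatticePoints (cutPiece p k u v m a) i, f x := by
  have hP := hdec.delzant.1.natCast_smul hdec.pos
  have hU := smul_eq_union_cutPiece hdec huv hm
  have hfin := scaledLatticePoints_finite hP.isCompact.isBounded hi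
  have hset : scaledLatticePoints ((k : ℝ) • Δ) i = scaledLatticePoints ((k : ℝ) • Δ') i ∪
      ⋃ a, scaledLatticePoints (cutPiece p k u v m a) i := by
    ext x
    have : x ∈ scaledLatticePoints ((k : ℝ) • Δ) i ↔ (i : ℝ)⁻¹ • toPlane x ∈ (k : ℝ) • Δ := Iff.rfl
    rw [this, hU]
    simp only [mem_union, mem_iUnion]
    rfl
  have hfin' : ∀ a, (scaledLatticePoints (cutPiece p k u v m a) i).Finite := fun a =>
    hfin.subset (by rw [hset]; exact subset_union_of_subset_right (subset_iUnion
      (fun a => scaledLatticePoints (cutPiece p k u v m a) i) a) _)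
  rw [hset, finsum_mem_union _ (hfin.subset (by rw [hset]; exact subset_union_left))
    (Set.finite_iUnion hfin'), finsum_mem_iUnion _ hfin',
    finsum_eq_sum_of_fintype (fun a => ∑ᶠ x ∈ scaledLatticePoints (cutPiece p k u v m a) i, f x)]
  · intro a b hab
    rw [Function.onFun, Set.disjoint_left]
    intro x hx hx'
    exact Set.disjoint_left.1 (disjoint_cutPiece hdec huv hm hab) hx hx'
  · rw [Set.disjoint_left]
    intro x hx hx'
    obtain ⟨a, ha⟩ := mem_iUnion.1 hx'
    exact Set.disjoint_left.1 (disjoint_rest_cutPiece hdec huv hm a) hx ha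

lemma ehrhart_latticeSum_cut (hdec : IsCornerDecomposition Δ Δ' D p k)
    (huv : ∀ a, IsOrientedEdgeBasis Δ (p a) (u a) (v a)) (hm : IsCornerSize D p k u v m) {i : ℕ}
    (hi : 0 < i) :
    (ehrhart ((k : ℝ) • Δ) i : ℝ) = ehrhart ((k : ℝ) • Δ') i +
      ∑ a, (m a * i : ℝ) * (m a * i + 1) / 2 ∧
    latticeSum ((k : ℝ) • Δ) i = latticeSum ((k : ℝ) • Δ') i +
      ∑ a, (((m a * i : ℝ) * (m a * i + 1) / 2) • (k : ℝ) • p a +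
        (((m a : ℝ) ^ 3 * i ^ 2 - m a) / 6) • (toPlane (u a) + toPlane (v a))) := by
  have hP := hdec.delzant.1.natCast_smul hdec.pos
  have hQ := hdec.least.1.2.1
  have hN : ∀ a, ∃ N : Fin 2 → ℤ, (k : ℝ) • p a = toPlane N := by
    intro a
    have : p a ∈ Δ.extremePoints ℝ ∩ D a := by rw [hdec.unique_vertex a]; rfl
    obtain ⟨n, hn⟩ := hdec.delzant.1.exists_of_extreme this.1
    exact ⟨(k : ℤ) • n, by rw [toPlane_zsmul, hn, Int.cast_natCast]⟩
  choose N hN using hN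
  constructor
  · rw [ehrhart, ehrhart, ← finsum_mem_one_real _ (scaledLatticePoints_finite hP.isCompact.isBounded hi),
      ← finsum_mem_one_real _ (scaledLatticePoints_finite hQ.isCompact.isBounded hi),
      finsum_scaled_cut hdec huv hm hi]
    congr 1
    refine Finset.sum_congr rfl fun a _ => ?_
    rw [cutPiece, hN a, finsum_mem_one_real, ncard_scaled_cornerPiece (huv a).crossZ_eq (hm a).1 hi]
    rw [scaled_cornerPiece (huv a).crossZ_eq (hm a).1 hi]
    exact (pairs (m a * i)).finite_toSet.image _
  · rw [latticeSum, latticeSum, finsum_scaled_cut hdec huv hm hi]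
    congr 1
    refine Finset.sum_congr rfl fun a _ => ?_
    rw [cutPiece, hN a, sum_scaled_cornerPiece (huv a).crossZ_eq (hm a).1 hi]

/-- Both counts have the area as i² coefficient and both lattice sums the moment, so the i² terms
cancel in each weight. The area of kΔ' is B/2 and the linear coefficient of its count is A/2, which
is how A and B enter. -/
theorem chow_cut (hdec : IsCornerDecomposition Δ Δ' D p k)
    (huv : ∀ a, IsOrientedEdgeBasis Δ (p a) (u a) (v a)) (hm : IsCornerSize D p k u v m) {i : ℕ}
    (hi : 0 < i) :
    chow ((k : ℝ) • Δ') i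
        = chow ((k : ℝ) • Δ) i + (i : ℝ) • DF1 Δ k m p u v + DF2 Δ k m p u v := by
  have hP := hdec.delzant.1.natCast_smul hdec.pos
  obtain ⟨h1, h2⟩ := area_moment_cut hdec huv hm
  obtain ⟨h3, h4⟩ := ehrhart_latticeSum_cut hdec huv hm hi
  obtain ⟨s, hs⟩ := exists_latticeSum_const hP
  have h5 := (hs i hi).1
  have h6 := (latticeSumPolynomial_spec hP).2 i hi
  have k1 : ∑ a, (m a : ℝ) ^ 2 / 2 = sumMSq m / 2 := by rw [sumMSq, Finset.sum_div]
  have k3 : ∑ a, (m a * i : ℝ) * (m a * i + 1) / 2 = (i : ℝ) ^ 2 / 2 * sumMSq m + i / 2 * sumM m := by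
    rw [sumMSq, sumM, Finset.mul_sum, Finset.mul_sum, ← Finset.sum_add_distrib]
    refine Finset.sum_congr rfl fun a _ => by ring
  set X3 := ∑ a, (m a : ℝ) ^ 3 • (toPlane (u a) + toPlane (v a)) with hX3
  set X1 := ∑ a, (m a : ℝ) • (toPlane (u a) + toPlane (v a)) with hX1
  set p2 := ∑ a, (m a : ℝ) ^ 2 • p a with hp2
  set p1 := ∑ a, (m a : ℝ) • p a with hp1
  have k2 : ∑ a, (((m a : ℝ) ^ 2 / 2) • (k : ℝ) • p a +
      ((m a : ℝ) ^ 3 / 6) • (toPlane (u a) + toPlane (v a))) = ((k : ℝ) / 2) • p2 + (1 / 6 : ℝ) • X3 := by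
    rw [hp2, hX3, Finset.smul_sum, Finset.smul_sum, ← Finset.sum_add_distrib]
    refine Finset.sum_congr rfl fun a _ => by module
  have k4 : ∑ a, (((m a * i : ℝ) * (m a * i + 1) / 2) • (k : ℝ) • p a +
        (((m a : ℝ) ^ 3 * i ^ 2 - m a) / 6) • (toPlane (u a) + toPlane (v a))) =
      ((k : ℝ) / 2 * i ^ 2) • p2 + ((k : ℝ) / 2 * i) • p1 + ((i : ℝ) ^ 2 / 6) • X3 - (1 / 6 : ℝ) • X1 := by
    rw [hp2, hp1, hX3, hX1, Finset.smul_sum, Finset.smul_sum, Finset.smul_sum, Finset.smul_sum,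
      ← Finset.sum_add_distrib, ← Finset.sum_add_distrib, ← Finset.sum_sub_distrib]
    refine Finset.sum_congr rfl fun a _ => by module
  rw [k1] at h1
  rw [k2] at h2
  rw [k3] at h3
  rw [k4] at h4
  have e1 : area ((k : ℝ) • Δ') = area ((k : ℝ) • Δ) - sumMSq m / 2 := by linarith
  have e2 := eq_sub_of_add_eq h2.symm
  have e3 : (ehrhart ((k : ℝ) • Δ') i : ℝ) = ehrhart ((k : ℝ) • Δ) i -
      ((i : ℝ) ^ 2 / 2 * sumMSq m + i / 2 * sumM m) := by linarith
  have e4 := eq_sub_of_add_eq h4.symm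
  -- Everything is now expressed through kΔ, the sums over corners and i, and the claim is an
  -- identity of polynomials in i.
  rw [chow, chow, e1, e2, e3, e4, h5, h6, DF1, DF2, ← hX3, ← hX1, ← hp2, ← hp1, invA, invB]
  module

end Decomposition

end ChowBlowUp
end

open ChowBlowUp in
theorem theorem3p2 {ℓ : ℕ} (Δ Δ' : Set Plane) (D : Fin ℓ → Set Plane) (p : Fin ℓ → Plane) (k : ℕ)
    (hdec : IsCornerDecomposition Δ Δ' D p k)
    (u v : Fin ℓ → Fin 2 → ℤ) (huv : ∀ a, IsOrientedEdgeBasis Δ (p a) (u a) (v a)) :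
    IsLatticeSumPolynomial ((k : ℝ) • Δ) (latticeSumPolynomial ((k : ℝ) • Δ)) ∧
    (∃! m : Fin ℓ → ℕ, IsCornerSize D p k u v m) ∧
    ∀ m : Fin ℓ → ℕ, IsCornerSize D p k u v m → ∀ i : ℕ, 0 < i →
      chow ((k : ℝ) • Δ') i
        = chow ((k : ℝ) • Δ) i + (i : ℝ) • DF1 Δ k m p u v + DF2 Δ k m p u v :=
  ⟨(latticeSumPolynomial_spec (hdec.delzant.1.natCast_smul hdec.pos)).1,
    existsUnique_cornerSize hdec huv, fun _ hm _ hi => chow_cut hdec huv hm hi⟩
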